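/- Let $f$ be a complex-valued function on $(0,\infty)$ with the following properties. (i) $f$ is an $L$-function in the sense of Doetsch: $f$ is Riemann integrable on every interval $[T_1,T_2]$ with $0<T_1<T_2<\infty$; the improper integral $\lim_{\epsilon\to0^+}\int_\epsilon^T|f(t)|\,dt$ exists for every $T\in(0,\infty)$; and there are $s_0\in\mathbb C$ and $T>0$ such that $\lim_{\omega\to\infty}\int_T^\omega|f(t)|e^{-s_0t}\,dt$ exists. (ii) $f$ is regulated: the left and right limits $f(t-)$ and $f(t+)$ exist at every $t>0$. (iii) $f$ has compact support in $[0,\infty)$, i.e. $f(t)=0$ for all sufficiently large $t$. (iv) $f(t)\sim Bt^\beta L(t)$ as $t\to0^+$, in the sense that $f(t)/(t^\beta L(t))\to B$, for some $\beta>0$, some $B\in\mathbb C$, and some real function $L$ that is slowly varying at $0$: $L$ is continuous and positive on some interval $(0,\delta)$, and $L(ut)/L(t)\to1$ as $t\to0^+$ for every $u>0$. Then the Laplace transform $\tilde f(s)=\int_0^\infty e^{-st}f(t)\,dt$ converges absolutely for every $s\in\mathbb C$, and the Voronoï summation formula $$\sum_{n=1}^\infty d(n)\tilde f(n)=\int_0^\infty(\ln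 k+2\gamma)\tilde f(k)\,dk+\frac{\tilde f(0)}4+2\pi\sum_{n=1}^\infty d(n)\int_0^\infty\Bigl[\frac2\pi K_0\bigl(4\pi\sqrt{nk}\bigr)-Y_0\bigl(4\pi\sqrt{nk}\bigr)\Bigr]\tilde f(k)\,dk$$ holds, where both series and all the integrals converge absolutely. Here $d(n)$ is the number of positive divisors of $n$, $\gamma$ is the Euler constant, $K_0$ is the McDonald function (modified Bessel function of the second kind) and $Y_0$ is the Neumann function (Bessel function of the second kind). -/

import Mathlib

open Filter Topology MeasureTheory Set

/-- An `L`-function in the sense of Doetsch. Only the values `f t` for `t > 0` matter.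
The boxes `I` in dimension one are exactly the intervals `[T₁, T₂]` with `T₁ < T₂`, and
`IntegrationParams.Riemann` is the classical Riemann integral (tagged partitions with mesh tending
to zero). Once `f` is Riemann integrable on compact subintervals of `(0, ∞)`, the interval
integrals below are the Riemann integrals. -/
structure IsLFunction (f : ℝ → ℂ) : Prop where
  riemann_integrable : ∀ I : BoxIntegral.Box (Fin 1), 0 < I.lower 0 →
    BoxIntegral.Integrable I BoxIntegral.IntegrationParams.Riemann
      (fun x : Fin 1 → ℝ => f (x 0)) (BoxIntegral.BoxAdditiveMap.volume (E := ℂ))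
  improper_zero : ∀ T : ℝ, 0 < T →
    ∃ l : ℝ, Tendsto (fun ε : ℝ => ∫ t in ε..T, ‖f t‖) (𝓝[>] 0) (𝓝 l)
  improper_top : ∃ s₀ : ℂ, ∃ T : ℝ, 0 < T ∧
    ∃ l : ℂ, Tendsto (fun ω : ℝ => ∫ t in T..ω, (‖f t‖ : ℂ) * Complex.exp (-s₀ * (t : ℂ)))
      atTop (𝓝 l)

/-- A function on `(0, ∞)` is regulated if it has a left and a right limit at every point. -/
def IsRegulatedOnPos (f : ℝ → ℂ) : Prop :=
  ∀ t : ℝ, 0 < t →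
    (∃ l : ℂ, Tendsto f (𝓝[<] t) (𝓝 l)) ∧ (∃ r : ℂ, Tendsto f (𝓝[>] t) (𝓝 r))

/-- `L` is slowly varying at `0`: continuous and positive on some `(0, δ)`, with
`L (u t) / L t → 1` as `t → 0⁺` for every `u > 0`. -/
structure IsSlowlyVaryingAtZero (L : ℝ → ℝ) : Prop where
  continuous_pos : ∃ δ : ℝ, 0 < δ ∧ ContinuousOn L (Ioo 0 δ) ∧ ∀ t ∈ Ioo 0 δ, 0 < L t
  ratio : ∀ u : ℝ, 0 < u → Tendsto (fun t : ℝ => L (u * t) / L t) (𝓝[>] 0) (𝓝 1)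

/-- The Laplace transform `∫₀^∞ e^{-st} f(t) dt`. -/
noncomputable def laplaceTransform (f : ℝ → ℂ) (s : ℂ) : ℂ :=
  ∫ t in Ioi (0 : ℝ), Complex.exp (-s * (t : ℂ)) * f t

/-- The Bessel function `J₀`. -/
noncomputable def besselJZero (x : ℝ) : ℝ :=
  ∑' m : ℕ, (-1 : ℝ) ^ m * (x ^ 2 / 4) ^ m / (m.factorial : ℝ) ^ 2

/-- The Neumann function `Y₀` for `x > 0`:
`(2/π) (ln (x/2) + γ) J₀(x) - (2/π) ∑_{m ≥ 1} (-1)^m H_m (x²/4)^m / (m!)²`, where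
`H_m = 1 + 1/2 + ⋯ + 1/m` (and `H_0 = 0`). -/
noncomputable def besselYZero (x : ℝ) : ℝ :=
  2 / Real.pi * (Real.log (x / 2) + Real.eulerMascheroniConstant) * besselJZero x
    - 2 / Real.pi * ∑' m : ℕ,
        (-1 : ℝ) ^ m * (harmonic m : ℝ) * (x ^ 2 / 4) ^ m / (m.factorial : ℝ) ^ 2

/-- The McDonald function `K₀(x) = ∫₀^∞ e^{-x cosh u} du` for `x > 0`. -/
noncomputable def besselKZero (x : ℝ) : ℝ :=
  ∫ u in Ioi (0 : ℝ), Real.exp (-x * Real.cosh u)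

/-- The kernel `(2/π) K₀(4π√(nk)) - Y₀(4π√(nk))`. -/
noncomputable def voronoiKernel (n : ℕ+) (k : ℝ) : ℝ :=
  2 / Real.pi * besselKZero (4 * Real.pi * Real.sqrt ((n : ℝ) * k))
    - besselYZero (4 * Real.pi * Real.sqrt ((n : ℝ) * k))

/-! The transform `f̃(k)` is a superposition of the exponentials `e^{-tk}`, so the formula is proved
for one exponential and then integrated against `f(t) dt`. Put `g(x) = x/(1+x²)` and let `C(z)`
(`cosConjLorentz`) be the conditionally convergent `∫₀^∞ g(x) cos(zx) dx`. For `e^{-tk}` the formula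
becomes `∑ d(n) e^{-nt} = (γ - log t)/t + 1/4 + (4/t) ∑ d(n) C(4π²n/t)`, together with the
evaluation of the Laplace transform of the kernel in terms of `C`.

Arithmetic side (`hasSum_card_divisors_mul_exp`): the left side is the Lambert series `∑ 1/(e^{mt} -
1)`. Partial fractions turn each summand into a series over `k` of `y/(y² + c²)` at `y = m`, with `c
= 2πk/t`. Summing over `m` by the trapezoidal rule with exact remainder brings in a Peano kernel
with an explicit Fourier series; its `l`-th mode contributes `C(4π²kl/t)`, and collecting `kl = n`
restores the divisor function.

Analytic side (`integral_voronoiKernel_mul_exp`): with `z = 4π²n/t`, the transforms of the `K₀` and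
`Y₀` parts are multiples of `e^z E₁(z)` and `e^{-z} Ei(z)`, and `e^z E₁(z) - e^{-z} Ei(z) = 2 C(z)`
by comparing differential equations (`expMulE1_sub_expMulEi`).

Exchange of sums and integrals: on a bounded range of `t` everything is dominated by the weight `(1
+ |log t|)/t`. The behaviour of `f` at `0` makes it integrable against this weight
(`integrableOn_norm_mul_log_div`), and `C(4π²n/t) = O(t²/n²)` makes the dual series converge
absolutely. -/

/-! ### Regulated functions: measurability and local boundedness. -/

section Regulated

/-- Sampling `f` at the next grid point strictly to the right of `t`, on a grid of mesh `1/(n+1)`,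
gives step functions converging pointwise to the right limit `g`. Then `f = g` off a null set. -/
theorem IsRegulatedOnPos.aestronglyMeasurable {f : ℝ → ℂ} (hf : IsRegulatedOnPos f) :
    AEStronglyMeasurable f (volume.restrict (Ioi 0)) := by
  choose! g hg using fun t ht => (hf t ht).2
  choose! h hh using fun t ht => (hf t ht).1
  have hmeas : ∀ n : ℕ, Measurable
      (fun t : ℝ => f (((⌊((n : ℝ) + 1) * t⌋ : ℝ) + 1) / ((n : ℝ) + 1))) := fun n =>
    (measurable_of_countable (fun k : ℤ => f (((k : ℝ) + 1) / ((n : ℝ) + 1)))).comp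
      ((measurable_id.const_mul _).floor)
  have hlim : ∀ t ∈ Ioi (0 : ℝ), Tendsto
      (fun n : ℕ => f (((⌊((n : ℝ) + 1) * t⌋ : ℝ) + 1) / ((n : ℝ) + 1))) atTop (𝓝 (g t)) := by
    intro t ht
    refine (hg t ht).comp (tendsto_nhdsWithin_iff.2 ⟨?_, Eventually.of_forall fun n => ?_⟩)
    · have h1 : Tendsto (fun n : ℕ => t + 1 / ((n : ℝ) + 1)) atTop (𝓝 t) := by
        simpa using tendsto_const_nhds.add (tendsto_one_div_add_atTop_nhds_zero_nat (𝕜 := ℝ))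
      refine tendsto_of_tendsto_of_tendsto_of_le_of_le tendsto_const_nhds h1 (fun n => ?_)
        (fun n => ?_)
      · have hn : (0 : ℝ) < n + 1 := by positivity
        simp only
        rw [le_div_iff₀ hn]
        nlinarith [Int.lt_floor_add_one (((n : ℝ) + 1) * t)]
      · have hn : (0 : ℝ) < n + 1 := by positivity
        simp only
        rw [div_le_iff₀ hn]
        have h2 : (t + 1 / ((n : ℝ) + 1)) * (n + 1) = t * (n + 1) + 1 := by field_simp
        nlinarith [Int.floor_le (((n : ℝ) + 1) * t)]
    · have hn : (0 : ℝ) < n + 1 := by positivity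
      simp only [mem_Ioi]
      rw [lt_div_iff₀ hn]
      nlinarith [Int.lt_floor_add_one (((n : ℝ) + 1) * t)]
  have hgm : AEStronglyMeasurable g (volume.restrict (Ioi 0)) :=
    aestronglyMeasurable_of_tendsto_ae atTop
      (fun n => (hmeas n).aestronglyMeasurable)
      ((ae_restrict_iff' measurableSet_Ioi).2 (Eventually.of_forall hlim))
  refine hgm.congr ?_
  rw [Filter.EventuallyEq, ae_restrict_iff' measurableSet_Ioi]
  -- the exceptional sets consist of isolated points
  have key : ∀ ε : ℝ, 0 < ε → volume {t : ℝ | 0 < t ∧ ε < dist (g t) (f t)} = 0 := by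
    intro ε hε
    refine measure_null_of_locally_null _ fun s hs => ?_
    refine ⟨{s}, ?_, by simp⟩
    -- On one side of `s`, `f` stays within `ε/2` of its one-sided limit. So does `g`, a limit of
    -- values of `f` taken on the same side because `u` is open.
    have aux : ∀ (l : ℂ) (u : Set ℝ), IsOpen u → u ⊆ Ioi 0 → Tendsto f (𝓝[u] s) (𝓝 l) →
        ∀ᶠ t in 𝓝[u] s, dist (g t) (f t) ≤ ε := by
      intro l u hu hu0 hl
      have h1 : ∀ᶠ t in 𝓝[u] s, dist (f t) l < ε / 2 := (Metric.tendsto_nhds.1 hl) _ (half_pos hε)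
      have h2 := eventually_eventually_nhdsWithin.2 h1
      filter_upwards [h1, h2, self_mem_nhdsWithin] with t ht1 ht2 ht3
      rw [hu.nhdsWithin_eq ht3] at ht2
      have h3 : dist (g t) l ≤ ε / 2 :=
        le_of_tendsto ((hg t (hu0 ht3)).dist tendsto_const_nhds)
          ((ht2.filter_mono nhdsWithin_le_nhds).mono fun x hx => hx.le)
      have := dist_triangle_right (g t) (f t) l
      linarith
    have hs0 : 0 < s := hs.1
    have hR := aux (g s) (Ioi s) isOpen_Ioi (Ioi_subset_Ioi hs0.le) (hg s hs0)
    have hI : 𝓝[Ioo 0 s] s = 𝓝[<] s := nhdsWithin_Ioo_eq_nhdsLT hs0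
    have hL := aux (h s) (Ioo 0 s) isOpen_Ioo (fun x hx => hx.1) (by rw [hI]; exact hh s hs0)
    rw [hI] at hL
    have hLR : ∀ᶠ t in 𝓝[≠] s, dist (g t) (f t) ≤ ε := by
      rw [← nhdsLT_sup_nhdsGT]
      exact eventually_sup.2 ⟨hL, hR⟩
    rw [eventually_nhdsWithin_iff] at hLR
    change ∀ᶠ x in 𝓝[_] s, x ∈ ({s} : Set ℝ)
    rw [eventually_nhdsWithin_iff]
    filter_upwards [hLR] with x hx hxs
    by_contra hne
    exact absurd (hx hne) (not_le.2 hxs.2)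
  have h0 : volume (⋃ n : ℕ, {t : ℝ | 0 < t ∧ 1 / ((n : ℝ) + 1) < dist (g t) (f t)}) = 0 :=
    measure_iUnion_null fun n => key _ (by positivity)
  filter_upwards [measure_eq_zero_iff_ae_notMem.1 h0] with t ht ht0
  by_contra hne
  obtain ⟨n, hn⟩ := exists_nat_one_div_lt (dist_pos.2 hne)
  exact ht (mem_iUnion.2 ⟨n, ht0, hn⟩)

theorem IsRegulatedOnPos.bddAbove_norm {f : ℝ → ℂ} (hf : IsRegulatedOnPos f) {a b : ℝ}
    (ha : 0 < a) : ∃ C : ℝ, ∀ t ∈ Icc a b, ‖f t‖ ≤ C := by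
  refine isCompact_Icc.induction_on (p := fun s => ∃ C : ℝ, ∀ t ∈ s, ‖f t‖ ≤ C) ⟨0, by simp⟩
    (fun s t hst ⟨C, hC⟩ => ⟨C, fun x hx => hC x (hst hx)⟩)
    (fun s t ⟨C, hC⟩ ⟨D, hD⟩ => ⟨max C D, fun x hx => hx.elim
      (fun h => (hC x h).trans (le_max_left _ _)) (fun h => (hD x h).trans (le_max_right _ _))⟩)
    fun s hs => ?_
  obtain ⟨⟨l, hl⟩, r, hr⟩ := hf s (ha.trans_le hs.1)
  have h1 : ∀ᶠ t in 𝓝[<] s, ‖f t‖ < ‖l‖ + 1 := hl.norm.eventually_lt_const (by simp)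
  have h2 : ∀ᶠ t in 𝓝[>] s, ‖f t‖ < ‖r‖ + 1 := hr.norm.eventually_lt_const (by simp)
  have h3 : ∀ᶠ t in 𝓝[≠] s, ‖f t‖ ≤ max (‖l‖ + 1) (‖r‖ + 1) := by
    rw [← nhdsLT_sup_nhdsGT]
    exact eventually_sup.2 ⟨h1.mono fun x hx => hx.le.trans (le_max_left _ _),
      h2.mono fun x hx => hx.le.trans (le_max_right _ _)⟩
  rw [eventually_nhdsWithin_iff] at h3
  refine ⟨_, mem_nhdsWithin_of_mem_nhds h3,
    max (max (‖l‖ + 1) (‖r‖ + 1)) ‖f s‖, fun x hx => ?_⟩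
  by_cases hxs : x = s
  · rw [hxs]; exact le_max_right _ _
  · exact (hx hxs).trans (le_max_left _ _)

end Regulated

/-! ### Growth of slowly varying functions at zero. -/

section SlowlyVarying

/-- The ratio condition at `u = 1/2` alone suffices: halving a small argument multiplies `L` by at
most `2^ε`, and iterating from the compact interval `[δ/2, δ]`, where `L` is bounded by continuity,
reaches every smaller argument. -/
theorem IsSlowlyVaryingAtZero.le_rpow_neg {L : ℝ → ℝ} (hL : IsSlowlyVaryingAtZero L) {ε : ℝ}
    (hε : 0 < ε) : ∃ C δ : ℝ, 0 < δ ∧ ∀ t ∈ Ioo 0 δ, 0 < L t ∧ L t ≤ C * t ^ (-ε) := by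
  obtain ⟨δ₁, hδ₁, hcont, hpos⟩ := hL.continuous_pos
  have h2 : (1 : ℝ) < 2 ^ ε := Real.one_lt_rpow one_lt_two hε
  have hr := (hL.ratio (1 / 2) (by norm_num)).eventually_lt_const h2
  obtain ⟨δ₂, hδ₂, hr2⟩ := mem_nhdsGT_iff_exists_Ioo_subset.1 hr
  obtain ⟨δ, hδ, hδ'⟩ : ∃ δ : ℝ, 0 < δ ∧ δ < min δ₁ δ₂ := exists_between (lt_min hδ₁ hδ₂)
  have hd1 : δ < δ₁ := hδ'.trans_le (min_le_left _ _)
  have hd2 : δ < δ₂ := hδ'.trans_le (min_le_right _ _)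
  obtain ⟨M, hM⟩ := (isCompact_Icc (a := δ / 2) (b := δ)).bddAbove_image
    (hcont.mono fun x hx => ⟨(half_pos hδ).trans_le hx.1, hx.2.trans_lt hd1⟩)
  have hM' : ∀ t ∈ Icc (δ / 2) δ, L t ≤ M := fun t ht => hM ⟨t, ht, rfl⟩
  have hM0 : 0 < M := (hpos δ ⟨hδ, hd1⟩).trans_le (hM' δ ⟨by linarith, le_rfl⟩)
  have step : ∀ t ∈ Ioc 0 δ, L (t / 2) ≤ 2 ^ ε * L t := by
    intro t ht
    have h3 : L (1 / 2 * t) / L t < 2 ^ ε := hr2 ⟨ht.1, ht.2.trans_lt hd2⟩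
    rw [div_lt_iff₀ (hpos t ⟨ht.1, ht.2.trans_lt hd1⟩)] at h3
    rw [show t / 2 = 1 / 2 * t by ring]
    exact h3.le
  have iter : ∀ n : ℕ, ∀ s ∈ Icc (δ / 2) δ, L (s / 2 ^ n) ≤ (2 ^ ε) ^ n * M := by
    intro n
    induction n with
    | zero => intro s hs; simpa using hM' s hs
    | succ n ih =>
      intro s hs
      have hs0 : 0 < s := (half_pos hδ).trans_le hs.1
      have h4 := step (s / 2 ^ n)
        ⟨by positivity, (div_le_self hs0.le (one_le_pow₀ (by norm_num))).trans hs.2⟩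
      rw [pow_succ, ← div_div]
      refine h4.trans ?_
      rw [pow_succ, mul_comm _ ((2 : ℝ) ^ ε), mul_assoc]
      exact mul_le_mul_of_nonneg_left (ih s hs) (by positivity)
  refine ⟨M * δ ^ ε, δ, hδ, fun t ht => ⟨hpos t ⟨ht.1, ht.2.trans hd1⟩, ?_⟩⟩
  -- This choice of `n` puts `2^n t` in `[δ/2, δ]`, so `n` halvings lead from there down to `t`.
  obtain ⟨n, hn1, hn2⟩ := exists_nat_pow_near (x := δ / t) (y := (2 : ℝ))
    ((one_le_div ht.1).2 ht.2.le) one_lt_two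
  have hp : (0 : ℝ) < 2 ^ n := by positivity
  rw [le_div_iff₀ ht.1] at hn1
  rw [div_lt_iff₀ ht.1, pow_succ] at hn2
  have h5 := iter n (t * 2 ^ n) ⟨by nlinarith, by linarith⟩
  rw [mul_div_cancel_right₀ _ hp.ne'] at h5
  refine h5.trans ?_
  have h6 : ((2 : ℝ) ^ ε) ^ n = (2 ^ n : ℝ) ^ ε := by
    rw [← Real.rpow_natCast, ← Real.rpow_mul two_pos.le, mul_comm, Real.rpow_mul two_pos.le,
      Real.rpow_natCast]
  rw [h6, mul_comm, mul_assoc]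
  refine mul_le_mul_of_nonneg_left ?_ hM0.le
  rw [Real.rpow_neg ht.1.le, ← div_eq_mul_inv, ← Real.div_rpow hδ.le ht.1.le]
  refine Real.rpow_le_rpow hp.le ?_ hε.le
  rw [le_div_iff₀ ht.1]; exact hn1

end SlowlyVarying

/-! ### Integrability of `f` against the logarithmic weight. -/

section Weighted

/-- Near `0` the exponent `β` is shared out: `β/2` absorbs `L`, `β/4` absorbs the logarithm, and the
remaining `β/4` leaves the integrable bound `t^(β/4 - 1)`. Elsewhere `f` is bounded or zero. -/
theorem integrableOn_norm_mul_log_div {f : ℝ → ℂ} (hreg : IsRegulatedOnPos f)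
    (hsupp : ∃ T : ℝ, ∀ t : ℝ, T < t → f t = 0) {B : ℂ} {β : ℝ} (hβ : 0 < β) {L : ℝ → ℝ}
    (hL : IsSlowlyVaryingAtZero L)
    (hasymp : Tendsto (fun t : ℝ => f t / ((t ^ β * L t : ℝ) : ℂ)) (𝓝[>] 0) (𝓝 B)) :
    IntegrableOn (fun t : ℝ => ‖f t‖ * ((1 + |Real.log t|) / t)) (Ioi 0) := by
  obtain ⟨T, hT⟩ := hsupp
  obtain ⟨C, δ₁, hδ₁, hC⟩ := hL.le_rpow_neg (half_pos hβ)
  have h1 := hasymp.norm.eventually_lt_const (lt_add_one ‖B‖)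
  obtain ⟨δ₂, hδ₂, h2⟩ := mem_nhdsGT_iff_exists_Ioo_subset.1 h1
  set δ := min (min δ₁ δ₂) 1 with hδdef
  have hδ : 0 < δ := lt_min (lt_min hδ₁ hδ₂) one_pos
  have hm : AEStronglyMeasurable (fun t : ℝ => ‖f t‖ * ((1 + |Real.log t|) / t))
      (volume.restrict (Ioi 0)) :=
    hreg.aestronglyMeasurable.norm.mul (by
      have : Measurable (fun t : ℝ => (1 + |Real.log t|) / t) := by fun_prop
      exact this.aestronglyMeasurable)
  have hsmall : IntegrableOn (fun t : ℝ => ‖f t‖ * ((1 + |Real.log t|) / t)) (Ioo 0 δ) := by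
    have hi : IntegrableOn (fun t : ℝ => (‖B‖ + 1) * C * (1 + 4 / β) * t ^ (β / 4 - 1))
        (Ioo 0 δ) :=
      ((intervalIntegral.integrableOn_Ioo_rpow_iff hδ).2 (by linarith)).const_mul _
    refine Integrable.mono' hi (hm.mono_set Ioo_subset_Ioi_self) ?_
    refine (ae_restrict_iff' measurableSet_Ioo).2 (Eventually.of_forall fun t ht => ?_)
    have ht0 : 0 < t := ht.1
    have htd1 : t < δ₁ := ht.2.trans_le ((min_le_left _ _).trans (min_le_left _ _))
    have htd2 : t < δ₂ := ht.2.trans_le ((min_le_left _ _).trans (min_le_right _ _))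
    have ht1 : t ≤ 1 := ht.2.le.trans (min_le_right _ _)
    obtain ⟨hLp, hLb⟩ := hC t ⟨ht0, htd1⟩
    have h3 : ‖f t / ((t ^ β * L t : ℝ) : ℂ)‖ < ‖B‖ + 1 := h2 ⟨ht0, htd2⟩
    have hpos : 0 < t ^ β * L t := by positivity
    rw [norm_div, Complex.norm_real, Real.norm_of_nonneg hpos.le, div_lt_iff₀ hpos] at h3
    have h4 : ‖f t‖ ≤ (‖B‖ + 1) * (C * t ^ (β / 2)) := by
      refine h3.le.trans (mul_le_mul_of_nonneg_left ?_ (by positivity))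
      calc t ^ β * L t ≤ t ^ β * (C * t ^ (-(β / 2))) :=
            mul_le_mul_of_nonneg_left hLb (by positivity)
        _ = C * (t ^ β * t ^ (-(β / 2))) := by ring
        _ = C * t ^ (β / 2) := by rw [← Real.rpow_add ht0]; congr 2; ring
    have h5 : 1 + |Real.log t| ≤ (1 + 4 / β) * t ^ (-(β / 4)) := by
      have h6 := (Real.abs_log_mul_self_rpow_lt t (β / 4) ht0 ht1 (by positivity)).le
      have h7 : (1 : ℝ) ≤ t ^ (-(β / 4)) :=
        Real.one_le_rpow_of_pos_of_le_one_of_nonpos ht0 ht1 (by linarith)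
      rw [abs_mul, abs_of_pos (Real.rpow_pos_of_pos ht0 _)] at h6
      have h8 : |Real.log t| = |Real.log t| * t ^ (β / 4) * t ^ (-(β / 4)) := by
        rw [mul_assoc, ← Real.rpow_add ht0]; simp
      rw [add_mul, one_mul, h8]
      refine add_le_add h7 (mul_le_mul_of_nonneg_right (h6.trans_eq ?_) (by positivity))
      field_simp
    have hC0 : 0 ≤ C := by
      by_contra hneg
      have : C * t ^ (-(β / 2)) ≤ 0 :=
        mul_nonpos_of_nonpos_of_nonneg (not_le.1 hneg).le (by positivity)
      linarith
    rw [Real.norm_of_nonneg (by positivity)]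
    calc ‖f t‖ * ((1 + |Real.log t|) / t)
        ≤ ((‖B‖ + 1) * (C * t ^ (β / 2))) * (((1 + 4 / β) * t ^ (-(β / 4))) / t) := by gcongr
      _ = (‖B‖ + 1) * C * (1 + 4 / β) * (t ^ (β / 2) * t ^ (-(β / 4)) * t ^ (-1 : ℝ)) := by
          rw [Real.rpow_neg_one]; ring
      _ = _ := by rw [← Real.rpow_add ht0, ← Real.rpow_add ht0]; congr 2; ring
  have hmid : IntegrableOn (fun t : ℝ => ‖f t‖ * ((1 + |Real.log t|) / t)) (Icc δ T) := by
    obtain ⟨D, hD⟩ := hreg.bddAbove_norm (b := T) hδ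
    have hc : ContinuousOn (fun t : ℝ => (1 + |Real.log t|) / t) (Icc δ T) := by
      have : ∀ t ∈ Icc δ T, t ≠ 0 := fun t ht => (hδ.trans_le ht.1).ne'
      fun_prop (disch := assumption)
    refine Integrable.mono' ((hc.integrableOn_Icc).const_mul D)
      (hm.mono_set fun t ht => hδ.trans_le ht.1) ?_
    refine (ae_restrict_iff' measurableSet_Icc).2 (Eventually.of_forall fun t ht => ?_)
    have ht0 : 0 < t := hδ.trans_le ht.1
    rw [Real.norm_of_nonneg (by positivity)]
    exact mul_le_mul_of_nonneg_right (hD t ht) (by positivity)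
  have hbig : IntegrableOn (fun t : ℝ => ‖f t‖ * ((1 + |Real.log t|) / t)) (Ioi T) :=
    integrableOn_zero.congr_fun (fun t ht => by simp [hT t ht]) measurableSet_Ioi
  refine ((hsmall.union hmid).union hbig).mono_set fun t ht => ?_
  by_cases h8 : t < δ
  · exact Or.inl (Or.inl ⟨ht, h8⟩)
  · by_cases h9 : t ≤ T
    · exact Or.inl (Or.inr ⟨not_lt.1 h8, h9⟩)
    · exact Or.inr (not_le.1 h9)

end Weighted

/-! ### Sine and cosine transforms of `1/(1+x²)` and `x/(1+x²)`. -/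

section FourierKernels

/-- `h` is continuous and `O(1 / (1 + x²))`. -/
structure QuadDecay (h : ℝ → ℝ) : Prop where
  cont : Continuous h
  bound : ∃ C : ℝ, ∀ x, |h x| ≤ C * (1 + x ^ 2)⁻¹

/-- The half-line sine transform. -/
noncomputable def sinTransform (h : ℝ → ℝ) (z : ℝ) : ℝ := ∫ x in Ioi (0 : ℝ), h x * Real.sin (z * x)

/-- The half-line cosine transform. -/
noncomputable def cosTransform (h : ℝ → ℝ) (z : ℝ) : ℝ := ∫ x in Ioi (0 : ℝ), h x * Real.cos (z * x)

namespace QuadDecay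

variable {h h' : ℝ → ℝ}

theorem integrableOn (hh : QuadDecay h) : IntegrableOn h (Ioi 0) := by
  obtain ⟨C, hC⟩ := hh.bound
  exact (Integrable.mono' (integrable_inv_one_add_sq.const_mul C) hh.cont.aestronglyMeasurable
    (Eventually.of_forall fun x => hC x)).integrableOn

theorem integrableOn_mul (hh : QuadDecay h) {w : ℝ → ℝ} (hw : Continuous w)
    (hw1 : ∀ x, |w x| ≤ 1) : IntegrableOn (fun x => h x * w x) (Ioi 0) :=
  (hh.integrableOn.norm).mono' (hh.cont.mul hw).aestronglyMeasurable
    (Eventually.of_forall fun x => by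
      rw [norm_mul]; exact mul_le_of_le_one_right (norm_nonneg _) (hw1 x))

theorem integrableOn_mul_sin (hh : QuadDecay h) (z : ℝ) :
    IntegrableOn (fun x => h x * Real.sin (z * x)) (Ioi 0) :=
  hh.integrableOn_mul (by fun_prop) fun _ => Real.abs_sin_le_one _

theorem integrableOn_mul_cos (hh : QuadDecay h) (z : ℝ) :
    IntegrableOn (fun x => h x * Real.cos (z * x)) (Ioi 0) :=
  hh.integrableOn_mul (by fun_prop) fun _ => Real.abs_cos_le_one _

theorem abs_sinTransform_le (hh : QuadDecay h) (z : ℝ) :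
    |sinTransform h z| ≤ ∫ x in Ioi (0 : ℝ), |h x| := by
  rw [sinTransform, ← Real.norm_eq_abs]
  refine norm_integral_le_of_norm_le hh.integrableOn.norm (Eventually.of_forall fun x => ?_)
  rw [norm_mul]
  exact mul_le_of_le_one_right (norm_nonneg _) (Real.abs_sin_le_one _)

theorem hasDerivAt_sinTransform (hh : QuadDecay h) (hx : QuadDecay fun x => x * h x) (z : ℝ) :
    HasDerivAt (sinTransform h) (cosTransform (fun x => x * h x) z) z := by
  refine (hasDerivAt_integral_of_dominated_loc_of_deriv_le (F := fun z x => h x * Real.sin (z * x))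
    (F' := fun z x => x * h x * Real.cos (z * x)) (bound := fun x => |x * h x|) univ_mem
    (Eventually.of_forall fun y => (hh.integrableOn_mul_sin y).aestronglyMeasurable)
    (hh.integrableOn_mul_sin z) (hx.integrableOn_mul_cos z).aestronglyMeasurable
    (Eventually.of_forall fun x y _ => ?_) hx.integrableOn.norm
    (Eventually.of_forall fun x y _ => ?_)).2
  · rw [norm_mul]; exact mul_le_of_le_one_right (norm_nonneg _) (Real.abs_cos_le_one _)
  · have := (((hasDerivAt_id y).mul_const x).sin).const_mul (h x)
    refine this.congr_deriv ?_
    simp only [id]; ring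

theorem hasDerivAt_cosTransform (hh : QuadDecay h) (hx : QuadDecay fun x => x * h x) (z : ℝ) :
    HasDerivAt (cosTransform h) (-sinTransform (fun x => x * h x) z) z := by
  have := (hasDerivAt_integral_of_dominated_loc_of_deriv_le
    (F := fun z x => h x * Real.cos (z * x))
    (F' := fun z x => -(x * h x * Real.sin (z * x))) (bound := fun x => |x * h x|) univ_mem
    (Eventually.of_forall fun y => (hh.integrableOn_mul_cos y).aestronglyMeasurable)
    (hh.integrableOn_mul_cos z) (hx.integrableOn_mul_sin z).neg.aestronglyMeasurable
    (Eventually.of_forall fun x y _ => ?_) hx.integrableOn.norm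
    (Eventually.of_forall fun x y _ => ?_)).2
  · rw [integral_neg] at this; exact this
  · rw [norm_neg, norm_mul]; exact mul_le_of_le_one_right (norm_nonneg _) (Real.abs_sin_le_one _)
  · have := (((hasDerivAt_id y).mul_const x).cos).const_mul (h x)
    refine this.congr_deriv ?_
    simp only [id]; ring

theorem tendsto_atTop (hh : QuadDecay h) : Tendsto h atTop (𝓝 0) := by
  obtain ⟨C, hC⟩ := hh.bound
  refine squeeze_zero_norm hC ?_
  have : Tendsto (fun x : ℝ => 1 + x ^ 2) atTop atTop :=
    tendsto_atTop_add_const_left _ _ (tendsto_pow_atTop two_ne_zero)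
  simpa using this.inv_tendsto_atTop.const_mul C

theorem sinTransform_deriv (hh : QuadDecay h) (hh' : QuadDecay h')
    (hd : ∀ x, HasDerivAt h (h' x) x) (z : ℝ) :
    sinTransform h' z = -z * cosTransform h z := by
  have h1 : Tendsto (fun x => h x * Real.sin (z * x)) atTop (𝓝 0) :=
    hh.tendsto_atTop.zero_mul_isBoundedUnder_le
      (isBoundedUnder_of ⟨1, fun x => Real.abs_sin_le_one _⟩)
  have key := integral_Ioi_of_hasDerivAt_of_tendsto (a := 0) (m := 0)
    (f := fun x => h x * Real.sin (z * x))
    (f' := fun x => h' x * Real.sin (z * x) + z * (h x * Real.cos (z * x))) (by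
      have : Continuous fun x => h x * Real.sin (z * x) := hh.cont.mul (by fun_prop)
      exact this.continuousWithinAt)
    (fun x _ => by
      have := (hd x).mul (((hasDerivAt_id x).const_mul z).sin)
      refine this.congr_deriv ?_
      simp only [id]; ring)
    ((hh'.integrableOn_mul_sin z).add ((hh.integrableOn_mul_cos z).const_mul z)) h1
  rw [integral_add (hh'.integrableOn_mul_sin z) ((hh.integrableOn_mul_cos z).const_mul z),
    integral_const_mul] at key
  simp only [mul_zero, Real.sin_zero, sub_zero] at key
  unfold sinTransform cosTransform
  linarith

theorem cosTransform_deriv (hh : QuadDecay h) (hh' : QuadDecay h')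
    (hd : ∀ x, HasDerivAt h (h' x) x) (z : ℝ) :
    cosTransform h' z = -h 0 + z * sinTransform h z := by
  have h1 : Tendsto (fun x => h x * Real.cos (z * x)) atTop (𝓝 0) :=
    hh.tendsto_atTop.zero_mul_isBoundedUnder_le
      (isBoundedUnder_of ⟨1, fun x => Real.abs_cos_le_one _⟩)
  have key := integral_Ioi_of_hasDerivAt_of_tendsto (a := 0) (m := 0)
    (f := fun x => h x * Real.cos (z * x))
    (f' := fun x => h' x * Real.cos (z * x) - z * (h x * Real.sin (z * x))) (by
      have : Continuous fun x => h x * Real.cos (z * x) := hh.cont.mul (by fun_prop)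
      exact this.continuousWithinAt)
    (fun x _ => by
      have := (hd x).mul (((hasDerivAt_id x).const_mul z).cos)
      refine this.congr_deriv ?_
      simp only [id]; ring)
    ((hh'.integrableOn_mul_cos z).sub ((hh.integrableOn_mul_sin z).const_mul z)) h1
  rw [integral_sub (hh'.integrableOn_mul_cos z) ((hh.integrableOn_mul_sin z).const_mul z),
    integral_const_mul] at key
  simp only [mul_zero, Real.cos_zero, mul_one] at key
  unfold sinTransform cosTransform
  linarith

end QuadDecay

/-- `1 / (1 + x²)`. -/
noncomputable def lorentz (x : ℝ) : ℝ := (1 + x ^ 2)⁻¹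
/-- The first derivative of `lorentz`. -/
noncomputable def lorentzDeriv (x : ℝ) : ℝ := -(2 * x) / (1 + x ^ 2) ^ 2
/-- The second derivative of `lorentz`. -/
noncomputable def lorentzDeriv2 (x : ℝ) : ℝ := (6 * x ^ 2 - 2) / (1 + x ^ 2) ^ 3
/-- `x / (1 + x²)`. -/
noncomputable def conjLorentz (x : ℝ) : ℝ := x / (1 + x ^ 2)
/-- The first derivative of `conjLorentz`. -/
noncomputable def conjLorentzDeriv (x : ℝ) : ℝ := (1 - x ^ 2) / (1 + x ^ 2) ^ 2
/-- The second derivative of `conjLorentz`. -/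
noncomputable def conjLorentzDeriv2 (x : ℝ) : ℝ := (2 * x ^ 3 - 6 * x) / (1 + x ^ 2) ^ 3

theorem one_add_sq_ne_zero (x : ℝ) : 1 + x ^ 2 ≠ 0 := by positivity

theorem hasDerivAt_lorentz (x : ℝ) : HasDerivAt lorentz (lorentzDeriv x) x := by
  have := (((hasDerivAt_pow 2 x).const_add 1).inv (one_add_sq_ne_zero x))
  refine this.congr_deriv ?_
  simp [lorentzDeriv]

theorem hasDerivAt_lorentzDeriv (x : ℝ) : HasDerivAt lorentzDeriv (lorentzDeriv2 x) x := by
  have h := one_add_sq_ne_zero x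
  have := ((((hasDerivAt_id x).const_mul 2).neg).div (((hasDerivAt_pow 2 x).const_add 1).pow 2)
    (pow_ne_zero 2 h))
  refine this.congr_deriv ?_
  simp only [lorentzDeriv2, id, Pi.pow_apply, Pi.neg_apply]
  field_simp
  push_cast
  ring

theorem hasDerivAt_conjLorentz (x : ℝ) : HasDerivAt conjLorentz (conjLorentzDeriv x) x := by
  have h := one_add_sq_ne_zero x
  have := ((hasDerivAt_id x).div ((hasDerivAt_pow 2 x).const_add 1) h)
  refine this.congr_deriv ?_
  simp only [conjLorentzDeriv, id]
  field_simp
  push_cast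
  ring

theorem hasDerivAt_conjLorentzDeriv (x : ℝ) :
    HasDerivAt conjLorentzDeriv (conjLorentzDeriv2 x) x := by
  have h := one_add_sq_ne_zero x
  have := (((hasDerivAt_pow 2 x).const_sub 1).div (((hasDerivAt_pow 2 x).const_add 1).pow 2)
    (pow_ne_zero 2 h))
  refine this.congr_deriv ?_
  simp only [conjLorentzDeriv2, Pi.pow_apply]
  field_simp
  push_cast
  ring

theorem quadDecay_lorentz : QuadDecay lorentz :=
  ⟨Continuous.inv₀ (by fun_prop) one_add_sq_ne_zero, 1, fun x => by
    rw [lorentz, abs_of_pos (by positivity), one_mul]⟩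

theorem QuadDecay.of_div {u : ℝ → ℝ} {n : ℕ} (hu : Continuous u) {C : ℝ}
    (hC : ∀ x, |u x| ≤ C * (1 + x ^ 2) ^ n) : QuadDecay fun x => u x / (1 + x ^ 2) ^ (n + 1) := by
  refine ⟨hu.div (by fun_prop) fun x => pow_ne_zero _ (one_add_sq_ne_zero x), C, fun x => ?_⟩
  have h : 0 < 1 + x ^ 2 := by positivity
  rw [abs_div, abs_of_pos (pow_pos h _), div_le_iff₀ (pow_pos h _), pow_succ]
  calc |u x| ≤ C * (1 + x ^ 2) ^ n := hC x
    _ = _ := by field_simp; ring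

theorem quadDecay_lorentzDeriv : QuadDecay lorentzDeriv :=
  QuadDecay.of_div (n := 1) (C := 1) (by fun_prop) fun x => by
    rw [abs_le]; constructor <;> nlinarith [sq_nonneg (x - 1), sq_nonneg (x + 1)]

theorem quadDecay_lorentzDeriv2 : QuadDecay lorentzDeriv2 :=
  QuadDecay.of_div (n := 2) (C := 6) (by fun_prop) fun x => by
    rw [abs_le]; constructor <;> nlinarith [sq_nonneg x, sq_nonneg (x ^ 2)]

theorem quadDecay_conjLorentzDeriv : QuadDecay conjLorentzDeriv :=
  QuadDecay.of_div (n := 1) (C := 1) (by fun_prop) fun x => by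
    rw [abs_le]; constructor <;> nlinarith [sq_nonneg x]

theorem quadDecay_conjLorentzDeriv2 : QuadDecay conjLorentzDeriv2 :=
  QuadDecay.of_div (n := 2) (C := 6) (by fun_prop) fun x => by
    rw [abs_le]; constructor <;>
      nlinarith [sq_nonneg (x ^ 2 - 1), sq_nonneg (x ^ 2),
        mul_nonneg (sq_nonneg x) (sq_nonneg (x - 1)),
        mul_nonneg (sq_nonneg x) (sq_nonneg (x + 1)), sq_nonneg (x - 1), sq_nonneg (x + 1)]

theorem quadDecay_mul_lorentzDeriv2 : QuadDecay fun x => x * lorentzDeriv2 x := by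
  have : QuadDecay fun x => (x * (6 * x ^ 2 - 2)) / (1 + x ^ 2) ^ 3 :=
    QuadDecay.of_div (n := 2) (C := 6) (by fun_prop) fun x => by
      rw [abs_le]; constructor <;>
      nlinarith [sq_nonneg (x ^ 2 - 1), sq_nonneg (x ^ 2),
        mul_nonneg (sq_nonneg x) (sq_nonneg (x - 1)),
        mul_nonneg (sq_nonneg x) (sq_nonneg (x + 1)), sq_nonneg (x - 1), sq_nonneg (x + 1)]
  simpa only [lorentzDeriv2, mul_div_assoc] using this

theorem quadDecay_mul_conjLorentzDeriv2 : QuadDecay fun x => x * conjLorentzDeriv2 x := by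
  have : QuadDecay fun x => (x * (2 * x ^ 3 - 6 * x)) / (1 + x ^ 2) ^ 3 :=
    QuadDecay.of_div (n := 2) (C := 6) (by fun_prop) fun x => by
      rw [abs_le]; constructor <;> nlinarith [sq_nonneg x, sq_nonneg (x ^ 2)]
  simpa only [conjLorentzDeriv2, mul_div_assoc] using this

/-- The regularised value `z⁻² ∫₀^∞ D²g(x) (1 - cos (z x)) dx` of `∫₀^∞ g(x) cos (z x) dx`,
where `g(x) = x / (1 + x²)`. -/
noncomputable def cosConjLorentz (z : ℝ) : ℝ :=
  (∫ x in Ioi (0 : ℝ), conjLorentzDeriv2 x * (1 - Real.cos (z * x))) / z ^ 2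

theorem integral_conjLorentzDeriv2 : ∫ x in Ioi (0 : ℝ), conjLorentzDeriv2 x = -1 := by
  have := quadDecay_conjLorentzDeriv.cosTransform_deriv quadDecay_conjLorentzDeriv2
    hasDerivAt_conjLorentzDeriv 0
  simpa [cosTransform, conjLorentzDeriv] using this

theorem cosConjLorentz_eq (z : ℝ) :
    cosConjLorentz z = (-1 - cosTransform conjLorentzDeriv2 z) / z ^ 2 := by
  have h := integral_sub quadDecay_conjLorentzDeriv2.integrableOn
    (quadDecay_conjLorentzDeriv2.integrableOn_mul_cos z)
  rw [integral_conjLorentzDeriv2] at h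
  rw [cosConjLorentz, cosTransform, ← h]
  simp only [mul_sub, mul_one]

theorem abs_cosConjLorentz_le {z : ℝ} (hz : 0 < z) :
    |cosConjLorentz z| ≤ 2 * (∫ x in Ioi (0 : ℝ), |conjLorentzDeriv2 x|) / z ^ 2 := by
  rw [cosConjLorentz, abs_div, abs_of_pos (pow_pos hz 2)]
  gcongr
  rw [← integral_const_mul, ← Real.norm_eq_abs]
  refine norm_integral_le_of_norm_le (quadDecay_conjLorentzDeriv2.integrableOn.norm.const_mul 2)
    (Eventually.of_forall fun x => ?_)
  rw [norm_mul, mul_comm]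
  refine mul_le_mul_of_nonneg_right ?_ (norm_nonneg _)
  rw [Real.norm_eq_abs, abs_le]
  constructor <;> linarith [Real.neg_one_le_cos (z * x), Real.cos_le_one (z * x)]

/-- Two integrations by parts. Passing to the second derivative gains enough decay for later
differentiation under the integral sign. -/
theorem sinTransform_lorentzDeriv2 (z : ℝ) :
    sinTransform lorentzDeriv2 z = z - z ^ 2 * sinTransform lorentz z := by
  rw [quadDecay_lorentzDeriv.sinTransform_deriv quadDecay_lorentzDeriv2 hasDerivAt_lorentzDeriv,
    quadDecay_lorentz.cosTransform_deriv quadDecay_lorentzDeriv hasDerivAt_lorentz]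
  simp [lorentz]
  ring

/-- Since `x/(1+x²)` is not integrable, the sine integral cannot be differentiated directly under
the integral sign. It is first expressed through the transform of the second derivative, which
decays fast enough. -/
theorem hasDerivAt_sinTransform_lorentz {z : ℝ} (hz : 0 < z) :
    HasDerivAt (sinTransform lorentz) (cosConjLorentz z) z := by
  have h1 : ∀ y : ℝ, 0 < y → sinTransform lorentz y =
    (y - sinTransform lorentzDeriv2 y) / y ^ 2 := by
    intro y hy
    rw [sinTransform_lorentzDeriv2]
    field_simp
    ring
  have h2 := ((hasDerivAt_id z).sub (quadDecay_lorentzDeriv2.hasDerivAt_sinTransform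
    quadDecay_mul_lorentzDeriv2 z)).div (hasDerivAt_pow 2 z) (pow_ne_zero 2 hz.ne')
  have h3 := h2.congr_of_eventuallyEq (f₁ := sinTransform lorentz) (by
    filter_upwards [lt_mem_nhds hz] with y hy using h1 y hy)
  refine h3.congr_deriv ?_
  -- With `h = 1/(1+x²)` and `g = x h`, Leibniz gives `g'' = 2h' + x h''`.
  have h4 : cosTransform conjLorentzDeriv2 z =
      2 * cosTransform lorentzDeriv z + cosTransform (fun x => x * lorentzDeriv2 x) z := by
    unfold cosTransform
    rw [← integral_const_mul, ← integral_add
      ((quadDecay_lorentzDeriv.integrableOn_mul_cos z).const_mul 2)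
      (quadDecay_mul_lorentzDeriv2.integrableOn_mul_cos z)]
    refine integral_congr_ae (Eventually.of_forall fun x => ?_)
    have h := one_add_sq_ne_zero x
    simp only [conjLorentzDeriv2, lorentzDeriv, lorentzDeriv2]
    field_simp
    ring
  rw [cosConjLorentz_eq, h4, quadDecay_lorentz.cosTransform_deriv quadDecay_lorentzDeriv
    hasDerivAt_lorentz]
  simp only [lorentz, id, Pi.sub_apply, sinTransform_lorentzDeriv2]
  field_simp
  push_cast
  ring

/-- Formally the derivative is `-∫ x g(x) sin(zx) dx` with `x g = 1 - h`, where `h = 1/(1+x²)`; the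
constant `1` contributes the Abel value `-1/z`. The second-derivative representation makes this
rigorous. -/
theorem hasDerivAt_cosConjLorentz {z : ℝ} (hz : 0 < z) :
    HasDerivAt cosConjLorentz (sinTransform lorentz z - 1 / z) z := by
  have h2 := (((quadDecay_conjLorentzDeriv2.hasDerivAt_cosTransform
    quadDecay_mul_conjLorentzDeriv2 z).const_sub (-1)).div (hasDerivAt_pow 2 z)
      (pow_ne_zero 2 hz.ne'))
  have h3 := h2.congr_of_eventuallyEq (f₁ := cosConjLorentz)
    (Eventually.of_forall cosConjLorentz_eq)
  refine h3.congr_deriv ?_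
  -- Differentiating `x g = 1 - h` twice gives `x g'' = -2g' - h''`.
  have h4 : sinTransform (fun x => x * conjLorentzDeriv2 x) z =
      -2 * sinTransform conjLorentzDeriv z - sinTransform lorentzDeriv2 z := by
    unfold sinTransform
    rw [← integral_const_mul, ← integral_sub
      ((quadDecay_conjLorentzDeriv.integrableOn_mul_sin z).const_mul (-2))
      (quadDecay_lorentzDeriv2.integrableOn_mul_sin z)]
    refine integral_congr_ae (Eventually.of_forall fun x => ?_)
    have h := one_add_sq_ne_zero x
    simp only [conjLorentzDeriv2, conjLorentzDeriv, lorentzDeriv2]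
    field_simp
    ring
  rw [h4, quadDecay_conjLorentzDeriv.cosTransform_deriv quadDecay_conjLorentzDeriv2
    hasDerivAt_conjLorentzDeriv, sinTransform_lorentzDeriv2]
  simp only [conjLorentzDeriv]
  field_simp
  push_cast
  ring

theorem tendsto_sinTransform_lorentz : Tendsto (sinTransform lorentz) (𝓝[>] 0) (𝓝 0) := by
  have : Tendsto (sinTransform lorentz) (𝓝[>] 0)
      (𝓝 (∫ x in Ioi (0 : ℝ), lorentz x * Real.sin (0 * x))) := by
    refine tendsto_integral_filter_of_dominated_convergence (fun x => |lorentz x|)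
      (Eventually.of_forall fun y => (quadDecay_lorentz.integrableOn_mul_sin y).aestronglyMeasurable)
      (Eventually.of_forall fun y => Eventually.of_forall fun x => ?_)
      quadDecay_lorentz.integrableOn.norm (Eventually.of_forall fun x => ?_)
    · rw [norm_mul]; exact mul_le_of_le_one_right (norm_nonneg _) (Real.abs_sin_le_one _)
    · have : Continuous fun y : ℝ => lorentz x * Real.sin (y * x) := by fun_prop
      exact this.continuousWithinAt
  simpa using this

end FourierKernels

/-! ### Laplace integrals of powers and of powers times a logarithm. -/

section GammaIntegrals

theorem abs_log_le_rpow_add {x : ℝ} (hx : 0 < x) :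
    |Real.log x| ≤ 2 * x ^ (-(1 / 2) : ℝ) + 2 * x ^ (1 / 2 : ℝ) := by
  have h1 := Real.log_le_rpow_div hx.le (ε := 1 / 2) (by norm_num)
  have h2 := Real.log_le_rpow_div (inv_pos.2 hx).le (ε := 1 / 2) (by norm_num)
  rw [Real.log_inv, Real.inv_rpow hx.le, ← Real.rpow_neg hx.le] at h2
  have h3 : 0 < x ^ (-(1 / 2) : ℝ) := by positivity
  have h4 : 0 < x ^ (1 / 2 : ℝ) := by positivity
  rw [abs_le]
  constructor <;> linarith

theorem integrableOn_pow_mul_exp_neg (m : ℕ) :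
    IntegrableOn (fun k : ℝ => k ^ m * Real.exp (-k)) (Ioi 0) := by
  have := Real.GammaIntegral_convergent (s := m + 1) (by positivity)
  refine this.congr_fun (fun x hx => ?_) measurableSet_Ioi
  simp [mul_comm]

theorem integrableOn_log_mul_pow_mul_exp_neg (m : ℕ) :
    IntegrableOn (fun k : ℝ => Real.log k * (k ^ m * Real.exp (-k))) (Ioi 0) := by
  have h1 := (Real.GammaIntegral_convergent (s := m + 1 / 2) (by positivity)).const_mul 2
  have h2 := (Real.GammaIntegral_convergent (s := m + 3 / 2) (by positivity)).const_mul 2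
  refine Integrable.mono' (h1.add h2) ?_
    ((ae_restrict_iff' measurableSet_Ioi).2 (Eventually.of_forall fun k hk => ?_))
  · have : Measurable (fun k : ℝ => Real.log k * (k ^ m * Real.exp (-k))) := by fun_prop
    exact this.aestronglyMeasurable
  · have hk0 : (0 : ℝ) < k := hk
    rw [norm_mul, Real.norm_of_nonneg (by positivity : 0 ≤ k ^ m * Real.exp (-k)), Real.norm_eq_abs]
    refine (mul_le_mul_of_nonneg_right (abs_log_le_rpow_add hk0) (by positivity)).trans_eq ?_
    rw [Pi.add_apply, show (m : ℝ) + 1 / 2 - 1 = (m : ℝ) + -(1 / 2) by ring,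
      show (m : ℝ) + 3 / 2 - 1 = (m : ℝ) + 1 / 2 by ring, Real.rpow_add hk0, Real.rpow_add hk0,
      Real.rpow_natCast]
    ring

/-- The integral is `Γ'(m+1)`, obtained by differentiating Euler's integral; harmonic numbers and
`γ` enter through the known value of this derivative. -/
theorem integral_log_mul_pow_mul_exp_neg (m : ℕ) :
    ∫ k in Ioi (0 : ℝ), Real.log k * (k ^ m * Real.exp (-k)) =
      m.factorial * (harmonic m - Real.eulerMascheroniConstant) := by
  have h1 := Complex.hasDerivAt_GammaIntegral (s := m + 1) (by simp; positivity)
  have h2 := Complex.hasDerivAt_Gamma_nat m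
  have h3 : Complex.Gamma =ᶠ[𝓝 (m + 1 : ℂ)] Complex.GammaIntegral := by
    have : ∀ᶠ s : ℂ in 𝓝 (m + 1 : ℂ), 0 < s.re :=
      Complex.continuous_re.continuousAt.eventually (lt_mem_nhds (by simp; positivity))
    filter_upwards [this] with s hs using Complex.Gamma_eq_integral hs
  have h4 := (h1.congr_of_eventuallyEq h3).unique h2
  have h5 : (∫ t : ℝ in Ioi 0, (t : ℂ) ^ ((m + 1 : ℂ) - 1) * (Real.log t * Real.exp (-t))) =
      ((∫ k in Ioi (0 : ℝ), Real.log k * (k ^ m * Real.exp (-k)) : ℝ) : ℂ) := by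
    rw [← integral_complex_ofReal]
    refine integral_congr_ae (Eventually.of_forall fun x => ?_)
    simp only [add_sub_cancel_right, Complex.cpow_natCast]
    push_cast
    ring
  rw [h5] at h4
  have h6 : ((∫ k in Ioi (0 : ℝ), Real.log k * (k ^ m * Real.exp (-k)) : ℝ) : ℂ) =
      ((m.factorial * (harmonic m - Real.eulerMascheroniConstant) : ℝ) : ℂ) := by
    rw [h4]; push_cast; ring
  exact_mod_cast h6

theorem integral_pow_mul_exp_neg (m : ℕ) :
    ∫ k in Ioi (0 : ℝ), k ^ m * Real.exp (-k) = m.factorial := by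
  rw [← Real.Gamma_nat_eq_factorial, Real.Gamma_eq_integral (by positivity)]
  refine setIntegral_congr_fun measurableSet_Ioi fun x hx => ?_
  simp [mul_comm]

variable {t : ℝ}

theorem integrableOn_pow_mul_exp_neg_mul (ht : 0 < t) (m : ℕ) :
    IntegrableOn (fun k : ℝ => k ^ m * Real.exp (-t * k)) (Ioi 0) := by
  have h := (integrableOn_Ioi_comp_mul_left_iff _ 0 ht).2
    (by simpa using integrableOn_pow_mul_exp_neg m)
  refine (h.const_mul (t ^ m)⁻¹).congr (Eventually.of_forall fun k => ?_)
  simp only [mul_pow, neg_mul]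
  field_simp

theorem integral_pow_mul_exp_neg_mul (ht : 0 < t) (m : ℕ) :
    ∫ k in Ioi (0 : ℝ), k ^ m * Real.exp (-t * k) = m.factorial / t ^ (m + 1) := by
  have h := integral_comp_mul_left_Ioi (fun k : ℝ => k ^ m * Real.exp (-k)) 0 ht
  rw [mul_zero, integral_pow_mul_exp_neg] at h
  have h2 : ∀ k : ℝ, k ^ m * Real.exp (-t * k) =
      (t ^ m)⁻¹ * ((t * k) ^ m * Real.exp (-(t * k))) := fun k => by
    simp only [mul_pow, neg_mul]; field_simp
  simp_rw [h2]
  rw [integral_const_mul, h, smul_eq_mul]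
  field_simp
  ring

theorem integrableOn_log_mul_pow_mul_exp_neg_mul (ht : 0 < t) (m : ℕ) :
    IntegrableOn (fun k : ℝ => Real.log k * (k ^ m * Real.exp (-t * k))) (Ioi 0) := by
  have h := (integrableOn_Ioi_comp_mul_left_iff _ 0 ht).2
    (by simpa using integrableOn_log_mul_pow_mul_exp_neg m)
  refine ((h.const_mul (t ^ m)⁻¹).sub
    ((integrableOn_pow_mul_exp_neg_mul ht m).const_mul (Real.log t))).congr
    ((ae_restrict_iff' measurableSet_Ioi).2 (Eventually.of_forall fun k hk => ?_))
  simp only [Pi.sub_apply, mul_pow, neg_mul, Real.log_mul ht.ne' (ne_of_gt hk)]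
  field_simp
  ring

theorem integral_log_mul_pow_mul_exp_neg_mul (ht : 0 < t) (m : ℕ) :
    ∫ k in Ioi (0 : ℝ), Real.log k * (k ^ m * Real.exp (-t * k)) =
      m.factorial / t ^ (m + 1) *
        (harmonic m - Real.eulerMascheroniConstant - Real.log t) := by
  have h := integral_comp_mul_left_Ioi (fun k : ℝ => Real.log k * (k ^ m * Real.exp (-k))) 0 ht
  rw [mul_zero, integral_log_mul_pow_mul_exp_neg] at h
  have h1 : ∀ k ∈ Ioi (0 : ℝ), Real.log (t * k) * ((t * k) ^ m * Real.exp (-(t * k))) =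
      t ^ m * (Real.log k * (k ^ m * Real.exp (-t * k))) +
      t ^ m * Real.log t * (k ^ m * Real.exp (-t * k)) := fun k hk => by
    rw [Real.log_mul ht.ne' (ne_of_gt hk), mul_pow, neg_mul]; ring
  rw [setIntegral_congr_fun measurableSet_Ioi h1, integral_add
    ((integrableOn_log_mul_pow_mul_exp_neg_mul ht m).const_mul _)
    ((integrableOn_pow_mul_exp_neg_mul ht m).const_mul _), integral_const_mul, integral_const_mul,
    integral_pow_mul_exp_neg_mul ht, smul_eq_mul] at h
  have h2 : t ^ m ≠ 0 := by positivity
  apply mul_left_cancel₀ h2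
  rw [eq_sub_of_add_eq h]
  field_simp
  ring

end GammaIntegrals

/-! ### Power series with coefficients of exponential type. -/

section ExpSeries

/-- Coefficients of a power series of exponential type. -/
def ExpType (a : ℕ → ℝ) : Prop := ∃ C R : ℝ, 0 ≤ C ∧ 0 ≤ R ∧ ∀ m, |a m| ≤ C * (R ^ m / m.factorial)

theorem ExpType.summable {a : ℕ → ℝ} (ha : ExpType a) (x : ℝ) :
    Summable fun m => |a m| * |x| ^ m := by
  obtain ⟨C, R, hC, hR, h⟩ := ha
  refine Summable.of_nonneg_of_le (fun m => by positivity) (fun m => ?_)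
    ((Real.summable_pow_div_factorial (R * |x|)).mul_left C)
  calc |a m| * |x| ^ m ≤ C * (R ^ m / m.factorial) * |x| ^ m :=
        mul_le_mul_of_nonneg_right (h m) (by positivity)
    _ = _ := by rw [mul_pow]; ring

theorem ExpType.summable_mul_pow {a : ℕ → ℝ} (ha : ExpType a) (x : ℝ) :
    Summable fun m => a m * x ^ m :=
  Summable.of_norm ((ha.summable x).congr fun m => by
    rw [norm_mul, norm_pow, Real.norm_eq_abs, Real.norm_eq_abs])

theorem ExpType.deriv {a : ℕ → ℝ} (ha : ExpType a) :
    ExpType fun m => ((m : ℝ) + 1) * a (m + 1) := by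
  obtain ⟨C, R, hC, hR, h⟩ := ha
  refine ⟨C * R, R, by positivity, hR, fun m => ?_⟩
  have hm : (0 : ℝ) < m + 1 := by positivity
  rw [abs_mul, abs_of_pos hm]
  calc ((m : ℝ) + 1) * |a (m + 1)| ≤ ((m : ℝ) + 1) * (C * (R ^ (m + 1) / (m + 1).factorial)) :=
        mul_le_mul_of_nonneg_left (h _) hm.le
    _ = _ := by
      rw [Nat.factorial_succ]; push_cast; field_simp; ring

theorem ExpType.hasDerivAt {a : ℕ → ℝ} (ha : ExpType a) (x : ℝ) :
    HasDerivAt (fun y => ∑' m, a m * y ^ m) (∑' m : ℕ, ((m : ℝ) + 1) * a (m + 1) * x ^ m) x := by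
  set r := |x| + 1
  have hr : |r| = r := abs_of_pos (by positivity)
  have hs : Summable fun m : ℕ => |a m| * (m * r ^ (m - 1)) := by
    rw [← summable_nat_add_iff 1]
    refine (ha.deriv.summable r).congr fun m => ?_
    rw [abs_mul, abs_of_pos (by positivity : (0 : ℝ) < m + 1), hr]
    push_cast
    ring
  have h := hasDerivAt_tsum_of_isPreconnected (g := fun m y => a m * y ^ m)
    (g' := fun (m : ℕ) y => a m * (m * y ^ (m - 1))) (t := Metric.ball 0 r) (y₀ := x) (y := x) hs
    Metric.isOpen_ball (convex_ball 0 r).isPreconnected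
    (fun m y _ => (hasDerivAt_pow m y).const_mul _) (fun m y hy => ?_)
    (by simp [r]) (ha.summable_mul_pow x) (by simp [r])
  · refine h.congr_deriv ?_
    have hs2 : Summable fun m : ℕ => a m * (m * x ^ (m - 1)) := by
      rw [← summable_nat_add_iff 1]
      refine (ha.deriv.summable_mul_pow x).congr fun m => ?_
      push_cast
      ring
    rw [hs2.tsum_eq_zero_add]
    simp only [Nat.cast_zero, zero_mul, mul_zero, zero_add]
    refine tsum_congr fun m => ?_
    push_cast
    ring
  · rw [norm_mul, norm_mul, norm_pow, Real.norm_eq_abs, Real.norm_natCast]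
    have : ‖y‖ ≤ r := by simpa using (mem_ball_zero_iff.1 hy).le
    gcongr

theorem harmonic_nonneg (m : ℕ) : (0 : ℝ) ≤ harmonic m := by
  rw [harmonic]; push_cast; positivity

theorem harmonic_le_self (m : ℕ) : (harmonic m : ℝ) ≤ m := by
  induction m with
  | zero => simp
  | succ m ih =>
    rw [harmonic_succ]
    push_cast
    have : ((m : ℝ) + 1)⁻¹ ≤ 1 := inv_le_one_of_one_le₀ (by linarith [m.cast_nonneg (α := ℝ)])
    linarith

end ExpSeries

/-! ### The functions `e^z E₁(z)` and `e^{-z} Ei(z)` and their cosine integral. -/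

section ExpIntegrals

/-- `e^z E₁(z) = ∫₀^∞ e^{-v} / (z + v) dv`. -/
noncomputable def expMulE1 (z : ℝ) : ℝ := ∫ v in Ioi (0 : ℝ), Real.exp (-v) / (z + v)

/-- `∑ (-1)^m H_m z^m / m!`. -/
noncomputable def harmonicExpSeries (z : ℝ) : ℝ :=
  ∑' m : ℕ, ((-1) ^ m * (harmonic m : ℝ) / m.factorial) * z ^ m

/-- `e^{-z} Ei(z)`. -/
noncomputable def expMulEi (z : ℝ) : ℝ :=
  (Real.log z + Real.eulerMascheroniConstant) * Real.exp (-z) - harmonicExpSeries z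

theorem integrableOn_exp_neg : IntegrableOn (fun v : ℝ => Real.exp (-v)) (Ioi 0) := by
  simpa using integrableOn_pow_mul_exp_neg 0

theorem integral_exp_neg_Ioi' : ∫ v in Ioi (0 : ℝ), Real.exp (-v) = 1 := by
  simpa using integral_pow_mul_exp_neg 0

theorem integrableOn_exp_neg_div_add {z : ℝ} (hz : 0 < z) (n : ℕ) :
    IntegrableOn (fun v : ℝ => Real.exp (-v) / (z + v) ^ n) (Ioi 0) := by
  refine Integrable.mono' (integrableOn_exp_neg.const_mul (z ^ n)⁻¹) ?_
    ((ae_restrict_iff' measurableSet_Ioi).2 (Eventually.of_forall fun v hv => ?_))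
  · have : Measurable (fun v : ℝ => Real.exp (-v) / (z + v) ^ n) := by fun_prop
    exact this.aestronglyMeasurable
  · have hv0 : (0 : ℝ) < v := hv
    rw [Real.norm_of_nonneg (by positivity), div_eq_inv_mul]
    gcongr
    linarith

theorem expMulE1_nonneg {z : ℝ} (hz : 0 < z) : 0 ≤ expMulE1 z :=
  setIntegral_nonneg measurableSet_Ioi fun v hv => by
    have hv0 : (0 : ℝ) < v := hv
    positivity

theorem expMulE1_le {z : ℝ} (hz : 0 < z) : expMulE1 z ≤ 1 / z := by
  have h := setIntegral_mono_on (by simpa using integrableOn_exp_neg_div_add hz 1)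
    (integrableOn_exp_neg.const_mul (1 / z)) measurableSet_Ioi
    (fun v hv => show Real.exp (-v) / (z + v) ≤ 1 / z * Real.exp (-v) by
      have hv0 : (0 : ℝ) < v := hv
      rw [div_eq_inv_mul, one_div]
      gcongr
      linarith)
  rwa [integral_const_mul, integral_exp_neg_Ioi', mul_one] at h

theorem tendsto_exp_neg_div_add_atTop (z : ℝ) :
    Tendsto (fun v : ℝ => Real.exp (-v) / (z + v)) atTop (𝓝 0) :=
  (Real.tendsto_exp_neg_atTop_nhds_zero).div_atTop (tendsto_atTop_add_const_left _ _ tendsto_id)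

theorem integral_exp_neg_div_add_sq {z : ℝ} (hz : 0 < z) :
    ∫ v in Ioi (0 : ℝ), Real.exp (-v) / (z + v) ^ 2 = 1 / z - expMulE1 z := by
  have h1 : IntegrableOn (fun v : ℝ => Real.exp (-v) / (z + v)) (Ioi 0) := by
    simpa using integrableOn_exp_neg_div_add hz 1
  have h2 := integrableOn_exp_neg_div_add hz 2
  have hd : ∀ v ∈ Ici (0 : ℝ), HasDerivAt (fun v : ℝ => Real.exp (-v) / (z + v))
      (-(Real.exp (-v) / (z + v)) - Real.exp (-v) / (z + v) ^ 2) v := by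
    intro v hv
    have hv0 : (0 : ℝ) ≤ v := hv
    have hzv : z + v ≠ 0 := by positivity
    refine (((hasDerivAt_id v).neg.exp).div ((hasDerivAt_id v).const_add z) hzv).congr_deriv ?_
    simp only [id, Pi.neg_apply]
    field_simp
  have key := integral_Ioi_of_hasDerivAt_of_tendsto' hd (h1.neg.sub h2)
    (tendsto_exp_neg_div_add_atTop z)
  have hsub := integral_sub h1.neg h2
  simp only [Pi.neg_apply] at hsub
  rw [hsub, integral_neg] at key
  simp only [add_zero, neg_zero, Real.exp_zero] at key
  unfold expMulE1
  linarith

theorem hasDerivAt_expMulE1 {z : ℝ} (hz : 0 < z) :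
    HasDerivAt expMulE1 (expMulE1 z - 1 / z) z := by
  have h1 : IntegrableOn (fun v : ℝ => Real.exp (-v) / (z + v)) (Ioi 0) := by
    simpa using integrableOn_exp_neg_div_add hz 1
  have h2 := (integrableOn_exp_neg_div_add (half_pos hz) 2)
  have hd := (hasDerivAt_integral_of_dominated_loc_of_deriv_le
    (μ := volume.restrict (Ioi (0 : ℝ)))
    (F := fun z v => Real.exp (-v) / (z + v)) (F' := fun z v => -(Real.exp (-v) / (z + v) ^ 2))
    (bound := fun v => Real.exp (-v) / (z / 2 + v) ^ 2)
    (Ioi_mem_nhds (half_lt_self hz))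
    (Eventually.of_forall fun y => by
      have : Measurable (fun v : ℝ => Real.exp (-v) / (y + v)) := by fun_prop
      exact this.aestronglyMeasurable)
    h1 (integrableOn_exp_neg_div_add hz 2).neg.aestronglyMeasurable
    ((ae_restrict_iff' measurableSet_Ioi).2 (Eventually.of_forall fun v hv y hy => ?_)) h2
    ((ae_restrict_iff' measurableSet_Ioi).2 (Eventually.of_forall fun v hv y hy => ?_))).2
  · refine hd.congr_deriv ?_
    rw [integral_neg, integral_exp_neg_div_add_sq hz]
    ring
  · have hv0 : (0 : ℝ) < v := hv
    have hy0 : z / 2 < y := hy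
    rw [norm_neg, Real.norm_of_nonneg (by positivity)]
    gcongr
  · have hv0 : (0 : ℝ) < v := hv
    have hy0 : z / 2 < y := hy
    have hyv : y + v ≠ 0 := by linarith
    refine ((hasDerivAt_const y (Real.exp (-v))).div ((hasDerivAt_id y).add_const v)
      hyv).congr_deriv ?_
    simp only [id]
    ring

/-- Integration by parts gives `expMulE1 z + log z = ∫ log(z+v) e^{-v} dv`. For `z < 1` the
inequality `|log(z+v)| ≤ |log v| + v` permits dominated convergence to `∫ log v e^{-v} dv = -γ`. -/
theorem tendsto_expMulE1_add_log :
    Tendsto (fun z => expMulE1 z + Real.log z) (𝓝[>] 0) (𝓝 (-Real.eulerMascheroniConstant)) := by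
  have hI : ∫ v in Ioi (0 : ℝ), Real.log v * Real.exp (-v) = -Real.eulerMascheroniConstant := by
    simpa using integral_log_mul_pow_mul_exp_neg 0
  have hlogi : IntegrableOn (fun v : ℝ => Real.log v * Real.exp (-v)) (Ioi 0) := by
    simpa using integrableOn_log_mul_pow_mul_exp_neg 0
  have hvi : IntegrableOn (fun v : ℝ => v * Real.exp (-v)) (Ioi 0) := by
    simpa using integrableOn_pow_mul_exp_neg 1
  have hbd : ∀ z ∈ Ioo (0 : ℝ) 1, ∀ v ∈ Ioi (0 : ℝ), ‖Real.log (z + v) * Real.exp (-v)‖ ≤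
      |Real.log v * Real.exp (-v)| + v * Real.exp (-v) := by
    intro z hz v hv
    have hv0 : (0 : ℝ) < v := hv
    rw [norm_mul, Real.norm_of_nonneg (Real.exp_pos (-v)).le, abs_mul,
      abs_of_pos (Real.exp_pos (-v)), ← add_mul]
    refine mul_le_mul_of_nonneg_right ?_ (Real.exp_pos _).le
    have h1 : Real.log v ≤ Real.log (z + v) := Real.log_le_log hv0 (by linarith [hz.1])
    have h2 := Real.log_le_sub_one_of_pos (by linarith [hz.1] : 0 < z + v)
    rw [Real.norm_eq_abs, abs_le]
    constructor
    · linarith [neg_abs_le (Real.log v)]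
    · linarith [abs_nonneg (Real.log v), hz.2]
  have hmeas : ∀ z : ℝ, AEStronglyMeasurable (fun v : ℝ => Real.log (z + v) * Real.exp (-v))
      (volume.restrict (Ioi 0)) := fun z => by
    have : Measurable (fun v : ℝ => Real.log (z + v) * Real.exp (-v)) := by fun_prop
    exact this.aestronglyMeasurable
  have hev : ∀ᶠ z : ℝ in 𝓝[>] 0, z ∈ Ioo (0 : ℝ) 1 := Ioo_mem_nhdsGT one_pos
  have hlim : Tendsto (fun z : ℝ => ∫ v in Ioi (0 : ℝ), Real.log (z + v) * Real.exp (-v)) (𝓝[>] 0)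
      (𝓝 (∫ v in Ioi (0 : ℝ), Real.log v * Real.exp (-v))) := by
    refine tendsto_integral_filter_of_dominated_convergence
      (fun v => |Real.log v * Real.exp (-v)| + v * Real.exp (-v))
      (Eventually.of_forall hmeas) ?_ (hlogi.norm.add hvi)
      ((ae_restrict_iff' measurableSet_Ioi).2 (Eventually.of_forall fun v hv => ?_))
    · filter_upwards [hev] with z hz
      exact (ae_restrict_iff' measurableSet_Ioi).2 (Eventually.of_forall (hbd z hz))
    · have hv0 : (0 : ℝ) < v := hv
      have : ContinuousAt (fun z : ℝ => Real.log (z + v) * Real.exp (-v)) 0 := by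
        have : (0 : ℝ) + v ≠ 0 := by linarith
        fun_prop (disch := assumption)
      simpa using this.tendsto.mono_left nhdsWithin_le_nhds
  rw [hI] at hlim
  refine hlim.congr' ?_
  filter_upwards [hev] with z hz
  have hz0 := hz.1
  have h1 : IntegrableOn (fun v : ℝ => Real.exp (-v) / (z + v)) (Ioi 0) := by
    simpa using integrableOn_exp_neg_div_add hz0 1
  have h2 : IntegrableOn (fun v : ℝ => Real.log (z + v) * Real.exp (-v)) (Ioi 0) :=
    (hlogi.norm.add hvi).mono' (hmeas z)
      ((ae_restrict_iff' measurableSet_Ioi).2 (Eventually.of_forall (hbd z hz)))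
  have hd : ∀ v ∈ Ici (0 : ℝ), HasDerivAt (fun v : ℝ => Real.log (z + v) * Real.exp (-v))
      (Real.exp (-v) / (z + v) - Real.log (z + v) * Real.exp (-v)) v := by
    intro v hv
    have hv0 : (0 : ℝ) ≤ v := hv
    have hzv : z + v ≠ 0 := by positivity
    refine ((((hasDerivAt_id v).const_add z).log hzv).mul
      ((hasDerivAt_id v).neg.exp)).congr_deriv ?_
    simp only [id, Pi.neg_apply]
    ring
  have htop : Tendsto (fun v : ℝ => Real.log (z + v) * Real.exp (-v)) atTop (𝓝 0) := by
    have h3 : Tendsto (fun v : ℝ => v ^ 1 * Real.exp (-v)) atTop (𝓝 0) :=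
      Real.tendsto_pow_mul_exp_neg_atTop_nhds_zero 1
    refine squeeze_zero' (g := fun v : ℝ => v ^ 1 * Real.exp (-v)) ?_ ?_ h3
    · filter_upwards [eventually_ge_atTop (1 : ℝ)] with v hv
      exact mul_nonneg (Real.log_nonneg (by linarith)) (Real.exp_pos _).le
    · filter_upwards [eventually_ge_atTop (1 : ℝ)] with v hv
      have := Real.log_le_sub_one_of_pos (by linarith [hz.1] : 0 < z + v)
      exact mul_le_mul_of_nonneg_right (by linarith [hz.2]) (Real.exp_pos _).le
  have key := integral_Ioi_of_hasDerivAt_of_tendsto' hd (h1.sub h2) htop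
  rw [integral_sub h1 h2] at key
  simp only [add_zero, neg_zero, Real.exp_zero, mul_one] at key
  unfold expMulE1
  linarith

theorem expType_harmonic_div_factorial :
    ExpType fun m => (-1) ^ m * (harmonic m : ℝ) / m.factorial := by
  refine ⟨1, 2, zero_le_one, zero_le_two, fun m => ?_⟩
  rw [abs_div, abs_mul, abs_pow, abs_neg, abs_one, one_pow, one_mul, one_mul,
    abs_of_nonneg (harmonic_nonneg m), Nat.abs_cast]
  gcongr
  exact (harmonic_le_self m).trans (by exact_mod_cast (Nat.lt_two_pow_self (n := m)).le)

/-- The recursion `H_{m+1} = H_m + 1/(m+1)` splits the differentiated series into the original one,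
up to sign, and a shifted exponential series. -/
theorem hasDerivAt_harmonicExpSeries {z : ℝ} (hz : 0 < z) :
    HasDerivAt harmonicExpSeries (-harmonicExpSeries z - (1 - Real.exp (-z)) / z) z := by
  refine (expType_harmonic_div_factorial.hasDerivAt z).congr_deriv ?_
  have h1 : HasSum (fun m : ℕ => (-z) ^ (m + 1) / (m + 1).factorial) (Real.exp (-z) - 1) := by
    have h := NormedSpace.expSeries_div_hasSum_exp (𝔸 := ℝ) (-z)
    rw [← Real.exp_eq_exp_ℝ] at h
    simpa using (hasSum_nat_add_iff' 1).2 h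
  have h2 := (expType_harmonic_div_factorial.summable_mul_pow z).hasSum.neg.add (h1.div_const z)
  have h3 : -harmonicExpSeries z - (1 - Real.exp (-z)) / z =
      -harmonicExpSeries z + (Real.exp (-z) - 1) / z := by ring
  rw [h3, harmonicExpSeries, ← h2.tsum_eq]
  refine tsum_congr fun m => ?_
  rw [harmonic_succ, Nat.factorial_succ, neg_pow z]
  push_cast
  field_simp
  ring

theorem hasDerivAt_expMulEi {z : ℝ} (hz : 0 < z) :
    HasDerivAt expMulEi (-expMulEi z + 1 / z) z := by
  refine ((((Real.hasDerivAt_log hz.ne').add_const _).mul (hasDerivAt_id z).neg.exp).sub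
    (hasDerivAt_harmonicExpSeries hz)).congr_deriv ?_
  simp only [expMulEi, id, Pi.neg_apply]
  field_simp
  ring

theorem tendsto_expMulEi_sub_log :
    Tendsto (fun z => expMulEi z - Real.log z) (𝓝[>] 0) (𝓝 Real.eulerMascheroniConstant) := by
  have hQ : Tendsto harmonicExpSeries (𝓝[>] 0) (𝓝 0) := by
    have := (expType_harmonic_div_factorial.hasDerivAt 0).continuousAt.tendsto
    have h0 : (∑' m : ℕ, ((-1) ^ m * (harmonic m : ℝ) / m.factorial) * (0 : ℝ) ^ m) = 0 := by
      rw [tsum_eq_single 0 (fun m hm => by simp [hm])]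
      simp
    rw [h0] at this
    exact this.mono_left nhdsWithin_le_nhds
  have h1 : Tendsto (fun z : ℝ => Real.log z * (Real.exp (-z) - 1)) (𝓝[>] 0) (𝓝 0) := by
    have h2 : Tendsto (fun z : ℝ => |Real.log z * z|) (𝓝[>] 0) (𝓝 0) := by
      simpa using (tendsto_log_mul_rpow_nhdsGT_zero (r := 1) one_pos).abs
    refine squeeze_zero_norm' ?_ h2
    filter_upwards [self_mem_nhdsWithin] with z hz
    have hz0 : (0 : ℝ) < z := hz
    rw [norm_mul, abs_mul, Real.norm_eq_abs]
    refine mul_le_mul_of_nonneg_left ?_ (abs_nonneg _)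
    rw [Real.norm_eq_abs, abs_of_pos hz0, abs_le]
    constructor
    · linarith [Real.add_one_le_exp (-z)]
    · linarith [Real.exp_le_one_iff.2 (neg_nonpos.2 hz0.le)]
  have h3 : Tendsto (fun z : ℝ => Real.eulerMascheroniConstant * Real.exp (-z)) (𝓝[>] 0)
      (𝓝 (Real.eulerMascheroniConstant * Real.exp (-0))) := by
    have : Continuous fun z : ℝ => Real.eulerMascheroniConstant * Real.exp (-z) := by fun_prop
    exact this.continuousAt.tendsto.mono_left nhdsWithin_le_nhds
  have h4 := (h1.add h3).sub hQ
  simp only [neg_zero, Real.exp_zero, mul_one, zero_add, sub_zero] at h4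
  refine h4.congr fun z => ?_
  unfold expMulEi
  ring

/-- The pair formed by the sine transform of `1/(1+x²)` and `cosConjLorentz`, and the pair of
half-sum and half-difference of `expMulE1` and `expMulEi`, satisfy the same linear system. Their
differences solve `X' = Y`, `Y' = X`; boundedness at infinity kills the growing mode and the
behaviour at `0` kills the decaying one. -/
theorem expMulE1_sub_expMulEi {z : ℝ} (hz : 0 < z) :
    expMulE1 z - expMulEi z = 2 * cosConjLorentz z := by
  set X : ℝ → ℝ := fun z => sinTransform lorentz z - (expMulE1 z + expMulEi z) / 2
  set Y : ℝ → ℝ := fun z => cosConjLorentz z - (expMulE1 z - expMulEi z) / 2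
  have hX : ∀ z : ℝ, 0 < z → HasDerivAt X (Y z) z := fun z hz => by
    refine ((hasDerivAt_sinTransform_lorentz hz).sub
      (((hasDerivAt_expMulE1 hz).add (hasDerivAt_expMulEi hz)).div_const 2)).congr_deriv ?_
    simp only [Y]; ring
  have hY : ∀ z : ℝ, 0 < z → HasDerivAt Y (X z) z := fun z hz => by
    refine ((hasDerivAt_cosConjLorentz hz).sub
      (((hasDerivAt_expMulE1 hz).sub (hasDerivAt_expMulEi hz)).div_const 2)).congr_deriv ?_
    simp only [X]; ring
  have hconst : ∀ F : ℝ → ℝ, (∀ z : ℝ, 0 < z → HasDerivAt F 0 z) →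
      ∀ a b : ℝ, 0 < a → 0 < b → F a = F b := fun F hF a b ha hb =>
    (convex_Ioi (0 : ℝ)).is_const_of_fderivWithin_eq_zero (𝕜 := ℝ)
      (fun z hz => (hF z hz).differentiableAt.differentiableWithinAt)
      (fun z hz => by
        rw [fderivWithin_of_isOpen isOpen_Ioi hz]
        ext
        simp [(hF z hz).deriv]) ha hb
  -- `e^{-z} (X + Y)` is constant and vanishes at infinity
  have hplus : ∀ z : ℝ, 0 < z → X z + Y z = 0 := by
    have hc := hconst (fun z => (X z + Y z) * Real.exp (-z)) (fun z hz => by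
      refine (((hX z hz).add (hY z hz)).mul (hasDerivAt_id z).neg.exp).congr_deriv ?_
      simp only [id, Pi.neg_apply, Pi.add_apply]; ring)
    -- `expMulEi` cancels in `X + Y`, so no asymptotics of `Ei` at infinity are needed.
    have hXY : ∀ z, X z + Y z = sinTransform lorentz z + cosConjLorentz z - expMulE1 z :=
      fun z => by simp only [X, Y]; ring
    set K := (∫ x in Ioi (0 : ℝ), |lorentz x|) +
      2 * (∫ x in Ioi (0 : ℝ), |conjLorentzDeriv2 x|) + 1
    have hbound : ∀ z : ℝ, 1 ≤ z → ‖(X z + Y z) * Real.exp (-z)‖ ≤ K * Real.exp (-z) := by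
      intro z hz1
      have hz0 : 0 < z := by linarith
      rw [norm_mul, Real.norm_of_nonneg (Real.exp_pos _).le]
      refine mul_le_mul_of_nonneg_right ?_ (Real.exp_pos _).le
      rw [hXY, Real.norm_eq_abs]
      refine (abs_sub _ _).trans (add_le_add ((abs_add_le _ _).trans (add_le_add
        (quadDecay_lorentz.abs_sinTransform_le z) ((abs_cosConjLorentz_le hz0).trans ?_))) ?_)
      · exact div_le_self (by positivity) (one_le_pow₀ hz1)
      · rw [abs_of_nonneg (expMulE1_nonneg hz0)]
        exact (expMulE1_le hz0).trans ((div_le_one hz0).2 hz1)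
    have hlim : Tendsto (fun z => (X z + Y z) * Real.exp (-z)) atTop (𝓝 0) := by
      refine squeeze_zero_norm' (a := fun z => K * Real.exp (-z)) ?_ ?_
      · filter_upwards [eventually_ge_atTop (1 : ℝ)] with z hz using hbound z hz
      · simpa using Real.tendsto_exp_neg_atTop_nhds_zero.const_mul K
    intro z hz
    have h1 : Tendsto (fun z => (X z + Y z) * Real.exp (-z)) atTop
        (𝓝 ((X z + Y z) * Real.exp (-z))) := by
      refine tendsto_const_nhds.congr' ?_
      filter_upwards [eventually_gt_atTop (0 : ℝ)] with w hw using hc z w hz hw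
    exact (mul_eq_zero.1 (tendsto_nhds_unique h1 hlim)).resolve_right (ne_of_gt (Real.exp_pos _))
  -- so `e^z X` is constant, and it vanishes at `0`
  have hXz : ∀ z : ℝ, 0 < z → X z = 0 := by
    have hc := hconst (fun z => X z * Real.exp z) (fun z hz => by
      refine ((hX z hz).mul (Real.hasDerivAt_exp z)).congr_deriv ?_
      rw [← add_mul, add_comm, hplus z hz, zero_mul])
    have hlim : Tendsto (fun z => X z * Real.exp z) (𝓝[>] 0) (𝓝 0) := by
      have h2 := tendsto_sinTransform_lorentz.sub
        ((tendsto_expMulE1_add_log.add tendsto_expMulEi_sub_log).div_const 2)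
      have h3 : Tendsto Real.exp (𝓝[>] 0) (𝓝 (Real.exp 0)) :=
        Real.continuous_exp.continuousAt.tendsto.mono_left nhdsWithin_le_nhds
      have h4 := h2.mul h3
      simp only [neg_add_cancel, zero_div, sub_zero, zero_mul] at h4
      refine h4.congr fun z => ?_
      simp only [X]; ring
    intro z hz
    have h1 : Tendsto (fun z => X z * Real.exp z) (𝓝[>] 0) (𝓝 (X z * Real.exp z)) := by
      refine tendsto_const_nhds.congr' ?_
      filter_upwards [self_mem_nhdsWithin] with w hw using hc z w hz hw
    exact (mul_eq_zero.1 (tendsto_nhds_unique h1 hlim)).resolve_right (Real.exp_pos _).ne'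
  have h5 := hplus z hz
  rw [hXz z hz, zero_add] at h5
  simp only [Y] at h5
  linarith

end ExpIntegrals

/-! ### The Laplace transform of `K₀(2√(ck))`. -/

section BesselK

/-- The substitution `v = (x/2) e^u` turns `x cosh u` into `v + x²/(4v)`. It uses the whole line of
`u`, whence the factor `1/2` by evenness. -/
theorem besselKZero_eq {x : ℝ} (hx : 0 < x) :
    besselKZero x = 1 / 2 * ∫ v in Ioi (0 : ℝ), Real.exp (-v - x ^ 2 / 4 / v) / v := by
  have h1 := integral_comp_abs (f := fun u => Real.exp (-x * Real.cosh u))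
  simp only [Real.cosh_abs] at h1
  have himg : (fun u : ℝ => x / 2 * Real.exp u) '' univ = Ioi 0 := by
    ext v
    simp only [image_univ, mem_range, mem_Ioi]
    refine ⟨fun ⟨u, hu⟩ => hu ▸ by positivity, fun hv => ⟨Real.log (v / (x / 2)), ?_⟩⟩
    rw [Real.exp_log (by positivity)]
    field_simp
  have h2 := integral_image_eq_integral_abs_deriv_smul (s := univ)
    (f := fun u : ℝ => x / 2 * Real.exp u) (f' := fun u => x / 2 * Real.exp u) MeasurableSet.univ
    (fun u _ => ((Real.hasDerivAt_exp u).const_mul _).hasDerivWithinAt)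
    (fun u _ w _ h => Real.exp_injective (mul_left_cancel₀ (by positivity) h))
    (fun v => Real.exp (-v - x ^ 2 / 4 / v) / v)
  rw [himg, setIntegral_univ] at h2
  have h3 : ∀ u : ℝ, |x / 2 * Real.exp u| • (Real.exp (-(x / 2 * Real.exp u) -
      x ^ 2 / 4 / (x / 2 * Real.exp u)) / (x / 2 * Real.exp u)) =
      Real.exp (-x * Real.cosh u) := by
    intro u
    have hu := Real.exp_pos u
    rw [abs_of_pos (by positivity), smul_eq_mul, mul_div_cancel₀ _ (by positivity), Real.cosh_eq,
      Real.exp_neg]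
    congr 1
    field_simp
    ring
  simp_rw [h3] at h2
  rw [h2, h1, besselKZero]
  ring

variable {c t : ℝ}

/-- Tonelli with `k` integrated first: the inner integral is elementary and leaves `(1/t)
e^{-v}/(c/t + v)`, the integrand of `expMulE1 (c/t)` up to `1/t`. -/
theorem integrable_besselK_integrand (hc : 0 < c) (ht : 0 < t) :
    Integrable (fun p : ℝ × ℝ => Real.exp (-p.2 - c * p.1 / p.2) / p.2 * Real.exp (-t * p.1))
      ((volume.restrict (Ioi 0)).prod (volume.restrict (Ioi 0))) := by
  have hm : Measurable (fun p : ℝ × ℝ =>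
      Real.exp (-p.2 - c * p.1 / p.2) / p.2 * Real.exp (-t * p.1)) := by fun_prop
  have heq : ∀ k v : ℝ, Real.exp (-v - c * k / v) / v * Real.exp (-t * k) =
      Real.exp (-v) / v * (k ^ 0 * Real.exp (-(t + c / v) * k)) := fun k v => by
    rw [pow_zero, one_mul, div_mul_eq_mul_div, div_mul_eq_mul_div, ← Real.exp_add, ← Real.exp_add]
    congr 2
    ring
  rw [integrable_prod_iff' hm.aestronglyMeasurable]
  constructor
  · refine (ae_restrict_iff' measurableSet_Ioi).2 (Eventually.of_forall fun v hv => ?_)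
    have hv0 : (0 : ℝ) < v := hv
    simp only [heq]
    exact (integrableOn_pow_mul_exp_neg_mul (by positivity) 0).const_mul _
  · have h := (integrableOn_exp_neg_div_add (div_pos hc ht) 1).const_mul (1 / t)
    refine h.congr ((ae_restrict_iff' measurableSet_Ioi).2 (Eventually.of_forall fun v hv => ?_))
    have hv0 : (0 : ℝ) < v := hv
    have h1 : ∀ k : ℝ, ‖Real.exp (-v - c * k / v) / v * Real.exp (-t * k)‖ =
        Real.exp (-v) / v * (k ^ 0 * Real.exp (-(t + c / v) * k)) := fun k => by
      rw [Real.norm_of_nonneg (by positivity), heq]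
    simp only [h1]
    rw [integral_const_mul, integral_pow_mul_exp_neg_mul (by positivity)]
    simp
    field_simp
    ring

theorem besselKZero_two_mul_sqrt (hc : 0 < c) {k : ℝ} (hk : 0 < k) :
    besselKZero (2 * Real.sqrt (c * k)) * Real.exp (-t * k) = 1 / 2 *
      ∫ v in Ioi (0 : ℝ), Real.exp (-v - c * k / v) / v * Real.exp (-t * k) := by
  rw [besselKZero_eq (by positivity), integral_mul_const, mul_assoc]
  simp only [mul_pow, Real.sq_sqrt (mul_pos hc hk).le]
  norm_num

theorem integrableOn_besselKZero_mul_exp (hc : 0 < c) (ht : 0 < t) :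
    IntegrableOn (fun k => besselKZero (2 * Real.sqrt (c * k)) * Real.exp (-t * k)) (Ioi 0) :=
  ((integrable_besselK_integrand hc ht).integral_prod_left.const_mul (1 / 2)).congr
    ((ae_restrict_iff' measurableSet_Ioi).2 (Eventually.of_forall fun _ hk =>
      (besselKZero_two_mul_sqrt hc hk).symm))

theorem integral_besselKZero_mul_exp (hc : 0 < c) (ht : 0 < t) :
    ∫ k in Ioi (0 : ℝ), besselKZero (2 * Real.sqrt (c * k)) * Real.exp (-t * k) =
      expMulE1 (c / t) / (2 * t) := by
  rw [setIntegral_congr_fun measurableSet_Ioi fun k hk => besselKZero_two_mul_sqrt (t := t) hc hk,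
    integral_const_mul, integral_integral_swap (integrable_besselK_integrand hc ht)]
  have h : ∀ v ∈ Ioi (0 : ℝ),
      ∫ k in Ioi (0 : ℝ), Real.exp (-v - c * k / v) / v * Real.exp (-t * k) =
      1 / t * (Real.exp (-v) / (c / t + v)) := by
    intro v hv
    have hv0 : (0 : ℝ) < v := hv
    have heq : ∀ k : ℝ, Real.exp (-v - c * k / v) / v * Real.exp (-t * k) =
        Real.exp (-v) / v * (k ^ 0 * Real.exp (-(t + c / v) * k)) := fun k => by
      rw [pow_zero, one_mul, div_mul_eq_mul_div, div_mul_eq_mul_div, ← Real.exp_add, ← Real.exp_add]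
      congr 2
      ring
    simp only [heq]
    rw [integral_const_mul, integral_pow_mul_exp_neg_mul (by positivity)]
    simp
    field_simp
    ring
  rw [setIntegral_congr_fun measurableSet_Ioi h, integral_const_mul, expMulE1]
  field_simp

theorem besselKZero_nonneg (x : ℝ) : 0 ≤ besselKZero x :=
  setIntegral_nonneg measurableSet_Ioi fun _ _ => (Real.exp_pos _).le

end BesselK

/-! ### `Y₀(2√κ)`: differential equation and a global bound. -/

section BesselY

/-- The coefficients of `J₀(2√κ)` as a power series in `κ`. -/
noncomputable def besselJCoeff (m : ℕ) : ℝ := (-1) ^ m / (m.factorial : ℝ) ^ 2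

/-- The coefficients of the entire part of `Y₀(2√κ)` as a power series in `κ`. -/
noncomputable def besselYCoeff (m : ℕ) : ℝ := (-1) ^ m * (harmonic m : ℝ) / (m.factorial : ℝ) ^ 2

theorem expType_besselJCoeff : ExpType besselJCoeff := by
  refine ⟨1, 1, zero_le_one, zero_le_one, fun m => ?_⟩
  rw [besselJCoeff, abs_div, abs_pow, abs_neg, abs_one, one_pow, one_mul, abs_pow, Nat.abs_cast]
  have h : (1 : ℝ) ≤ m.factorial := by exact_mod_cast m.factorial_pos
  gcongr
  nlinarith

theorem expType_besselYCoeff : ExpType besselYCoeff := by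
  refine ⟨1, 2, zero_le_one, zero_le_two, fun m => ?_⟩
  rw [besselYCoeff, abs_div, abs_mul, abs_pow, abs_neg, abs_one, one_pow, one_mul, one_mul, abs_pow,
    Nat.abs_cast, abs_of_nonneg (harmonic_nonneg m)]
  have h : (1 : ℝ) ≤ m.factorial := by exact_mod_cast m.factorial_pos
  gcongr
  · exact (harmonic_le_self m).trans (by exact_mod_cast (Nat.lt_two_pow_self (n := m)).le)
  · nlinarith

/-- `Y₀(2√κ)` as a function of `κ`. -/
noncomputable def besselYSqrt (κ : ℝ) : ℝ :=
  1 / Real.pi * (Real.log κ + 2 * Real.eulerMascheroniConstant) * (∑' m, besselJCoeff m * κ ^ m) -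
    2 / Real.pi * ∑' m, besselYCoeff m * κ ^ m

theorem besselYZero_two_mul_sqrt {κ : ℝ} (hκ : 0 < κ) :
    besselYZero (2 * Real.sqrt κ) = besselYSqrt κ := by
  have h1 : (2 * Real.sqrt κ) ^ 2 / 4 = κ := by rw [mul_pow, Real.sq_sqrt hκ.le]; ring
  have h2 : Real.log (2 * Real.sqrt κ / 2) = Real.log κ / 2 := by
    rw [mul_div_cancel_left₀ _ two_ne_zero, Real.log_sqrt hκ.le]
  rw [besselYZero, besselJZero, h1, h2, besselYSqrt]
  congr 1
  · simp only [besselJCoeff, div_mul_eq_mul_div]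
    ring
  · simp only [besselYCoeff, div_mul_eq_mul_div]

/-- The operator `x D² + D` sends `x^{m+1}` to `(m+1)² x^m`, so Bessel's equation reduces to
recurrences for the coefficients. -/
theorem ExpType.mul_deriv2_add_deriv {a : ℕ → ℝ} (ha : ExpType a) (x : ℝ) :
    x * (∑' m : ℕ, ((m : ℝ) + 1) * (((m + 1 : ℕ) : ℝ) + 1) * a (m + 1 + 1) * x ^ m) +
      ∑' m : ℕ, ((m : ℝ) + 1) * a (m + 1) * x ^ m =
        ∑' m : ℕ, ((m : ℝ) + 1) ^ 2 * a (m + 1) * x ^ m := by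
  have h1 := ha.deriv.summable_mul_pow x
  have h2 := ha.deriv.deriv.summable_mul_pow x
  have h3 : HasSum (fun m : ℕ => (m : ℝ) * (((m : ℝ) + 1) * a (m + 1)) * x ^ m)
      (x * ∑' m : ℕ, ((m : ℝ) + 1) * (((m + 1 : ℕ) : ℝ) + 1) * a (m + 1 + 1) * x ^ m) := by
    rw [← hasSum_nat_add_iff' 1]
    have := h2.hasSum.mul_left x
    simp only [Finset.range_one, Finset.sum_singleton, Nat.cast_zero, zero_mul, sub_zero]
    have e1 : (fun m : ℕ => ((m + 1 : ℕ) : ℝ) * ((((m + 1 : ℕ) : ℝ) + 1) * a (m + 1 + 1)) *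
        x ^ (m + 1)) = fun m : ℕ =>
        x * (((m : ℝ) + 1) * ((((m + 1 : ℕ) : ℝ) + 1) * a (m + 1 + 1)) * x ^ m) := by
      ext m; push_cast; ring
    rw [e1]
    simpa only [mul_assoc] using this
  rw [← (h3.add h1.hasSum).tsum_eq]
  exact tsum_congr fun m => by ring

/-- The derivative of `besselYSqrt`. -/
noncomputable def besselYSqrtDeriv (κ : ℝ) : ℝ :=
  1 / Real.pi * (1 / κ * (∑' m, besselJCoeff m * κ ^ m) +
    (Real.log κ + 2 * Real.eulerMascheroniConstant) *
      ∑' m : ℕ, ((m : ℝ) + 1) * besselJCoeff (m + 1) * κ ^ m) -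
    2 / Real.pi * ∑' m : ℕ, ((m : ℝ) + 1) * besselYCoeff (m + 1) * κ ^ m

theorem hasDerivAt_besselYSqrt {κ : ℝ} (hκ : 0 < κ) :
    HasDerivAt besselYSqrt (besselYSqrtDeriv κ) κ := by
  refine ((((((Real.hasDerivAt_log hκ.ne').add_const _).const_mul (1 / Real.pi))).mul
    (expType_besselJCoeff.hasDerivAt κ)).sub
    ((expType_besselYCoeff.hasDerivAt κ).const_mul (2 / Real.pi))).congr_deriv ?_
  rw [besselYSqrtDeriv]
  ring

/-- This is Bessel's equation in the variable `κ`, namely `κ w'' + w' + w = 0`, which is what makes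
the energy in the next lemma monotone. -/
theorem hasDerivAt_besselYSqrtDeriv {κ : ℝ} (hκ : 0 < κ) :
    HasDerivAt besselYSqrtDeriv (-(besselYSqrtDeriv κ + besselYSqrt κ) / κ) κ := by
  have hJ := expType_besselJCoeff.mul_deriv2_add_deriv κ
  have hY := expType_besselYCoeff.mul_deriv2_add_deriv κ
  have hJ' : ∑' m : ℕ, ((m : ℝ) + 1) ^ 2 * besselJCoeff (m + 1) * κ ^ m =
      -∑' m, besselJCoeff m * κ ^ m := by
    rw [← tsum_neg]
    refine tsum_congr fun m => ?_
    rw [besselJCoeff, besselJCoeff, Nat.factorial_succ]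
    push_cast
    field_simp
    ring
  -- The extra `J₀'` series comes from `H_{m+1} - H_m`; it cancels the cross term produced by
  -- differentiating `log κ · J₀` twice.
  have hY' : ∑' m : ℕ, ((m : ℝ) + 1) ^ 2 * besselYCoeff (m + 1) * κ ^ m =
      -(∑' m, besselYCoeff m * κ ^ m) + ∑' m : ℕ, ((m : ℝ) + 1) * besselJCoeff (m + 1) * κ ^ m := by
    rw [← ((expType_besselYCoeff.summable_mul_pow κ).hasSum.neg.add
      (expType_besselJCoeff.deriv.summable_mul_pow κ).hasSum).tsum_eq]
    refine tsum_congr fun m => ?_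
    rw [besselJCoeff, besselYCoeff, besselYCoeff, Nat.factorial_succ, harmonic_succ]
    push_cast
    field_simp
    ring
  have h2J := expType_besselJCoeff.deriv.hasDerivAt κ
  have h2Y := expType_besselYCoeff.deriv.hasDerivAt κ
  simp only [← mul_assoc] at h2J h2Y
  rw [hJ'] at hJ
  rw [hY'] at hY
  have hinv : HasDerivAt (fun κ : ℝ => 1 / κ) (-(κ ^ 2)⁻¹) κ := by
    simpa [one_div] using hasDerivAt_inv hκ.ne'
  refine ((((hinv.mul (expType_besselJCoeff.hasDerivAt κ)).add
    (((Real.hasDerivAt_log hκ.ne').add_const (2 * Real.eulerMascheroniConstant)).mul h2J)).const_mul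
      (1 / Real.pi)).sub (h2Y.const_mul (2 / Real.pi))).congr_deriv ?_
  rw [besselYSqrtDeriv, besselYSqrt]
  set J0 := ∑' m, besselJCoeff m * κ ^ m
  set J1 := ∑' m : ℕ, ((m : ℝ) + 1) * besselJCoeff (m + 1) * κ ^ m
  set J2 := ∑' m : ℕ, ((m : ℝ) + 1) * (((m + 1 : ℕ) : ℝ) + 1) * besselJCoeff (m + 1 + 1) * κ ^ m
  set Y0 := ∑' m, besselYCoeff m * κ ^ m
  set Y1 := ∑' m : ℕ, ((m : ℝ) + 1) * besselYCoeff (m + 1) * κ ^ m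
  set Y2 := ∑' m : ℕ, ((m : ℝ) + 1) * (((m + 1 : ℕ) : ℝ) + 1) * besselYCoeff (m + 1 + 1) * κ ^ m
  have e1 : J2 = (-J0 - J1) / κ := by rw [eq_div_iff hκ.ne']; linarith
  have e2 : Y2 = (-Y0 + J1 - Y1) / κ := by rw [eq_div_iff hκ.ne']; linarith
  rw [e1, e2]
  have := Real.pi_pos
  field_simp
  ring

/-- For large `κ` the energy argument replaces the asymptotic expansion of `Y₀`: only boundedness is
needed. For `κ ≤ 1` the defining expression shows a logarithm times functions bounded on `[0, 1]`.
-/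
theorem exists_abs_besselYSqrt_le :
    ∃ C : ℝ, 0 ≤ C ∧ ∀ κ : ℝ, 0 < κ → |besselYSqrt κ| ≤ C * (1 + |Real.log κ|) := by
  -- for `κ ≥ 1`, the energy `w² + κ w'²` decreases
  have hE : AntitoneOn (fun κ => besselYSqrt κ ^ 2 + κ * besselYSqrtDeriv κ ^ 2) (Ici 1) := by
    have hd : ∀ κ : ℝ, 0 < κ → HasDerivAt
        (fun κ => besselYSqrt κ ^ 2 + κ * besselYSqrtDeriv κ ^ 2) (-besselYSqrtDeriv κ ^ 2) κ := by
      intro κ hκ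
      refine (((hasDerivAt_besselYSqrt hκ).pow 2).add
        ((hasDerivAt_id κ).mul ((hasDerivAt_besselYSqrtDeriv hκ).pow 2))).congr_deriv ?_
      simp only [id, Pi.pow_apply]
      field_simp
      push_cast
      ring
    refine antitoneOn_of_deriv_nonpos (convex_Ici 1)
      (fun κ hκ => (hd κ (one_pos.trans_le hκ)).continuousAt.continuousWithinAt)
      (fun κ hκ => ?_) (fun κ hκ => ?_)
    · rw [interior_Ici] at hκ
      exact (hd κ (one_pos.trans hκ)).differentiableAt.differentiableWithinAt
    · rw [interior_Ici] at hκ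
      rw [(hd κ (one_pos.trans hκ)).deriv]
      nlinarith [sq_nonneg (besselYSqrtDeriv κ)]
  set e := besselYSqrt 1 ^ 2 + 1 * besselYSqrtDeriv 1 ^ 2
  have hcont : Continuous fun κ : ℝ => |∑' m, besselJCoeff m * κ ^ m| :=
    (continuous_iff_continuousAt.2 fun κ => (expType_besselJCoeff.hasDerivAt κ).continuousAt).abs
  have hcont' : Continuous fun κ : ℝ => |∑' m, besselYCoeff m * κ ^ m| :=
    (continuous_iff_continuousAt.2 fun κ => (expType_besselYCoeff.hasDerivAt κ).continuousAt).abs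
  obtain ⟨M, hM⟩ := (isCompact_Icc (a := (0 : ℝ)) (b := 1)).bddAbove_image hcont.continuousOn
  obtain ⟨N, hN⟩ := (isCompact_Icc (a := (0 : ℝ)) (b := 1)).bddAbove_image hcont'.continuousOn
  have hM' : ∀ κ ∈ Icc (0 : ℝ) 1, |∑' m, besselJCoeff m * κ ^ m| ≤ M := fun κ hκ => hM ⟨κ, hκ, rfl⟩
  have hN' : ∀ κ ∈ Icc (0 : ℝ) 1, |∑' m, besselYCoeff m * κ ^ m| ≤ N := fun κ hκ => hN ⟨κ, hκ, rfl⟩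
  have hM0 : 0 ≤ M := (abs_nonneg _).trans (hM' 0 (by simp))
  have hN0 : 0 ≤ N := (abs_nonneg _).trans (hN' 0 (by simp))
  have hpi := Real.pi_pos
  set γ' := |2 * Real.eulerMascheroniConstant|
  refine ⟨√e + 1 / Real.pi * (1 + γ') * M + 2 / Real.pi * N, by positivity, fun κ hκ => ?_⟩
  have hl := abs_nonneg (Real.log κ)
  rcases le_total 1 κ with h1 | h1
  · have h2 := hE (mem_Ici.2 le_rfl) (mem_Ici.2 h1) h1
    have h3 : besselYSqrt κ ^ 2 ≤ e := by
      have : 0 ≤ κ * besselYSqrtDeriv κ ^ 2 := by positivity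
      simp only at h2
      linarith
    have h4 := Real.abs_le_sqrt h3
    calc |besselYSqrt κ| ≤ (√e + 1 / Real.pi * (1 + γ') * M + 2 / Real.pi * N) * 1 := by
          rw [mul_one]
          have : 0 ≤ 1 / Real.pi * (1 + γ') * M + 2 / Real.pi * N := by positivity
          linarith
      _ ≤ _ := by gcongr; linarith
  · have h2 := hM' κ ⟨hκ.le, h1⟩
    have h3 := hN' κ ⟨hκ.le, h1⟩
    rw [besselYSqrt]
    refine (abs_sub _ _).trans ?_
    rw [abs_mul, abs_mul, abs_mul, abs_of_pos (by positivity : 0 < 1 / Real.pi),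
      abs_of_pos (by positivity : 0 < 2 / Real.pi)]
    have h4 : |Real.log κ + 2 * Real.eulerMascheroniConstant| ≤ (1 + γ') * (1 + |Real.log κ|) := by
      refine (abs_add_le _ _).trans ?_
      have : 0 ≤ γ' * |Real.log κ| := by positivity
      change |Real.log κ| + γ' ≤ _
      nlinarith
    calc 1 / Real.pi * |Real.log κ + 2 * Real.eulerMascheroniConstant| *
          |∑' m, besselJCoeff m * κ ^ m| + 2 / Real.pi * |∑' m, besselYCoeff m * κ ^ m|
        ≤ 1 / Real.pi * ((1 + γ') * (1 + |Real.log κ|)) * M + 2 / Real.pi * N := by gcongr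
      _ ≤ (1 / Real.pi * (1 + γ') * M + 2 / Real.pi * N) * (1 + |Real.log κ|) := by
          have : 0 ≤ 2 / Real.pi * N * |Real.log κ| := by positivity
          nlinarith
      _ ≤ _ := by
          gcongr
          linarith [Real.sqrt_nonneg e]

end BesselY

/-! ### Origin of the weight `(1 + |log t|)/t`. -/

section LogWeight

theorem integrableOn_one_add_abs_log_mul_exp {t : ℝ} (ht : 0 < t) :
    IntegrableOn (fun k : ℝ => (1 + |Real.log k|) * Real.exp (-t * k)) (Ioi 0) := by
  have h1 := integrableOn_pow_mul_exp_neg_mul ht 0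
  have h2 := (integrableOn_log_mul_pow_mul_exp_neg_mul ht 0).norm
  refine (h1.add h2).congr (Eventually.of_forall fun k => ?_)
  simp only [Pi.add_apply, pow_zero, one_mul, norm_mul, Real.norm_eq_abs, Real.abs_exp]
  ring

/-- Scaling `u = tk` produces the factor `1/t` and shifts the logarithm by `log t`. Every kernel
with at most logarithmic growth thus has a Laplace transform controlled by the same weight. -/
theorem exists_integral_one_add_abs_log_mul_exp_le :
    ∃ C : ℝ, 0 ≤ C ∧ ∀ t : ℝ, 0 < t →
      ∫ k in Ioi (0 : ℝ), (1 + |Real.log k|) * Real.exp (-t * k) ≤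
        C * ((1 + |Real.log t|) / t) := by
  set D := ∫ u in Ioi (0 : ℝ), (1 + |Real.log u|) * Real.exp (-1 * u)
  have hi1 := integrableOn_one_add_abs_log_mul_exp one_pos
  have he : IntegrableOn (fun u : ℝ => Real.exp (-1 * u)) (Ioi 0) := by
    simpa using integrableOn_exp_neg
  have heI : ∫ u in Ioi (0 : ℝ), Real.exp (-1 * u) = 1 := by
    simpa using integral_exp_neg_Ioi'
  -- Needed to absorb `D + |log t|` into `D (1 + |log t|)`.
  have hD : 1 ≤ D := by
    rw [← heI]
    refine setIntegral_mono_on he hi1 measurableSet_Ioi fun u _ => ?_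
    nlinarith [Real.exp_pos (-1 * u), abs_nonneg (Real.log u)]
  refine ⟨D, by linarith, fun t ht => ?_⟩
  have h := integral_comp_mul_left_Ioi
    (fun u : ℝ => (1 + |Real.log (t⁻¹ * u)|) * Real.exp (-1 * u)) 0 ht
  simp only [mul_zero, inv_mul_cancel_left₀ ht.ne', smul_eq_mul] at h
  have h' : ∀ k : ℝ, (1 + |Real.log k|) * Real.exp (-t * k) =
    (1 + |Real.log k|) * Real.exp (-1 * (t * k)) := fun k => by congr 2; ring
  simp_rw [h']
  rw [h]
  have hb := hi1.add (he.const_mul |Real.log t|)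
  have hle : ∀ u ∈ Ioi (0 : ℝ), (1 + |Real.log (t⁻¹ * u)|) * Real.exp (-1 * u) ≤
      (1 + |Real.log u|) * Real.exp (-1 * u) + |Real.log t| * Real.exp (-1 * u) := by
    intro u hu
    rw [← add_mul]
    refine mul_le_mul_of_nonneg_right ?_ (Real.exp_pos _).le
    rw [Real.log_mul (inv_ne_zero ht.ne') (ne_of_gt hu), Real.log_inv]
    have := abs_add_le (-Real.log t) (Real.log u)
    rw [abs_neg] at this
    linarith
  have hint : ∫ u in Ioi (0 : ℝ), (1 + |Real.log (t⁻¹ * u)|) * Real.exp (-1 * u) ≤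
      D + |Real.log t| := by
    have h3 := integral_mono_of_nonneg (μ := volume.restrict (Ioi (0 : ℝ)))
      (f := fun u : ℝ => (1 + |Real.log (t⁻¹ * u)|) * Real.exp (-1 * u))
      (Eventually.of_forall fun u => by positivity) hb
      ((ae_restrict_iff' measurableSet_Ioi).2 (Eventually.of_forall hle))
    refine h3.trans_eq ?_
    have h4 := integral_add hi1 (he.const_mul |Real.log t|)
    simp only [Pi.add_apply]
    rw [h4, integral_const_mul, heI, mul_one]
  calc t⁻¹ * ∫ u in Ioi (0 : ℝ), (1 + |Real.log (t⁻¹ * u)|) * Real.exp (-1 * u)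
      ≤ t⁻¹ * (D + |Real.log t|) := by gcongr
    _ ≤ t⁻¹ * (D * (1 + |Real.log t|)) := by
        gcongr
        nlinarith [abs_nonneg (Real.log t)]
    _ = _ := by ring

end LogWeight

/-! ### The Laplace transform of the Voronoï kernel. -/

section VoronoiKernelLaplace

variable {c t : ℝ}

/-- For `k ≤ 1` the power is at most `1`, and for `k ≥ 1` the logarithm is at most `k`. The first
resulting term does not depend on `m`, which keeps the later series summable. -/
theorem integral_norm_log_mul_pow_mul_exp_le (ht : 0 < t) (m : ℕ) :
    ∫ k in Ioi (0 : ℝ), ‖Real.log k * (k ^ m * Real.exp (-t * k))‖ ≤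
      (∫ k in Ioi (0 : ℝ), (1 + |Real.log k|) * Real.exp (-t * k)) +
        (m + 1).factorial / t ^ (m + 2) := by
  rw [← integral_pow_mul_exp_neg_mul ht (m + 1), ← integral_add
    (integrableOn_one_add_abs_log_mul_exp ht) (integrableOn_pow_mul_exp_neg_mul ht (m + 1))]
  refine setIntegral_mono_on (integrableOn_log_mul_pow_mul_exp_neg_mul ht m).norm
    ((integrableOn_one_add_abs_log_mul_exp ht).add (integrableOn_pow_mul_exp_neg_mul ht (m + 1)))
    measurableSet_Ioi fun k hk => ?_
  have hk0 : (0 : ℝ) < k := hk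
  rw [norm_mul, Real.norm_of_nonneg (by positivity : 0 ≤ k ^ m * Real.exp (-t * k)), ← mul_assoc,
    ← add_mul, Real.norm_eq_abs]
  refine mul_le_mul_of_nonneg_right ?_ (Real.exp_pos _).le
  have hl := abs_nonneg (Real.log k)
  rcases le_total k 1 with h1 | h1
  · have h2 : k ^ m ≤ 1 := pow_le_one₀ hk0.le h1
    have h3 : 0 ≤ k ^ (m + 1) := by positivity
    nlinarith
  · have h2 : |Real.log k| ≤ k := by
      rw [abs_of_nonneg (Real.log_nonneg h1)]
      linarith [Real.log_le_sub_one_of_pos hk0]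
    have h3 : |Real.log k| * k ^ m ≤ k * k ^ m := by gcongr
    rw [pow_succ']
    linarith

/-- The power series, including its part multiplied by `log k`, is integrated termwise. Each moment
supplies an `m!` that cancels one of the two factorials in the Bessel coefficients, leaving
exponential series in `c/t`. -/
theorem integral_besselYSqrt_mul_exp (hc : 0 < c) (ht : 0 < t) :
    ∫ k in Ioi (0 : ℝ), besselYSqrt (c * k) * Real.exp (-t * k) =
      expMulEi (c / t) / (Real.pi * t) := by
  have hpi := Real.pi_pos
  set l := 1 / Real.pi * (Real.log c + 2 * Real.eulerMascheroniConstant) with hl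
  set α : ℕ → ℝ := fun m => (l * besselJCoeff m - 2 / Real.pi * besselYCoeff m) * c ^ m with hα
  set β : ℕ → ℝ := fun m => 1 / Real.pi * besselJCoeff m * c ^ m with hβ
  set F : ℕ → ℝ → ℝ := fun m k => α m * (k ^ m * Real.exp (-t * k)) +
    β m * (Real.log k * (k ^ m * Real.exp (-t * k))) with hF
  have hi1 := fun m => (integrableOn_pow_mul_exp_neg_mul ht m).const_mul (α m)
  have hi2 := fun m => (integrableOn_log_mul_pow_mul_exp_neg_mul ht m).const_mul (β m)
  set D := ∫ k in Ioi (0 : ℝ), (1 + |Real.log k|) * Real.exp (-t * k)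
  have hD : 0 ≤ D := setIntegral_nonneg measurableSet_Ioi fun k _ => by positivity
  have hf1 : ∀ m : ℕ, (1 : ℝ) ≤ m.factorial := fun m => by exact_mod_cast m.factorial_pos
  have hJ : ∀ m, |besselJCoeff m| = 1 / (m.factorial : ℝ) ^ 2 := fun m => by
    rw [besselJCoeff, abs_div, abs_pow, abs_neg, abs_one, one_pow, abs_pow, Nat.abs_cast]
  have hY : ∀ m, |besselYCoeff m| ≤ 2 ^ m / (m.factorial : ℝ) ^ 2 := fun m => by
    rw [besselYCoeff, abs_div, abs_mul, abs_pow, abs_neg, abs_one, one_pow, one_mul, abs_pow,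
      Nat.abs_cast, abs_of_nonneg (harmonic_nonneg m)]
    gcongr
    exact (harmonic_le_self m).trans (by exact_mod_cast (Nat.lt_two_pow_self (n := m)).le)
  -- The extra powers of `2` absorb `H_m` and the factor `m + 1` from `(m+1)!`; the bound is a
  -- combination of terms of exponential series.
  have hnorm : ∀ m, ∫ k in Ioi (0 : ℝ), ‖F m k‖ ≤
      (|l| + 2 / Real.pi) / t * ((2 * c / t) ^ m / m.factorial) +
        (1 / Real.pi * D * (c ^ m / m.factorial) +
          1 / Real.pi / t ^ 2 * ((2 * c / t) ^ m / m.factorial)) := by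
    intro m
    have hfm := hf1 m
    have h1 : ∫ k in Ioi (0 : ℝ), ‖F m k‖ ≤ |α m| * (m.factorial / t ^ (m + 1)) +
        |β m| * (D + (m + 1).factorial / t ^ (m + 2)) := by
      calc ∫ k in Ioi (0 : ℝ), ‖F m k‖
          ≤ ∫ k in Ioi (0 : ℝ), (|α m| * (k ^ m * Real.exp (-t * k)) +
            |β m| * ‖Real.log k * (k ^ m * Real.exp (-t * k))‖) := by
            refine setIntegral_mono_on ((hi1 m).add (hi2 m)).norm
              (((integrableOn_pow_mul_exp_neg_mul ht m).const_mul _).add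
                ((integrableOn_log_mul_pow_mul_exp_neg_mul ht m).norm.const_mul _))
              measurableSet_Ioi fun k hk => ?_
            have hk0 : (0 : ℝ) < k := hk
            refine (norm_add_le _ _).trans_eq ?_
            rw [norm_mul, norm_mul (β m), Real.norm_eq_abs, Real.norm_eq_abs (β m),
              Real.norm_of_nonneg (by positivity : 0 ≤ k ^ m * Real.exp (-t * k))]
        _ ≤ _ := by
            rw [integral_add ((integrableOn_pow_mul_exp_neg_mul ht m).const_mul _)
                ((integrableOn_log_mul_pow_mul_exp_neg_mul ht m).norm.const_mul _),
              integral_const_mul, integral_const_mul, integral_pow_mul_exp_neg_mul ht]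
            gcongr
            exact integral_norm_log_mul_pow_mul_exp_le ht m
    have hαm : |α m| ≤ (|l| + 2 / Real.pi) * ((2 * c) ^ m / (m.factorial : ℝ) ^ 2) := by
      rw [hα]
      simp only
      rw [abs_mul, abs_of_pos (pow_pos hc m)]
      have h2 : |l * besselJCoeff m - 2 / Real.pi * besselYCoeff m| ≤
          (|l| + 2 / Real.pi) * (2 ^ m / (m.factorial : ℝ) ^ 2) := by
        refine (abs_sub _ _).trans ?_
        rw [abs_mul l, abs_mul (2 / Real.pi), hJ, abs_of_pos (by positivity : 0 < 2 / Real.pi),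
          add_mul]
        gcongr
        · exact one_le_pow₀ one_le_two
        · exact hY m
      calc _ ≤ (|l| + 2 / Real.pi) * (2 ^ m / (m.factorial : ℝ) ^ 2) * c ^ m := by gcongr
        _ = _ := by rw [mul_pow]; ring
    have hβm : |β m| = 1 / Real.pi * (c ^ m / (m.factorial : ℝ) ^ 2) := by
      rw [hβ]
      simp only
      rw [abs_mul, abs_mul, hJ, abs_of_pos (pow_pos hc m),
          abs_of_pos (by positivity : 0 < 1 / Real.pi)]
      ring
    refine h1.trans (add_le_add ?_ ?_)
    · refine (mul_le_mul_of_nonneg_right hαm (by positivity)).trans_eq ?_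
      rw [div_pow]
      field_simp
      ring
    · rw [hβm, mul_add]
      refine add_le_add ?_ ?_
      · have h3 : c ^ m / (m.factorial : ℝ) ^ 2 ≤ c ^ m / m.factorial := by
          gcongr
          nlinarith
        calc _ ≤ 1 / Real.pi * (c ^ m / m.factorial) * D := by gcongr
          _ = _ := by ring
      · have h4 : ((m : ℝ) + 1) ≤ 2 ^ m := by exact_mod_cast Nat.lt_two_pow_self (n := m)
        calc 1 / Real.pi * (c ^ m / (m.factorial : ℝ) ^ 2) * ((m + 1).factorial / t ^ (m + 2))
            = 1 / Real.pi / t ^ 2 * (((m : ℝ) + 1) * c ^ m / t ^ m / m.factorial) := by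
              rw [Nat.factorial_succ]; push_cast; field_simp; ring
          _ ≤ 1 / Real.pi / t ^ 2 * (2 ^ m * c ^ m / t ^ m / m.factorial) := by gcongr
          _ = _ := by rw [div_pow, mul_pow]
  have hsum : Summable fun m => ∫ k in Ioi (0 : ℝ), ‖F m k‖ :=
    Summable.of_nonneg_of_le (fun m => integral_nonneg fun k => norm_nonneg _) hnorm
      (((Real.summable_pow_div_factorial _).mul_left _).add
        (((Real.summable_pow_div_factorial _).mul_left _).add
          ((Real.summable_pow_div_factorial _).mul_left _)))
  have key : HasSum (fun m => ∫ k in Ioi (0 : ℝ), F m k) (∫ k in Ioi (0 : ℝ), ∑' m, F m k) :=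
    hasSum_integral_of_summable_integral_norm (fun m => (hi1 m).add (hi2 m)) hsum
  -- The `-2H_m` from the coefficients of `Y₀` meets `+H_m` from the logarithmic moment, while `2γ`
  -- meets `-γ`; this leaves the coefficients of `expMulEi`.
  have hval : ∀ m, ∫ k in Ioi (0 : ℝ), F m k = 1 / (Real.pi * t) *
      ((Real.log (c / t) + Real.eulerMascheroniConstant) * ((-(c / t)) ^ m / m.factorial) -
        ((-1) ^ m * (harmonic m : ℝ) / m.factorial) * (c / t) ^ m) := by
    intro m
    have h := integral_add (hi1 m) (hi2 m)
    rw [integral_const_mul, integral_const_mul, integral_pow_mul_exp_neg_mul ht,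
      integral_log_mul_pow_mul_exp_neg_mul ht] at h
    have hfm := hf1 m
    have hfm0 : (m.factorial : ℝ) ≠ 0 := by positivity
    rw [hF]
    simp only
    rw [h, Real.log_div hc.ne' ht.ne', neg_pow, div_pow]
    simp only [hα, hβ, hl, besselJCoeff, besselYCoeff]
    field_simp
    ring
  have hptw : ∀ k ∈ Ioi (0 : ℝ), ∑' m, F m k = besselYSqrt (c * k) * Real.exp (-t * k) := by
    intro k hk
    have h1 := (expType_besselJCoeff.summable_mul_pow (c * k)).hasSum.mul_left
      (l + 1 / Real.pi * Real.log k)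
    have h2 := (expType_besselYCoeff.summable_mul_pow (c * k)).hasSum.mul_left (2 / Real.pi)
    have h3 := (h1.sub h2).mul_right (Real.exp (-t * k))
    rw [besselYSqrt, Real.log_mul hc.ne' (ne_of_gt hk)]
    have h4 : (1 / Real.pi * (Real.log c + Real.log k + 2 * Real.eulerMascheroniConstant)) =
        l + 1 / Real.pi * Real.log k := by rw [hl]; ring
    rw [h4, ← h3.tsum_eq]
    refine tsum_congr fun m => ?_
    simp only [hF, hα, hβ, mul_pow]
    ring
  have key2 := key.tsum_eq
  rw [setIntegral_congr_fun measurableSet_Ioi hptw] at key2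
  rw [← key2]
  have hexp : HasSum (fun m : ℕ => (-(c / t)) ^ m / m.factorial) (Real.exp (-(c / t))) := by
    have h := NormedSpace.expSeries_div_hasSum_exp (𝔸 := ℝ) (-(c / t))
    rwa [← Real.exp_eq_exp_ℝ] at h
  have h5 := ((hexp.mul_left (Real.log (c / t) + Real.eulerMascheroniConstant)).sub
    (expType_harmonic_div_factorial.summable_mul_pow (c / t)).hasSum).mul_left (1 / (Real.pi * t))
  rw [tsum_congr hval, h5.tsum_eq, expMulEi, harmonicExpSeries]
  ring

theorem continuousOn_besselYSqrt : ContinuousOn besselYSqrt (Ioi 0) :=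
  fun _ hκ => (hasDerivAt_besselYSqrt hκ).continuousAt.continuousWithinAt

theorem exists_abs_besselYSqrt_mul_le (hc : 0 < c) :
    ∃ C : ℝ, 0 ≤ C ∧ ∀ k : ℝ, 0 < k → |besselYSqrt (c * k)| ≤ C * (1 + |Real.log k|) := by
  obtain ⟨C, hC, h⟩ := exists_abs_besselYSqrt_le
  refine ⟨C * (1 + |Real.log c|), by positivity, fun k hk => (h _ (mul_pos hc hk)).trans ?_⟩
  rw [mul_assoc, Real.log_mul hc.ne' hk.ne']
  refine mul_le_mul_of_nonneg_left ?_ hC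
  nlinarith [abs_add_le (Real.log c) (Real.log k), abs_nonneg (Real.log c), abs_nonneg (Real.log k)]

theorem aestronglyMeasurable_besselYSqrt_mul (hc : 0 < c) :
    AEStronglyMeasurable (fun k => besselYSqrt (c * k)) (volume.restrict (Ioi 0)) :=
  (continuousOn_besselYSqrt.comp (by fun_prop) fun _ hk => mul_pos hc hk).aestronglyMeasurable
    measurableSet_Ioi

theorem integrableOn_besselYSqrt_mul_exp (hc : 0 < c) (ht : 0 < t) :
    IntegrableOn (fun k => besselYSqrt (c * k) * Real.exp (-t * k)) (Ioi 0) := by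
  obtain ⟨C, hC, h⟩ := exists_abs_besselYSqrt_mul_le hc
  refine ((integrableOn_one_add_abs_log_mul_exp ht).const_mul C).mono'
    ((aestronglyMeasurable_besselYSqrt_mul hc).mul (by
      have : Continuous fun k : ℝ => Real.exp (-t * k) := by fun_prop
      exact this.aestronglyMeasurable))
    ((ae_restrict_iff' measurableSet_Ioi).2 (Eventually.of_forall fun k hk => ?_))
  rw [norm_mul, Real.norm_eq_abs, Real.norm_of_nonneg (Real.exp_pos _).le, ← mul_assoc]
  exact mul_le_mul_of_nonneg_right (h k hk) (Real.exp_pos _).le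

theorem four_pi_sq_mul_pos (n : ℕ+) : 0 < 4 * Real.pi ^ 2 * (n : ℝ) := by
  have := Real.pi_pos
  have : (0 : ℝ) < n := by exact_mod_cast n.pos
  positivity

theorem voronoiKernel_eq (n : ℕ+) {k : ℝ} (hk : 0 < k) :
    voronoiKernel n k = 2 / Real.pi * besselKZero (2 * Real.sqrt (4 * Real.pi ^ 2 * n * k)) -
      besselYSqrt (4 * Real.pi ^ 2 * n * k) := by
  rw [← besselYZero_two_mul_sqrt (mul_pos (four_pi_sq_mul_pos n) hk), voronoiKernel]
  have : 4 * Real.pi * Real.sqrt ((n : ℝ) * k) = 2 * Real.sqrt (4 * Real.pi ^ 2 * n * k) := by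
    rw [show 4 * Real.pi ^ 2 * n * k = (2 * Real.pi) ^ 2 * ((n : ℝ) * k) by ring,
      Real.sqrt_mul (by positivity : 0 ≤ (2 * Real.pi) ^ 2), Real.sqrt_sq (by positivity)]
    ring
  rw [this]

theorem voronoiKernel_mul_exp_eq (n : ℕ+) {k : ℝ} (hk : 0 < k) :
    voronoiKernel n k * Real.exp (-t * k) =
      2 / Real.pi * (besselKZero (2 * Real.sqrt (4 * Real.pi ^ 2 * n * k)) * Real.exp (-t * k)) -
        besselYSqrt (4 * Real.pi ^ 2 * n * k) * Real.exp (-t * k) := by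
  rw [voronoiKernel_eq n hk]; ring

theorem integrableOn_voronoiKernel_mul_exp (n : ℕ+) (ht : 0 < t) :
    IntegrableOn (fun k => voronoiKernel n k * Real.exp (-t * k)) (Ioi 0) :=
  (((integrableOn_besselKZero_mul_exp (four_pi_sq_mul_pos n) ht).const_mul (2 / Real.pi)).sub
    (integrableOn_besselYSqrt_mul_exp (four_pi_sq_mul_pos n) ht)).congr
    ((ae_restrict_iff' measurableSet_Ioi).2 (Eventually.of_forall fun _ hk =>
      (voronoiKernel_mul_exp_eq n hk).symm))

/-- Measurability is read off the integrable product with `e^{-k}` by multiplying back by `e^k`. -/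
theorem aestronglyMeasurable_voronoiKernel (n : ℕ+) :
    AEStronglyMeasurable (voronoiKernel n) (volume.restrict (Ioi 0)) := by
  have h := (integrableOn_voronoiKernel_mul_exp n one_pos).aestronglyMeasurable.mul
    (show AEStronglyMeasurable (fun k : ℝ => Real.exp (1 * k)) (volume.restrict (Ioi 0)) by
      have : Continuous fun k : ℝ => Real.exp (1 * k) := by fun_prop
      exact this.aestronglyMeasurable)
  refine h.congr (Eventually.of_forall fun k => ?_)
  simp only [Pi.mul_apply]
  rw [mul_assoc, ← Real.exp_add]
  simp

/-- The factors `2/π` and `-1` in the kernel are exactly those that pair `expMulE1` with `expMulEi`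
into their difference, which is `2 * cosConjLorentz`. -/
theorem integral_voronoiKernel_mul_exp (n : ℕ+) (ht : 0 < t) :
    ∫ k in Ioi (0 : ℝ), voronoiKernel n k * Real.exp (-t * k) =
      2 / (Real.pi * t) * cosConjLorentz (4 * Real.pi ^ 2 * n / t) := by
  have hc := four_pi_sq_mul_pos n
  rw [setIntegral_congr_fun measurableSet_Ioi fun k hk => voronoiKernel_mul_exp_eq n hk,
    integral_sub ((integrableOn_besselKZero_mul_exp hc ht).const_mul (2 / Real.pi))
    (integrableOn_besselYSqrt_mul_exp hc ht), integral_const_mul,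
    integral_besselKZero_mul_exp hc ht, integral_besselYSqrt_mul_exp hc ht]
  have h := expMulE1_sub_expMulEi (div_pos hc ht)
  rw [eq_add_of_sub_eq h]
  have := Real.pi_pos
  field_simp
  ring

/-- `K₀` is nonnegative, so its exact transform serves as its norm integral; `Y₀` is bounded
logarithmically. The constant may depend on `n`, because this estimate only justifies Fubini for
each `n`; summability over `n` comes from the closed form. -/
theorem exists_integral_norm_voronoiKernel_mul_exp_le (n : ℕ+) {T : ℝ} (hT : 0 < T) :
    ∃ C : ℝ, ∀ t ∈ Ioc 0 T, ∫ k in Ioi (0 : ℝ), ‖voronoiKernel n k‖ * Real.exp (-t * k) ≤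
      C * ((1 + |Real.log t|) / t) := by
  have hc := four_pi_sq_mul_pos n
  have hpi := Real.pi_pos
  obtain ⟨C₁, hC₁, h₁⟩ := exists_abs_besselYSqrt_mul_le hc
  obtain ⟨C₂, hC₂, h₂⟩ := exists_integral_one_add_abs_log_mul_exp_le
  set c := 4 * Real.pi ^ 2 * (n : ℝ)
  refine ⟨T / (Real.pi * c) + C₁ * C₂, fun t ht => ?_⟩
  have ht0 := ht.1
  have hle : ∀ k ∈ Ioi (0 : ℝ), ‖voronoiKernel n k‖ * Real.exp (-t * k) ≤
      2 / Real.pi * (besselKZero (2 * Real.sqrt (c * k)) * Real.exp (-t * k)) +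
        C₁ * ((1 + |Real.log k|) * Real.exp (-t * k)) := by
    intro k hk
    rw [← mul_assoc, ← mul_assoc, ← add_mul]
    refine mul_le_mul_of_nonneg_right ?_ (Real.exp_pos _).le
    rw [voronoiKernel_eq n hk, Real.norm_eq_abs]
    refine (abs_sub _ _).trans (add_le_add ?_ (h₁ k hk))
    rw [abs_of_nonneg (mul_nonneg (by positivity) (besselKZero_nonneg _))]
  have hi1 := (integrableOn_besselKZero_mul_exp hc ht0).const_mul (2 / Real.pi)
  have hi2 := (integrableOn_one_add_abs_log_mul_exp ht0).const_mul C₁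
  have h3 := integral_mono_of_nonneg (μ := volume.restrict (Ioi (0 : ℝ)))
      (f := fun k : ℝ => ‖voronoiKernel n k‖ * Real.exp (-t * k))
      (Eventually.of_forall fun u => by positivity) (hi1.add hi2)
      ((ae_restrict_iff' measurableSet_Ioi).2 (Eventually.of_forall hle))
  refine h3.trans ?_
  have h4 := integral_add hi1 hi2
  simp only [Pi.add_apply]
  rw [h4, integral_const_mul, integral_const_mul, integral_besselKZero_mul_exp hc ht0, add_mul]
  refine add_le_add ?_ ?_
  · have h5 := expMulE1_le (div_pos hc ht0)
    have h6 : 1 / t ≤ (1 + |Real.log t|) / t := by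
      gcongr
      linarith [abs_nonneg (Real.log t)]
    calc 2 / Real.pi * (expMulE1 (c / t) / (2 * t)) ≤ 2 / Real.pi * (1 / (c / t) / (2 * t)) := by
          gcongr
      _ = t / (Real.pi * c) * (1 / t) := by field_simp
      _ ≤ T / (Real.pi * c) * ((1 + |Real.log t|) / t) := by
          gcongr
          exact ht.2
  · rw [mul_assoc]
    exact mul_le_mul_of_nonneg_left (h₂ t ht0) hC₁

end VoronoiKernelLaplace

/-! ### Partial fractions of `1/(e^x - 1)` and the product for `sinh`. -/

section PartialFractions

theorem HasSum.of_eq {ι α : Type*} [AddCommMonoid α] [TopologicalSpace α] {f g : ι → α} {a b : α}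
    (h : HasSum f a) (hf : ∀ i, g i = f i) (hb : b = a) : HasSum g b := by
  rw [hb, show g = f from funext hf]
  exact h

/-- This is the cotangent expansion at the imaginary point `z = ix/(2π)`, where `e^{2πiz} = e^{-x}`.
-/
theorem hasSum_exp_sub_one_inv {x : ℝ} (hx : 0 < x) :
    HasSum (fun k : ℕ => 2 * x / (x ^ 2 + 4 * Real.pi ^ 2 * ((k : ℝ) + 1) ^ 2))
      (1 / (Real.exp x - 1) - 1 / x + 1 / 2) := by
  have hpi := Real.pi_pos
  set z : ℂ := Complex.I * (x / (2 * Real.pi) : ℝ) with hz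
  have hzc : z ∈ Complex.integerComplement := by
    rintro ⟨n, hn⟩
    have him := congrArg Complex.im hn
    rw [hz, Complex.I_mul_im, Complex.ofReal_re, Complex.intCast_im] at him
    have : 0 < x / (2 * Real.pi) := by positivity
    linarith
  have h1 := cot_series_rep' hzc
  have h2 := (summable_cotTerm hzc).hasSum
  simp only [cotTerm] at h2
  rw [← h1, Complex.cot_pi_eq_exp_ratio] at h2
  have hexp : Complex.exp (2 * Real.pi * Complex.I * z) = (Real.exp (-x) : ℂ) := by
    rw [hz, Complex.ofReal_exp]
    congr 1
    push_cast
    have : (Real.pi : ℂ) ≠ 0 := by exact_mod_cast hpi.ne'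
    field_simp
    rw [Complex.I_sq]
    ring
  rw [hexp] at h2
  have h3 := h2.mul_left (Complex.I / (2 * Real.pi))
  have hpi' : (Real.pi : ℂ) ≠ 0 := by exact_mod_cast hpi.ne'
  have hxc : (x : ℂ) ≠ 0 := by exact_mod_cast hx.ne'
  rw [← Complex.hasSum_ofReal]
  refine h3.of_eq (fun k => ?_) ?_
  · have hk : ((k : ℂ) + 1) ≠ 0 := by exact_mod_cast k.succ_ne_zero
    have hd : (x ^ 2 + 4 * Real.pi ^ 2 * ((k : ℝ) + 1) ^ 2 : ℂ) ≠ 0 := by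
      have : (x ^ 2 + 4 * Real.pi ^ 2 * ((k : ℝ) + 1) ^ 2 : ℝ) ≠ 0 := by positivity
      exact_mod_cast this
    have hm : z - ((k : ℂ) + 1) ≠ 0 := fun h => hzc ⟨(k : ℤ) + 1, by
      push_cast; rw [sub_eq_zero.1 h]⟩
    have hp : z + ((k : ℂ) + 1) ≠ 0 := fun h => hzc ⟨-((k : ℤ) + 1), by
      push_cast; rw [eq_neg_of_add_eq_zero_left h]⟩
    have hprod : (z - ((k : ℂ) + 1)) * (z + ((k : ℂ) + 1)) =
        -(x ^ 2 + 4 * Real.pi ^ 2 * ((k : ℝ) + 1) ^ 2) / (4 * Real.pi ^ 2) := by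
      rw [hz]
      push_cast
      field_simp
      ring_nf
      rw [Complex.I_sq]
      ring
    rw [div_add_div _ _ hm hp, hprod]
    simp only [hz]
    push_cast at hd ⊢
    field_simp
    ring_nf
    rw [Complex.I_sq]
    ring
  · have he : Real.exp x - 1 ≠ 0 := by
      have := Real.add_one_lt_exp hx.ne'
      linarith
    have he' : (Real.exp x : ℂ) - 1 ≠ 0 := by exact_mod_cast he
    have he2 : (Real.exp x : ℂ) ≠ 0 := by exact_mod_cast (Real.exp_pos x).ne'
    rw [Real.exp_neg, hz]
    push_cast at he' he2 ⊢
    have he3 : 1 - (Complex.exp x)⁻¹ ≠ 0 := by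
      intro h
      apply he'
      rw [sub_eq_zero] at h ⊢
      rw [eq_comm, inv_eq_one] at h
      exact h
    have hI := Complex.I_ne_zero
    have e1 : ((Complex.exp x)⁻¹ + 1) / (Complex.I * (1 - (Complex.exp x)⁻¹)) =
      -Complex.I * ((Complex.exp x + 1) / (Complex.exp x - 1)) := by
      rw [div_eq_iff (mul_ne_zero hI he3)]
      field_simp
      rw [Complex.I_sq]
      ring
    rw [e1]
    field_simp
    rw [Complex.I_sq]
    ring

/-- Logarithm of Euler's sine product at `ix`. -/
theorem hasSum_log_one_add_sq {x : ℝ} (hx : 0 < x) :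
    HasSum (fun k : ℕ => Real.log (1 + x ^ 2 / ((k : ℝ) + 1) ^ 2))
      (Real.log (Real.sinh (Real.pi * x) / (Real.pi * x))) := by
  have hpi := Real.pi_pos
  rw [hasSum_iff_tendsto_nat_of_nonneg fun k => Real.log_nonneg (by
    have : 0 ≤ x ^ 2 / ((k : ℝ) + 1) ^ 2 := by positivity
    linarith)]
  have h1 := Complex.tendsto_euler_sin_prod (Complex.I * x)
  have h2 : Tendsto (fun n : ℕ => ∏ j ∈ Finset.range n, (1 + x ^ 2 / ((j : ℝ) + 1) ^ 2)) atTop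
      (𝓝 (Real.sinh (Real.pi * x) / (Real.pi * x))) := by
    rw [← Filter.tendsto_ofReal_iff]
    have h3 := h1.div_const (Real.pi * (Complex.I * x))
    have hpi' : (Real.pi : ℂ) ≠ 0 := by exact_mod_cast hpi.ne'
    have hxc : (x : ℂ) ≠ 0 := by exact_mod_cast hx.ne'
    have hI := Complex.I_ne_zero
    convert! h3 using 2
    · rw [mul_div_cancel_left₀ _ (by simp [hpi', hxc])]
      push_cast
      refine Finset.prod_congr rfl fun j _ => ?_
      rw [mul_pow, Complex.I_sq]
      ring
    · rw [show (Real.pi : ℂ) * (Complex.I * x) = (Real.pi * x) * Complex.I by ring,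
        Complex.sin_mul_I]
      push_cast
      field_simp
  have hs : 0 < Real.sinh (Real.pi * x) / (Real.pi * x) :=
    div_pos (Real.sinh_pos_iff.2 (by positivity)) (by positivity)
  refine ((Real.continuousAt_log hs.ne').tendsto.comp h2).congr fun n => ?_
  rw [Function.comp_apply, Real.log_prod fun j _ => by positivity]

end PartialFractions

/-! ### The trapezoidal rule with exact remainder. -/

section Trapezoid

/-- The Peano kernel of the trapezoidal rule. -/
noncomputable def trapezoidKernel (y : ℝ) : ℝ := Int.fract y * (1 - Int.fract y)

theorem abs_trapezoidKernel_le (y : ℝ) : |trapezoidKernel y| ≤ 1 := by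
  have h1 := Int.fract_nonneg y
  have h2 := (Int.fract_lt_one y).le
  rw [trapezoidKernel, abs_of_nonneg (mul_nonneg h1 (by linarith))]
  nlinarith

theorem measurable_trapezoidKernel : Measurable trapezoidKernel := by
  unfold trapezoidKernel; fun_prop

/-- The Fourier series of the second Bernoulli polynomial, subtracted from its value at `0`; the
differences `1 - cos` are the ones that occur in `cosConjLorentz`. -/
theorem hasSum_trapezoidKernel (y : ℝ) :
    HasSum (fun l : ℕ => 1 / (Real.pi ^ 2 * ((l : ℝ) + 1) ^ 2) *
      (1 - Real.cos (2 * Real.pi * ((l : ℝ) + 1) * y))) (trapezoidKernel y) := by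
  have hpi := Real.pi_pos
  have h1 := hasSum_one_div_nat_pow_mul_cos one_ne_zero (x := Int.fract y)
    ⟨Int.fract_nonneg y, (Int.fract_lt_one y).le⟩
  have h2 := hasSum_zeta_two
  have h3 := ((h2.sub h1).mul_left (1 / Real.pi ^ 2))
  have h4 := (hasSum_nat_add_iff' 1).2 h3
  refine h4.of_eq (fun l => ?_) ?_
  · have hcos : Real.cos (2 * Real.pi * ((l + 1 : ℕ) : ℝ) * Int.fract y) =
        Real.cos (2 * Real.pi * ((l : ℝ) + 1) * y) := by
      rw [Int.fract, ← Real.cos_sub_int_mul_two_pi (2 * Real.pi * ((l : ℝ) + 1) * y) ((l + 1) * ⌊y⌋)]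
      congr 1
      push_cast
      ring
    rw [mul_one, hcos]
    push_cast
    field_simp
  · simp only [trapezoidKernel, Polynomial.bernoulli, Finset.sum_range_succ, mul_one,
      Finset.range_one, Finset.sum_singleton, bernoulli_zero,
      bernoulli_one, bernoulli_two, Polynomial.map_add, Polynomial.map_monomial,
      Polynomial.eval_add, Polynomial.eval_monomial, Nat.factorial_two]
    norm_num
    field_simp
    ring

theorem sum_eq_integral_add_trapezoid {f f' f'' : ℝ → ℝ} (hf : ∀ y, HasDerivAt f (f' y) y)
    (hf' : ∀ y, HasDerivAt f' (f'' y) y) (hf'' : Continuous f'') (N : ℕ) :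
    ∑ m ∈ Finset.range N, f ((m : ℝ) + 1) = (∫ y in (0 : ℝ)..N, f y) + (f N - f 0) / 2 +
      (∫ y in (0 : ℝ)..N, f'' y * trapezoidKernel y) / 2 := by
  have hfc : Continuous f := continuous_iff_continuousAt.2 fun y => (hf y).continuousAt
  have hint : ∀ a b : ℝ, IntervalIntegrable (fun y => f'' y * trapezoidKernel y) volume a b :=
    fun a b => by
      have h1 := hf''.intervalIntegrable (μ := volume) a b
      have h2 : ∀ s : Set ℝ, AEStronglyMeasurable trapezoidKernel (volume.restrict s) :=
        fun s => measurable_trapezoidKernel.aestronglyMeasurable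
      exact ⟨h1.1.mul_bdd (h2 _) (Eventually.of_forall abs_trapezoidKernel_le),
        h1.2.mul_bdd (h2 _) (Eventually.of_forall abs_trapezoidKernel_le)⟩
  have step : ∀ m : ℕ, (∫ y in (m : ℝ)..(m + 1 : ℕ), f y) +
      (∫ y in (m : ℝ)..(m + 1 : ℕ), f'' y * trapezoidKernel y) / 2 = (f (m + 1 : ℕ) + f m) / 2 := by
    intro m
    have hm : (m : ℝ) ≤ (m + 1 : ℕ) := by exact_mod_cast m.le_succ
    have h1 : ∫ y in (m : ℝ)..(m + 1 : ℕ), f'' y * trapezoidKernel y =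
        ∫ y in (m : ℝ)..(m + 1 : ℕ), f'' y * ((y - m) * (m + 1 - y)) := by
      refine intervalIntegral.integral_congr_ae ?_
      have : ∀ᵐ y : ℝ ∂volume, y ≠ (m + 1 : ℕ) := by simp [ae_iff]
      filter_upwards [this] with y hy hy2
      rw [uIoc_of_le hm] at hy2
      have hlt : y < (m + 1 : ℕ) := lt_of_le_of_ne hy2.2 hy
      have hfl : ⌊y⌋ = (m : ℤ) := by
        rw [Int.floor_eq_iff]
        push_cast at hlt ⊢
        exact ⟨hy2.1.le, hlt⟩
      rw [trapezoidKernel, Int.fract, hfl]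
      push_cast
      ring
    -- This antiderivative records both integrations by parts at once. The kernel vanishes at the
    -- endpoints, so only the values of `f` survive there.
    have h2 : ∀ y ∈ uIcc (m : ℝ) (m + 1 : ℕ), HasDerivAt
        (fun y => f' y * ((y - m) * (m + 1 - y)) / 2 - f y * (2 * m + 1 - 2 * y) / 2)
        (f y + f'' y * ((y - m) * (m + 1 - y)) / 2) y := by
      intro y _
      refine ((((hf' y).mul (((hasDerivAt_id y).sub_const (m : ℝ)).mul
        ((hasDerivAt_id y).const_sub ((m : ℝ) + 1)))).div_const 2).sub
        (((hf y).mul (((hasDerivAt_id y).const_mul 2).const_sub (2 * (m : ℝ) + 1))).div_const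
          2)).congr_deriv ?_
      simp only [id, Pi.mul_apply]
      ring
    have hc : Continuous fun y => f'' y * ((y - m) * (m + 1 - y)) := by fun_prop
    have h3 := intervalIntegral.integral_eq_sub_of_hasDerivAt h2
      ((hfc.add (hc.div_const 2)).intervalIntegrable _ _)
    rw [intervalIntegral.integral_add (hfc.intervalIntegrable _ _)
      ((hc.div_const 2).intervalIntegrable _ _), intervalIntegral.integral_div] at h3
    rw [h1, h3]
    push_cast
    ring
  induction N with
  | zero => simp
  | succ N ih =>
    rw [Finset.sum_range_succ, ih, ← intervalIntegral.integral_add_adjacent_intervals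
      (hfc.intervalIntegrable 0 N) (hfc.intervalIntegrable N (N + 1 : ℕ)),
      ← intervalIntegral.integral_add_adjacent_intervals (hint 0 N) (hint N (N + 1 : ℕ))]
    have := step N
    push_cast at this ⊢
    linarith

end Trapezoid

/-! ### The trapezoidal rule applied to `y/(y² + c²)`. -/

section ScaledConjLorentz

variable {c : ℝ}

/-- The second derivative of `y ↦ y / (y² + c²)`. -/
noncomputable def scaledConjLorentzDeriv2 (c y : ℝ) : ℝ := conjLorentzDeriv2 (y / c) / c ^ 3

theorem continuous_scaledConjLorentzDeriv2 (c : ℝ) : Continuous (scaledConjLorentzDeriv2 c) :=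
  (quadDecay_conjLorentzDeriv2.cont.comp (continuous_id.div_const c)).div_const _

theorem integrableOn_scaledConjLorentzDeriv2 (hc : 0 < c) :
    IntegrableOn (scaledConjLorentzDeriv2 c) (Ioi 0) := by
  have h := (integrableOn_Ioi_comp_mul_left_iff conjLorentzDeriv2 0 (inv_pos.2 hc)).2
    (by simpa using quadDecay_conjLorentzDeriv2.integrableOn)
  refine (h.div_const (c ^ 3)).congr (Eventually.of_forall fun y => ?_)
  simp only [scaledConjLorentzDeriv2, div_eq_inv_mul y c]

theorem integral_scaledConjLorentzDeriv2_comp (hc : 0 < c) (w : ℝ → ℝ) :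
    ∫ y in Ioi (0 : ℝ), scaledConjLorentzDeriv2 c y * w y =
      (∫ x in Ioi (0 : ℝ), conjLorentzDeriv2 x * w (c * x)) / c ^ 2 := by
  have h := integral_comp_mul_left_Ioi (fun y => scaledConjLorentzDeriv2 c y * w y) 0 hc
  rw [mul_zero, smul_eq_mul] at h
  have h2 : ∀ x, scaledConjLorentzDeriv2 c (c * x) * w (c * x) =
      (c ^ 3)⁻¹ * (conjLorentzDeriv2 x * w (c * x)) := fun x => by
    rw [scaledConjLorentzDeriv2, mul_div_cancel_left₀ _ hc.ne']; ring
  simp_rw [h2] at h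
  rw [integral_const_mul] at h
  rw [eq_inv_mul_iff_mul_eq₀ hc.ne'] at h
  rw [← h]
  field_simp

theorem integral_abs_scaledConjLorentzDeriv2 (hc : 0 < c) :
    ∫ y in Ioi (0 : ℝ), |scaledConjLorentzDeriv2 c y| =
      (∫ x in Ioi (0 : ℝ), |conjLorentzDeriv2 x|) / c ^ 2 := by
  have h := integral_comp_mul_left_Ioi (fun y => |scaledConjLorentzDeriv2 c y|) 0 hc
  rw [mul_zero, smul_eq_mul] at h
  have h2 : ∀ x, |scaledConjLorentzDeriv2 c (c * x)| =
      (c ^ 3)⁻¹ * |conjLorentzDeriv2 x| := fun x => by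
    rw [scaledConjLorentzDeriv2, mul_div_cancel_left₀ _ hc.ne', abs_div,
      abs_of_pos (pow_pos hc 3)]; ring
  simp_rw [h2] at h
  rw [integral_const_mul] at h
  rw [eq_inv_mul_iff_mul_eq₀ hc.ne'] at h
  rw [← h]
  field_simp

theorem integrableOn_scaledConjLorentzDeriv2_mul_trapezoidKernel (hc : 0 < c) :
    IntegrableOn (fun y => scaledConjLorentzDeriv2 c y * trapezoidKernel y) (Ioi 0) :=
  (integrableOn_scaledConjLorentzDeriv2 hc).mul_bdd
    measurable_trapezoidKernel.aestronglyMeasurable (Eventually.of_forall abs_trapezoidKernel_le)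

/-- Uniformity in `N` and the decay `1/c²`, with `c` proportional to `k + 1` later on, give the
dominating series for exchanging the sum over `k` with `N → ∞`. -/
theorem abs_integral_scaledConjLorentzDeriv2_mul_trapezoidKernel_le (hc : 0 < c) (N : ℕ) :
    |∫ y in (0 : ℝ)..N, scaledConjLorentzDeriv2 c y * trapezoidKernel y| ≤
      (∫ x in Ioi (0 : ℝ), |conjLorentzDeriv2 x|) / c ^ 2 := by
  rw [← integral_abs_scaledConjLorentzDeriv2 hc, intervalIntegral.integral_of_le N.cast_nonneg,
    ← Real.norm_eq_abs]
  refine (norm_integral_le_of_norm_le ((integrableOn_scaledConjLorentzDeriv2 hc).mono_set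
    Ioc_subset_Ioi_self).norm (Eventually.of_forall fun y => ?_)).trans ?_
  · rw [norm_mul]
    exact mul_le_of_le_one_right (norm_nonneg _) (abs_trapezoidKernel_le y)
  · exact setIntegral_mono_set (integrableOn_scaledConjLorentzDeriv2 hc).norm
      (Eventually.of_forall fun y => norm_nonneg _) Ioc_subset_Ioi_self.eventuallyLE

/-- Insert the Fourier series of the Peano kernel. After rescaling by `c`, the `l`-th mode has
frequency `2π(l+1)c`, and its coefficient differs from the normalisation `z⁻²` of `cosConjLorentz`
by the factor `4`. -/
theorem hasSum_integral_scaledConjLorentzDeriv2_mul_trapezoidKernel (hc : 0 < c) :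
    HasSum (fun l : ℕ => 4 * cosConjLorentz (2 * Real.pi * ((l : ℝ) + 1) * c))
      (∫ y in Ioi (0 : ℝ), scaledConjLorentzDeriv2 c y * trapezoidKernel y) := by
  have hpi := Real.pi_pos
  set F : ℕ → ℝ → ℝ := fun l y => scaledConjLorentzDeriv2 c y *
    (1 / (Real.pi ^ 2 * ((l : ℝ) + 1) ^ 2) * (1 - Real.cos (2 * Real.pi * ((l : ℝ) + 1) * y)))
  have hb : ∀ (l : ℕ) (y : ℝ), ‖1 / (Real.pi ^ 2 * ((l : ℝ) + 1) ^ 2) *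
      (1 - Real.cos (2 * Real.pi * ((l : ℝ) + 1) * y))‖ ≤
      2 / Real.pi ^ 2 * (1 / ((l : ℝ) + 1) ^ 2) := by
    intro l y
    rw [norm_mul, Real.norm_of_nonneg (by positivity), Real.norm_eq_abs]
    have : |1 - Real.cos (2 * Real.pi * ((l : ℝ) + 1) * y)| ≤ 2 := by
      rw [abs_le]
      constructor <;> linarith [Real.neg_one_le_cos (2 * Real.pi * ((l : ℝ) + 1) * y),
        Real.cos_le_one (2 * Real.pi * ((l : ℝ) + 1) * y)]
    calc _ ≤ 1 / (Real.pi ^ 2 * ((l : ℝ) + 1) ^ 2) * 2 := by gcongr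
      _ = _ := by field_simp
  have hi := integrableOn_scaledConjLorentzDeriv2 hc
  have hFi : ∀ l, IntegrableOn (F l) (Ioi 0) := fun l =>
    hi.mul_bdd (by
      have : Continuous fun y => 1 / (Real.pi ^ 2 * ((l : ℝ) + 1) ^ 2) *
        (1 - Real.cos (2 * Real.pi * ((l : ℝ) + 1) * y)) := by fun_prop
      exact this.aestronglyMeasurable) (Eventually.of_forall (hb l))
  have hsum2 : Summable fun l : ℕ => 1 / ((l : ℝ) + 1) ^ 2 := by
    have := (summable_nat_add_iff 1).2 (Real.summable_one_div_nat_pow.2 one_lt_two)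
    exact_mod_cast this
  have hs : Summable fun l => ∫ y in Ioi (0 : ℝ), ‖F l y‖ := by
    refine Summable.of_nonneg_of_le (fun l => integral_nonneg fun y => norm_nonneg _) (fun l => ?_)
      (((hsum2.mul_left (2 / Real.pi ^ 2))).mul_left
        (∫ y in Ioi (0 : ℝ), ‖scaledConjLorentzDeriv2 c y‖))
    rw [← integral_mul_const]
    refine integral_mono_of_nonneg (Eventually.of_forall fun y => norm_nonneg _)
      (hi.norm.mul_const _) (Eventually.of_forall fun y => ?_)
    simp only [F]
    rw [norm_mul]
    exact mul_le_mul_of_nonneg_left (hb l y) (norm_nonneg _)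
  refine (hasSum_integral_of_summable_integral_norm hFi hs).of_eq (fun l => ?_) ?_
  · rw [integral_scaledConjLorentzDeriv2_comp hc, cosConjLorentz]
    have : ∀ x, conjLorentzDeriv2 x * (1 / (Real.pi ^ 2 * ((l : ℝ) + 1) ^ 2) *
        (1 - Real.cos (2 * Real.pi * ((l : ℝ) + 1) * (c * x)))) =
        1 / (Real.pi ^ 2 * ((l : ℝ) + 1) ^ 2) * (conjLorentzDeriv2 x *
          (1 - Real.cos (2 * Real.pi * ((l : ℝ) + 1) * c * x))) := fun x => by
      rw [← mul_assoc (2 * Real.pi * ((l : ℝ) + 1)) c x]; ring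
    simp_rw [this]
    rw [integral_const_mul]
    field_simp
    ring
  · refine integral_congr_ae (Eventually.of_forall fun y => ?_)
    exact (((hasSum_trapezoidKernel y).mul_left _).tsum_eq).symm

theorem hasDerivAt_scaledConjLorentz (hc : 0 < c) (y : ℝ) :
    HasDerivAt (fun y => y / (y ^ 2 + c ^ 2)) (conjLorentzDeriv (y / c) / c ^ 2) y := by
  have h := (((hasDerivAt_conjLorentz (y / c)).comp y ((hasDerivAt_id y).div_const c)).div_const c)
  have he : (fun y => y / (y ^ 2 + c ^ 2)) = fun y => (conjLorentz ∘ fun y => id y / c) y / c := by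
    ext y
    simp only [conjLorentz, Function.comp_apply, id]
    have : y ^ 2 + c ^ 2 ≠ 0 := by positivity
    have : 1 + (y / c) ^ 2 ≠ 0 := by positivity
    field_simp
    ring
  rw [he]
  refine h.congr_deriv ?_
  field_simp

theorem hasDerivAt_scaledConjLorentzDeriv (y : ℝ) :
    HasDerivAt (fun y => conjLorentzDeriv (y / c) / c ^ 2) (scaledConjLorentzDeriv2 c y) y := by
  refine (((hasDerivAt_conjLorentzDeriv (y / c)).comp y
    ((hasDerivAt_id y).div_const c)).div_const (c ^ 2)).congr_deriv ?_
  rw [scaledConjLorentzDeriv2]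
  ring

theorem sum_scaledConjLorentz (hc : 0 < c) (N : ℕ) :
    ∑ m ∈ Finset.range N, ((m : ℝ) + 1) / (((m : ℝ) + 1) ^ 2 + c ^ 2) =
      1 / 2 * Real.log (1 + (N : ℝ) ^ 2 / c ^ 2) + 1 / 2 * ((N : ℝ) / ((N : ℝ) ^ 2 + c ^ 2)) +
      1 / 2 * ∫ y in (0 : ℝ)..N, scaledConjLorentzDeriv2 c y * trapezoidKernel y := by
  have h := sum_eq_integral_add_trapezoid (hasDerivAt_scaledConjLorentz hc)
    hasDerivAt_scaledConjLorentzDeriv (continuous_scaledConjLorentzDeriv2 c) N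
  have hd : ∀ y ∈ uIcc (0 : ℝ) N, HasDerivAt (fun y => 1 / 2 * Real.log (1 + y ^ 2 / c ^ 2))
      (y / (y ^ 2 + c ^ 2)) y := by
    intro y _
    have hp : 1 + y ^ 2 / c ^ 2 ≠ 0 := by positivity
    have hp2 : y ^ 2 + c ^ 2 ≠ 0 := by positivity
    refine (((((hasDerivAt_pow 2 y).div_const (c ^ 2)).const_add 1).log hp).const_mul
      (1 / 2)).congr_deriv ?_
    field_simp
    push_cast
    ring
  have hcont : Continuous fun y => y / (y ^ 2 + c ^ 2) :=
    continuous_iff_continuousAt.2 fun y => (hasDerivAt_scaledConjLorentz hc y).continuousAt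
  have hI := intervalIntegral.integral_eq_sub_of_hasDerivAt hd (hcont.intervalIntegrable _ _)
  rw [hI] at h
  rw [h]
  simp
  ring

end ScaledConjLorentz

/-! ### Evaluation of the Lambert series. -/

section LambertSeries

theorem summable_one_div_succ_sq : Summable fun k : ℕ => 1 / ((k : ℝ) + 1) ^ 2 := by
  have := (summable_nat_add_iff 1).2 (Real.summable_one_div_nat_pow.2 one_lt_two)
  exact_mod_cast this

variable {t : ℝ}

theorem hasSum_exp_mul_sub_one_inv (ht : 0 < t) {y : ℝ} (hy : 0 < y) :
    HasSum (fun k : ℕ => 2 / t * (y / (y ^ 2 + (2 * Real.pi / t * ((k : ℝ) + 1)) ^ 2)))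
      (1 / (Real.exp (y * t) - 1) - 1 / (y * t) + 1 / 2) := by
  refine (hasSum_exp_sub_one_inv (mul_pos hy ht)).of_eq (fun k => ?_) rfl
  have hpi := Real.pi_pos
  have h1 : (y * t) ^ 2 + 4 * Real.pi ^ 2 * ((k : ℝ) + 1) ^ 2 ≠ 0 := by positivity
  have h2 : y ^ 2 + (2 * Real.pi / t * ((k : ℝ) + 1)) ^ 2 =
    ((y * t) ^ 2 + 4 * Real.pi ^ 2 * ((k : ℝ) + 1) ^ 2) / t ^ 2 := by field_simp; ring
  rw [h2]
  field_simp

/-- Keeping the `m`-sum finite allows the two summations to be exchanged freely. The main terms `½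
log(1 + N²/c²)` add up over `k` to a logarithm of `sinh`, and the endpoint terms add up to the
partial fraction series at `N`. -/
theorem sum_exp_sub_one_inv (ht : 0 < t) {N : ℕ} (hN : 0 < N) :
    ∑ m ∈ Finset.range N, 1 / (Real.exp (((m : ℝ) + 1) * t) - 1) =
      ((harmonic N : ℝ) - Real.log N) / t - Real.log t / t + Real.log (1 - Real.exp (-(N * t))) / t +
      1 / 2 * (1 / (Real.exp (N * t) - 1) - 1 / (N * t) + 1 / 2) +
      1 / t * ∑' k : ℕ, ∫ y in (0 : ℝ)..N,
        scaledConjLorentzDeriv2 (2 * Real.pi / t * ((k : ℝ) + 1)) y * trapezoidKernel y := by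
  have hpi := Real.pi_pos
  have hN0 : (0 : ℝ) < N := by exact_mod_cast hN
  set a := 2 * Real.pi / t with ha
  have ha0 : 0 < a := by positivity
  have hak : ∀ k : ℕ, 0 < a * ((k : ℝ) + 1) := fun k => by positivity
  have h1 : HasSum (fun k : ℕ => ∑ m ∈ Finset.range N,
      2 / t * (((m : ℝ) + 1) / (((m : ℝ) + 1) ^ 2 + (a * ((k : ℝ) + 1)) ^ 2)))
      (∑ m ∈ Finset.range N, (1 / (Real.exp (((m : ℝ) + 1) * t) - 1) - 1 / (((m : ℝ) + 1) * t) +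
        1 / 2)) :=
    hasSum_sum fun m _ => hasSum_exp_mul_sub_one_inv ht (by positivity)
  have h2 := hasSum_log_one_add_sq (div_pos hN0 ha0)
  have h3 := hasSum_exp_mul_sub_one_inv ht hN0
  have h4 : Summable fun k : ℕ => ∫ y in (0 : ℝ)..N,
      scaledConjLorentzDeriv2 (a * ((k : ℝ) + 1)) y * trapezoidKernel y := by
    refine Summable.of_norm_bounded (summable_one_div_succ_sq.mul_left
      ((∫ x in Ioi (0 : ℝ), |conjLorentzDeriv2 x|) / a ^ 2)) fun k => ?_
    refine (abs_integral_scaledConjLorentzDeriv2_mul_trapezoidKernel_le (hak k) N).trans_eq ?_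
    rw [mul_pow]
    field_simp
  have h5 := ((h2.mul_left (1 / t)).add (h3.mul_left (1 / 2))).add (h4.hasSum.mul_left (1 / t))
  have h6 := h1.unique (h5.of_eq (fun k => by
    have e1 : ((N : ℝ) / a) ^ 2 / ((k : ℝ) + 1) ^ 2 = (N : ℝ) ^ 2 / (a * ((k : ℝ) + 1)) ^ 2 := by
      rw [mul_pow, div_pow, div_div]
    rw [← Finset.mul_sum, sum_scaledConjLorentz (hak k) N, e1]
    ring) rfl)
  have h7 : ∑ m ∈ Finset.range N, (1 / (Real.exp (((m : ℝ) + 1) * t) - 1) - 1 / (((m : ℝ) + 1) * t) +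
      1 / 2) = ∑ m ∈ Finset.range N, 1 / (Real.exp (((m : ℝ) + 1) * t) - 1) -
      (harmonic N : ℝ) / t + N / 2 := by
    rw [Finset.sum_add_distrib, Finset.sum_sub_distrib, harmonic, Rat.cast_sum, Finset.sum_div]
    simp only [Finset.sum_const, Finset.card_range, nsmul_eq_mul]
    push_cast
    congr 1
    · congr 1
      refine Finset.sum_congr rfl fun m _ => ?_
      field_simp
    · ring
  -- The term `N t / 2`, divided by `t`, cancels the sum of the constants `1/2`, and `log N` will
  -- combine with `harmonic N` to produce `γ`.
  have h8 : Real.log (Real.sinh (Real.pi * (N / a)) / (Real.pi * (N / a))) =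
      N * t / 2 + Real.log (1 - Real.exp (-(N * t))) - Real.log N - Real.log t := by
    have hx : Real.pi * (N / a) = N * t / 2 := by rw [ha]; field_simp
    have hlt : Real.exp (-(N * t)) < 1 := by
      rw [Real.exp_lt_one_iff]
      have := mul_pos hN0 ht
      linarith
    have hp : 0 < 1 - Real.exp (-(N * t)) := by linarith
    have hs : Real.sinh (N * t / 2) / (N * t / 2) =
        Real.exp (N * t / 2) * (1 - Real.exp (-(N * t))) / (N * t) := by
      rw [Real.sinh_eq, mul_sub, ← Real.exp_add,
        show N * t / 2 + -(N * t) = -(N * t / 2) by ring]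
      field_simp
    rw [hx, hs, Real.log_div (by positivity) (by positivity),
      Real.log_mul (Real.exp_pos _).ne' hp.ne', Real.log_exp, Real.log_mul hN0.ne' ht.ne']
    ring
  rw [h7, h8] at h6
  have h9 : 1 / t * (N * t / 2 + Real.log (1 - Real.exp (-(N * t))) - Real.log N - Real.log t) =
      N / 2 + Real.log (1 - Real.exp (-(N * t))) / t - Real.log N / t - Real.log t / t := by
    field_simp
  rw [h9] at h6
  rw [sub_div]
  linarith

theorem tendsto_nat_mul_atTop (ht : 0 < t) : Tendsto (fun N : ℕ => (N : ℝ) * t) atTop atTop :=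
  tendsto_natCast_atTop_atTop.atTop_mul_const ht

theorem hasSum_exp_mul_nat_sub_one_inv (ht : 0 < t) :
    HasSum (fun m : ℕ => 1 / (Real.exp (((m : ℝ) + 1) * t) - 1))
      ((Real.eulerMascheroniConstant - Real.log t) / t + 1 / 4 + 1 / t * ∑' k : ℕ,
        ∫ y in Ioi (0 : ℝ),
          scaledConjLorentzDeriv2 (2 * Real.pi / t * ((k : ℝ) + 1)) y * trapezoidKernel y) := by
  have hpi := Real.pi_pos
  have hexp1 : ∀ m : ℕ, 0 < Real.exp (((m : ℝ) + 1) * t) - 1 := fun m => by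
    have := Real.add_one_lt_exp (x := ((m : ℝ) + 1) * t) (by positivity)
    have : 0 < ((m : ℝ) + 1) * t := by positivity
    linarith
  rw [hasSum_iff_tendsto_nat_of_nonneg fun m => by have := hexp1 m; positivity]
  set a := 2 * Real.pi / t with ha
  have ha0 : 0 < a := by positivity
  have hak : ∀ k : ℕ, 0 < a * ((k : ℝ) + 1) := fun k => by positivity
  have hNt := tendsto_nat_mul_atTop ht
  have l1 : Tendsto (fun N : ℕ => ((harmonic N : ℝ) - Real.log N) / t - Real.log t / t) atTop
      (𝓝 (Real.eulerMascheroniConstant / t - Real.log t / t)) :=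
    (Real.tendsto_harmonic_sub_log.div_const t).sub_const _
  have l2 : Tendsto (fun N : ℕ => Real.log (1 - Real.exp (-(N * t))) / t) atTop (𝓝 0) := by
    have h1 : Tendsto (fun N : ℕ => 1 - Real.exp (-(N * t))) atTop (𝓝 (1 - 0)) :=
      (Real.tendsto_exp_neg_atTop_nhds_zero.comp hNt).const_sub 1
    have h2 := ((Real.continuousAt_log (by norm_num : (1 - 0 : ℝ) ≠ 0)).tendsto.comp h1).div_const t
    simpa using h2
  -- The endpoint correction at `N` is the source of the constant `1/4`, hence of `f̃(0)/4`.
  have l3 : Tendsto (fun N : ℕ => 1 / 2 * (1 / (Real.exp (N * t) - 1) - 1 / (N * t) + 1 / 2)) atTop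
      (𝓝 (1 / 4)) := by
    have h1 : Tendsto (fun N : ℕ => 1 / (Real.exp (N * t) - 1)) atTop (𝓝 0) := by
      have := tendsto_atTop_add_const_right _ (-1 : ℝ) (Real.tendsto_exp_atTop.comp hNt)
      simpa [one_div, sub_eq_add_neg] using! this.inv_tendsto_atTop
    have h2 : Tendsto (fun N : ℕ => 1 / ((N : ℝ) * t)) atTop (𝓝 0) := by
      simpa only [one_div] using! hNt.inv_tendsto_atTop
    have := ((h1.sub h2).add_const (1 / 2)).const_mul (1 / 2)
    convert! this using 2
    norm_num
  have l4 : Tendsto (fun N : ℕ => ∑' k : ℕ, ∫ y in (0 : ℝ)..N,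
        scaledConjLorentzDeriv2 (a * ((k : ℝ) + 1)) y * trapezoidKernel y) atTop
      (𝓝 (∑' k : ℕ, ∫ y in Ioi (0 : ℝ),
          scaledConjLorentzDeriv2 (a * ((k : ℝ) + 1)) y * trapezoidKernel y)) := by
    refine tendsto_tsum_of_dominated_convergence (summable_one_div_succ_sq.mul_left
      ((∫ x in Ioi (0 : ℝ), |conjLorentzDeriv2 x|) / a ^ 2)) (fun k => ?_)
      (Eventually.of_forall fun N k => ?_)
    · exact intervalIntegral_tendsto_integral_Ioi 0
        (integrableOn_scaledConjLorentzDeriv2_mul_trapezoidKernel (hak k))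
        tendsto_natCast_atTop_atTop
    · refine (abs_integral_scaledConjLorentzDeriv2_mul_trapezoidKernel_le (hak k) N).trans_eq ?_
      rw [mul_pow]
      field_simp
  have l5 := ((l1.add l2).add l3).add (l4.const_mul (1 / t))
  have hval : Real.eulerMascheroniConstant / t - Real.log t / t + 0 + 1 / 4 =
      (Real.eulerMascheroniConstant - Real.log t) / t + 1 / 4 := by ring
  rw [hval] at l5
  refine l5.congr' ?_
  filter_upwards [eventually_gt_atTop 0] with N hN
  rw [sum_exp_sub_one_inv ht hN]

end LambertSeries

/-! ### From double sums to divisor sums. -/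

section DivisorSums

/-- Absolute summability over pairs permits grouping by the product `n`, and each `n` occurs once
per divisor. It is used on both sides of the transformation formula. -/
theorem hasSum_card_divisors_mul {u : ℕ+ → ℝ} (hu : Summable fun p : ℕ+ × ℕ+ => u (p.1 * p.2)) :
    HasSum (fun n : ℕ+ => ((n : ℕ).divisors.card : ℝ) * u n) (∑' m : ℕ+, ∑' l : ℕ+, u (m * l)) := by
  rw [← hu.tsum_prod]
  have h1 := (sigmaAntidiagonalEquivProd.hasSum_iff).2 hu.hasSum
  have h2 := h1.sigma fun n => hasSum_fintype _
  refine h2.of_eq (fun n => ?_) rfl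
  have : ∀ x : (Nat.divisorsAntidiagonal (n : ℕ)),
      ((fun p : ℕ+ × ℕ+ => u (p.1 * p.2)) ∘ sigmaAntidiagonalEquivProd) ⟨n, x⟩ = u n := by
    intro x
    simp only [Function.comp_apply]
    congr 1
    exact PNat.eq (Nat.mem_divisorsAntidiagonal.1 x.2).1
  simp only [this]
  rw [Finset.sum_const, nsmul_eq_mul, Finset.card_univ, Fintype.card_coe,
    ← Nat.map_div_right_divisors, Finset.card_map]

theorem hasSum_pnat_iff_succ {g : ℕ → ℝ} {s : ℝ} :
    HasSum (fun n : ℕ+ => g n) s ↔ HasSum (fun n : ℕ => g (n + 1)) s := by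
  rw [← Equiv.pnatEquivNat.symm.hasSum_iff]
  rfl

theorem summable_pnat_one_div_sq : Summable fun n : ℕ+ => 1 / (n : ℝ) ^ 2 := by
  have h := (hasSum_pnat_iff_succ (g := fun n => 1 / (n : ℝ) ^ 2)).2 (by
    simpa using! summable_one_div_succ_sq.hasSum)
  exact h.summable

variable {t : ℝ}

/-- `∫₀^∞ |D²g|`, for `g(x) = x / (1 + x²)`. -/
noncomputable def conjLorentzConst : ℝ := ∫ x in Ioi (0 : ℝ), |conjLorentzDeriv2 x|

theorem conjLorentzConst_nonneg : 0 ≤ conjLorentzConst := integral_nonneg fun _ => abs_nonneg _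

/-- The decay `n⁻²` makes the double series over products `m l` summable, and the factor `t²` more
than compensates for the `1/t` in front of the dual series. -/
theorem abs_cosConjLorentz_div_le (ht : 0 < t) (n : ℕ+) :
    |cosConjLorentz (4 * Real.pi ^ 2 * n / t)| ≤ conjLorentzConst * t ^ 2 * (1 / (n : ℝ) ^ 2) := by
  have hpi := Real.pi_gt_three
  have hn : (0 : ℝ) < n := by exact_mod_cast n.pos
  have hK := conjLorentzConst_nonneg
  refine (abs_cosConjLorentz_le (by positivity)).trans ?_
  change 2 * conjLorentzConst / _ ≤ _
  have h1 : (2 : ℝ) ≤ (4 * Real.pi ^ 2) ^ 2 := by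
    have h3 : (9 : ℝ) ≤ Real.pi ^ 2 := by nlinarith
    nlinarith
  rw [div_le_iff₀ (by positivity)]
  have h2 : conjLorentzConst * t ^ 2 * (1 / (n : ℝ) ^ 2) * (4 * Real.pi ^ 2 * n / t) ^ 2 =
      conjLorentzConst * (4 * Real.pi ^ 2) ^ 2 := by field_simp
  rw [h2]
  nlinarith

theorem summable_cosConjLorentz_mul (ht : 0 < t) :
    Summable fun p : ℕ+ × ℕ+ => cosConjLorentz (4 * Real.pi ^ 2 * ((p.1 * p.2 : ℕ+) : ℝ) / t) := by
  have h := (summable_pnat_one_div_sq.mul_of_nonneg summable_pnat_one_div_sq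
    (fun _ => by positivity) (fun _ => by positivity)).mul_left (conjLorentzConst * t ^ 2)
  refine Summable.of_norm_bounded h fun p => ?_
  refine (abs_cosConjLorentz_div_le ht _).trans_eq ?_
  push_cast
  rw [mul_pow]
  field_simp

theorem hasSum_exp_neg_mul_nat (ht : 0 < t) :
    HasSum (fun l : ℕ+ => Real.exp (-(l * t))) (1 / (Real.exp t - 1)) := by
  rw [hasSum_pnat_iff_succ (g := fun l => Real.exp (-(l * t)))]
  have h1 : Real.exp (-t) < 1 := by rw [Real.exp_lt_one_iff]; linarith
  have h2 := (hasSum_geometric_of_lt_one (Real.exp_pos _).le h1).mul_left (Real.exp (-t))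
  refine h2.of_eq (fun l => ?_) ?_
  · rw [← Real.exp_nat_mul, ← Real.exp_add]
    congr 1
    push_cast
    ring
  · rw [Real.exp_neg, eq_comm]
    have := Real.exp_pos t
    have h3 : Real.exp t - 1 ≠ 0 := by linarith [Real.add_one_lt_exp ht.ne']
    field_simp

theorem hasSum_card_divisors_mul_exp (ht : 0 < t) :
    HasSum (fun n : ℕ+ => ((n : ℕ).divisors.card : ℝ) * Real.exp (-(n * t)))
      ((Real.eulerMascheroniConstant - Real.log t) / t + 1 / 4 + 4 / t *
        ∑' n : ℕ+, ((n : ℕ).divisors.card : ℝ) * cosConjLorentz (4 * Real.pi ^ 2 * n / t)) := by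
  have hpi := Real.pi_pos
  have h1 := hasSum_exp_mul_nat_sub_one_inv ht
  have h1' : HasSum (fun m : ℕ+ => 1 / (Real.exp (m * t) - 1)) _ :=
    (hasSum_pnat_iff_succ (g := fun m => 1 / (Real.exp (m * t) - 1))).2
      (h1.of_eq (fun m => by push_cast; rfl) rfl)
  have hfib : ∀ m : ℕ+, HasSum (fun l : ℕ+ => Real.exp (-(((m * l : ℕ+) : ℝ) * t)))
      (1 / (Real.exp (m * t) - 1)) := fun m => by
    have hm : (0 : ℝ) < m := by exact_mod_cast m.pos
    refine (hasSum_exp_neg_mul_nat (mul_pos hm ht)).of_eq (fun l => ?_) rfl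
    congr 1
    push_cast
    ring
  have hs : Summable fun p : ℕ+ × ℕ+ => Real.exp (-(((p.1 * p.2 : ℕ+) : ℝ) * t)) := by
    rw [summable_prod_of_nonneg fun p => (Real.exp_pos _).le]
    exact ⟨fun m => (hfib m).summable, h1'.summable.congr fun m => ((hfib m).tsum_eq).symm⟩
  refine (hasSum_card_divisors_mul (u := fun n : ℕ+ => Real.exp (-(n * t))) hs).of_eq
    (fun n => rfl) ?_
  rw [tsum_congr fun m => (hfib m).tsum_eq, h1'.tsum_eq]
  congr 1
  have h2 := hasSum_card_divisors_mul (u := fun n : ℕ+ => cosConjLorentz (4 * Real.pi ^ 2 * n / t))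
    (summable_cosConjLorentz_mul ht)
  rw [h2.tsum_eq]
  -- With `c = 2π(k+1)/t`, the frequency `2πlc` becomes `4π²(k+1)l/t`, a function of the product
  -- only.
  have h3 : ∀ k : ℕ, ∫ y in Ioi (0 : ℝ),
      scaledConjLorentzDeriv2 (2 * Real.pi / t * ((k : ℝ) + 1)) y * trapezoidKernel y =
      4 * ∑' l : ℕ+, cosConjLorentz (4 * Real.pi ^ 2 * (((k + 1 : ℕ) : ℝ) * (l : ℕ)) / t) := by
    intro k
    have h4 := hasSum_integral_scaledConjLorentzDeriv2_mul_trapezoidKernel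
      (c := 2 * Real.pi / t * ((k : ℝ) + 1)) (by positivity)
    rw [← tsum_mul_left]
    refine (((hasSum_pnat_iff_succ (g := fun l : ℕ => 4 * cosConjLorentz
      (4 * Real.pi ^ 2 * (((k + 1 : ℕ) : ℝ) * (l : ℕ)) / t))).2
      (h4.of_eq (fun l => ?_) rfl)).tsum_eq).symm
    push_cast
    congr 2
    field_simp
    ring
  rw [tsum_congr h3, tsum_mul_left, ← mul_assoc]
  have h5 : 4 / t = 1 / t * 4 := by ring
  rw [h5]
  congr 1
  rw [← Equiv.pnatEquivNat.symm.tsum_eq]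
  refine tsum_congr fun k => tsum_congr fun l => ?_
  rw [PNat.mul_coe, Nat.cast_mul]
  rfl

theorem summable_card_divisors_div_sq :
    Summable fun n : ℕ+ => ((n : ℕ).divisors.card : ℝ) * (1 / (n : ℝ) ^ 2) := by
  refine (hasSum_card_divisors_mul (u := fun n : ℕ+ => 1 / (n : ℝ) ^ 2) ?_).summable
  refine (summable_pnat_one_div_sq.mul_of_nonneg summable_pnat_one_div_sq
    (fun _ => by positivity) (fun _ => by positivity)).congr fun p => ?_
  push_cast
  field_simp

end DivisorSums

/-! ### Fubini for integrals against the Laplace transform. -/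

section LaplaceFubini

/-- A function supported in `(0, T]`, integrable against the weight `(1 + |log t|) / t`. -/
structure LogIntegrable (f : ℝ → ℂ) (T : ℝ) : Prop where
  pos : 0 < T
  zero : ∀ t : ℝ, T < t → f t = 0
  meas : AEStronglyMeasurable f (volume.restrict (Ioi 0))
  int : IntegrableOn (fun t : ℝ => ‖f t‖ * ((1 + |Real.log t|) / t)) (Ioi 0)

namespace LogIntegrable

variable {f : ℝ → ℂ} {T : ℝ}

theorem norm_mul_le (hf : LogIntegrable f T) {φ : ℝ → ℂ} {C : ℝ}
    (hφ : ∀ t ∈ Ioc 0 T, ‖φ t‖ ≤ C * ((1 + |Real.log t|) / t)) {t : ℝ} (ht : 0 < t) :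
    ‖φ t * f t‖ ≤ C * (‖f t‖ * ((1 + |Real.log t|) / t)) := by
  rw [norm_mul]
  by_cases h : t ≤ T
  · refine (mul_le_mul_of_nonneg_right (hφ t ⟨ht, h⟩) (norm_nonneg _)).trans_eq ?_
    ring
  · simp [hf.zero t (not_le.1 h)]

theorem integrableOn_mul (hf : LogIntegrable f T) {φ : ℝ → ℂ} {C : ℝ}
    (hm : AEStronglyMeasurable φ (volume.restrict (Ioi 0)))
    (hφ : ∀ t ∈ Ioc 0 T, ‖φ t‖ ≤ C * ((1 + |Real.log t|) / t)) :
    IntegrableOn (fun t => φ t * f t) (Ioi 0) :=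
  (hf.int.const_mul C).mono' (hm.mul hf.meas) ((ae_restrict_iff' measurableSet_Ioi).2
    (Eventually.of_forall fun _ ht => hf.norm_mul_le hφ ht))

/-- Bounded functions of `t` are thereby dominated by the weight too; this covers the exponentials
that define the transform itself. -/
theorem one_le_mul_weight (hf : LogIntegrable f T) {t : ℝ} (ht : t ∈ Ioc 0 T) :
    1 ≤ T * ((1 + |Real.log t|) / t) := by
  have h1 : 1 / t ≤ (1 + |Real.log t|) / t := by
    have := ht.1
    gcongr
    linarith [abs_nonneg (Real.log t)]
  calc (1 : ℝ) ≤ T * (1 / t) := by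
        rw [mul_one_div, le_div_iff₀ ht.1, one_mul]; exact ht.2
    _ ≤ _ := mul_le_mul_of_nonneg_left h1 hf.pos.le

theorem integrableOn_exp_mul (hf : LogIntegrable f T) (s : ℂ) :
    IntegrableOn (fun t : ℝ => Complex.exp (-s * (t : ℂ)) * f t) (Ioi 0) := by
  refine hf.integrableOn_mul (C := Real.exp (‖s‖ * T) * T) ?_ fun t ht => ?_
  · have : Continuous fun t : ℝ => Complex.exp (-s * (t : ℂ)) := by fun_prop
    exact this.aestronglyMeasurable
  · rw [Complex.norm_exp, mul_assoc]
    have h1 : (-s * (t : ℂ)).re ≤ ‖s‖ * T := by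
      refine (Complex.re_le_norm _).trans ?_
      rw [norm_mul, norm_neg, Complex.norm_real, Real.norm_of_nonneg ht.1.le]
      exact mul_le_mul_of_nonneg_left ht.2 (norm_nonneg _)
    calc Real.exp (-s * (t : ℂ)).re ≤ Real.exp (‖s‖ * T) * 1 := by
          rw [mul_one]; exact Real.exp_le_exp.2 h1
      _ ≤ _ := mul_le_mul_of_nonneg_left (hf.one_le_mul_weight ht) (Real.exp_pos _).le

variable {G : ℝ → ℝ} {C : ℝ}

/-- Tonelli with `k` integrated first: the weighted bound on the transform of `‖G‖` is exactly what
`f` can absorb, and `f` vanishes beyond `T`. -/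
theorem integrable_prod (hf : LogIntegrable f T)
    (hG : AEStronglyMeasurable G (volume.restrict (Ioi 0)))
    (hGi : ∀ t : ℝ, 0 < t → IntegrableOn (fun k => G k * Real.exp (-t * k)) (Ioi 0))
    (hGb : ∀ t ∈ Ioc 0 T, ∫ k in Ioi (0 : ℝ), ‖G k‖ * Real.exp (-t * k) ≤
      C * ((1 + |Real.log t|) / t)) :
    Integrable (fun p : ℝ × ℝ => ((G p.1 * Real.exp (-p.2 * p.1) : ℝ) : ℂ) * f p.2)
      ((volume.restrict (Ioi 0)).prod (volume.restrict (Ioi 0))) := by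
  have hm : AEStronglyMeasurable
      (fun p : ℝ × ℝ => ((G p.1 * Real.exp (-p.2 * p.1) : ℝ) : ℂ) * f p.2)
      ((volume.restrict (Ioi 0)).prod (volume.restrict (Ioi 0))) := by
    have he : Continuous fun p : ℝ × ℝ => Real.exp (-p.2 * p.1) := by fun_prop
    exact (Complex.continuous_ofReal.comp_aestronglyMeasurable
      (hG.comp_fst.mul he.aestronglyMeasurable)).mul hf.meas.comp_snd
  have hnorm : ∀ t : ℝ, ∫ k in Ioi (0 : ℝ), ‖((G k * Real.exp (-t * k) : ℝ) : ℂ) * f t‖ =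
      (∫ k in Ioi (0 : ℝ), ‖G k‖ * Real.exp (-t * k)) * ‖f t‖ := fun t => by
    rw [← integral_mul_const]
    refine integral_congr_ae (Eventually.of_forall fun k => ?_)
    simp only
    rw [norm_mul, Complex.norm_real, norm_mul, Real.norm_of_nonneg (Real.exp_pos _).le]
  rw [integrable_prod_iff' hm]
  refine ⟨(ae_restrict_iff' measurableSet_Ioi).2 (Eventually.of_forall fun t ht => ?_), ?_⟩
  · exact (hGi t ht).ofReal.mul_const (f t)
  · refine (hf.int.const_mul C).mono' hm.norm.prod_swap.integral_prod_right'
      ((ae_restrict_iff' measurableSet_Ioi).2 (Eventually.of_forall fun t ht => ?_))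
    rw [Real.norm_of_nonneg (integral_nonneg fun _ => norm_nonneg _)]
    simp only [hnorm]
    by_cases h : t ≤ T
    · refine (mul_le_mul_of_nonneg_right (hGb t ⟨ht, h⟩) (norm_nonneg _)).trans_eq ?_
      ring
    · simp [hf.zero t (not_le.1 h)]

theorem mul_laplaceTransform_eq (k : ℝ) :
    ∫ t in Ioi (0 : ℝ), ((G k * Real.exp (-t * k) : ℝ) : ℂ) * f t =
      (G k : ℂ) * laplaceTransform f (k : ℂ) := by
  rw [laplaceTransform, ← integral_const_mul]
  refine integral_congr_ae (Eventually.of_forall fun t => ?_)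
  simp only
  push_cast
  rw [mul_assoc]
  congr 3
  ring

theorem integrableOn_mul_laplaceTransform (hf : LogIntegrable f T)
    (hG : AEStronglyMeasurable G (volume.restrict (Ioi 0)))
    (hGi : ∀ t : ℝ, 0 < t → IntegrableOn (fun k => G k * Real.exp (-t * k)) (Ioi 0))
    (hGb : ∀ t ∈ Ioc 0 T, ∫ k in Ioi (0 : ℝ), ‖G k‖ * Real.exp (-t * k) ≤
      C * ((1 + |Real.log t|) / t)) :
    IntegrableOn (fun k : ℝ => (G k : ℂ) * laplaceTransform f (k : ℂ)) (Ioi 0) :=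
  (hf.integrable_prod hG hGi hGb).integral_prod_left.congr
    (Eventually.of_forall fun k => mul_laplaceTransform_eq k)

theorem integrableOn_integral_mul (hf : LogIntegrable f T)
    (hG : AEStronglyMeasurable G (volume.restrict (Ioi 0)))
    (hGi : ∀ t : ℝ, 0 < t → IntegrableOn (fun k => G k * Real.exp (-t * k)) (Ioi 0))
    (hGb : ∀ t ∈ Ioc 0 T, ∫ k in Ioi (0 : ℝ), ‖G k‖ * Real.exp (-t * k) ≤
      C * ((1 + |Real.log t|) / t)) :
    IntegrableOn (fun t : ℝ => ((∫ k in Ioi (0 : ℝ), G k * Real.exp (-t * k) : ℝ) : ℂ) * f t)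
      (Ioi 0) :=
  (hf.integrable_prod hG hGi hGb).integral_prod_right.congr
    (Eventually.of_forall fun t => by
      simp only
      rw [integral_mul_const, integral_complex_ofReal])

theorem integral_mul_laplaceTransform (hf : LogIntegrable f T)
    (hG : AEStronglyMeasurable G (volume.restrict (Ioi 0)))
    (hGi : ∀ t : ℝ, 0 < t → IntegrableOn (fun k => G k * Real.exp (-t * k)) (Ioi 0))
    (hGb : ∀ t ∈ Ioc 0 T, ∫ k in Ioi (0 : ℝ), ‖G k‖ * Real.exp (-t * k) ≤
      C * ((1 + |Real.log t|) / t)) :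
    ∫ k in Ioi (0 : ℝ), (G k : ℂ) * laplaceTransform f (k : ℂ) =
      ∫ t in Ioi (0 : ℝ), ((∫ k in Ioi (0 : ℝ), G k * Real.exp (-t * k) : ℝ) : ℂ) * f t := by
  simp_rw [← mul_laplaceTransform_eq]
  rw [integral_integral_swap (hf.integrable_prod hG hGi hGb)]
  refine integral_congr_ae (Eventually.of_forall fun t => ?_)
  simp only
  rw [integral_mul_const, integral_complex_ofReal]

end LogIntegrable

end LaplaceFubini

/-! ### The Laplace transform of the kernel `log k + 2γ`. -/

section LogKernel

variable {t : ℝ}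

theorem integrableOn_log_add_mul_exp (ht : 0 < t) (c : ℝ) :
    IntegrableOn (fun k => (Real.log k + c) * Real.exp (-t * k)) (Ioi 0) := by
  refine ((integrableOn_log_mul_pow_mul_exp_neg_mul ht 0).add
    ((integrableOn_pow_mul_exp_neg_mul ht 0).const_mul c)).congr (Eventually.of_forall fun k => ?_)
  simp only [Pi.add_apply, pow_zero, one_mul]
  ring

theorem integral_log_add_mul_exp (ht : 0 < t) :
    ∫ k in Ioi (0 : ℝ), (Real.log k + 2 * Real.eulerMascheroniConstant) * Real.exp (-t * k) =
      (Real.eulerMascheroniConstant - Real.log t) / t := by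
  have h := integral_add (integrableOn_log_mul_pow_mul_exp_neg_mul ht 0)
    ((integrableOn_pow_mul_exp_neg_mul ht 0).const_mul (2 * Real.eulerMascheroniConstant))
  rw [integral_log_mul_pow_mul_exp_neg_mul ht, integral_const_mul,
    integral_pow_mul_exp_neg_mul ht] at h
  simp only [pow_zero, one_mul, ← add_mul] at h
  rw [h]
  simp
  field_simp
  ring

theorem exists_integral_norm_log_add_mul_exp_le (c : ℝ) :
    ∃ C : ℝ, ∀ t : ℝ, 0 < t → ∫ k in Ioi (0 : ℝ), ‖Real.log k + c‖ * Real.exp (-t * k) ≤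
      C * ((1 + |Real.log t|) / t) := by
  obtain ⟨C, hC, h⟩ := exists_integral_one_add_abs_log_mul_exp_le
  refine ⟨(1 + |c|) * C, fun t ht => ?_⟩
  have h1 := integral_mono_of_nonneg (μ := volume.restrict (Ioi (0 : ℝ)))
    (f := fun k : ℝ => ‖Real.log k + c‖ * Real.exp (-t * k))
    (Eventually.of_forall fun u => by positivity)
    ((integrableOn_one_add_abs_log_mul_exp ht).const_mul (1 + |c|))
    (Eventually.of_forall fun k => by
      simp only
      rw [← mul_assoc]
      refine mul_le_mul_of_nonneg_right ?_ (Real.exp_pos _).le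
      rw [Real.norm_eq_abs]
      have := abs_add_le (Real.log k) c
      nlinarith [abs_nonneg (Real.log k), abs_nonneg c])
  refine h1.trans ?_
  rw [integral_const_mul, mul_assoc]
  exact mul_le_mul_of_nonneg_left (h t ht) (by positivity)

end LogKernel

/-! ### Voronoï summation for exponentials, then for Laplace transforms. -/

section VoronoiSummation

variable {f : ℝ → ℂ} {T : ℝ}

/-- The Voronoï summation formula for the exponential `e^{-tk}`, as one series. -/
theorem hasSum_voronoi_exp {t : ℝ} (ht : 0 < t) (z : ℂ) :
    HasSum (fun n : ℕ+ => ((n : ℕ).divisors.card : ℂ) * (Complex.exp (-(n : ℂ) * (t : ℂ)) * z) -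
      2 * Real.pi * (((n : ℕ).divisors.card : ℂ) *
        (((∫ k in Ioi (0 : ℝ), voronoiKernel n k * Real.exp (-t * k) : ℝ) : ℂ) * z)))
      (((∫ k in Ioi (0 : ℝ), (Real.log k + 2 * Real.eulerMascheroniConstant) *
        Real.exp (-t * k) : ℝ) : ℂ) * z + 1 / 4 * z) := by
  have h1 := hasSum_card_divisors_mul_exp ht
  have hs : Summable fun n : ℕ+ => ((n : ℕ).divisors.card : ℝ) *
      cosConjLorentz (4 * Real.pi ^ 2 * n / t) :=
    (hasSum_card_divisors_mul (u := fun n : ℕ+ => cosConjLorentz (4 * Real.pi ^ 2 * n / t))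
      (summable_cosConjLorentz_mul ht)).summable
  have h2 := h1.sub (hs.hasSum.mul_left (4 / t))
  rw [add_sub_cancel_right] at h2
  have h3 := (Complex.hasSum_ofReal.2 h2).mul_right z
  rw [integral_log_add_mul_exp ht]
  refine h3.of_eq (fun n => ?_) ?_
  · rw [integral_voronoiKernel_mul_exp n ht]
    have htc : (t : ℂ) ≠ 0 := by exact_mod_cast ht.ne'
    have hpc : (Real.pi : ℂ) ≠ 0 := by exact_mod_cast Real.pi_ne_zero
    push_cast
    rw [neg_mul]
    field_simp
    ring
  · push_cast
    ring

/-- The transformation formula itself gives the growth of the divisor series as `t → 0`: its main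
term has the size of the weight, and the dual part is `O(t)`. The terms are nonnegative, so all
finite partial sums inherit the bound. -/
theorem exists_sum_card_divisors_mul_exp_le (hT : 0 < T) :
    ∃ C : ℝ, ∀ t ∈ Ioc 0 T, ∀ s : Finset ℕ+,
      ∑ n ∈ s, ((n : ℕ).divisors.card : ℝ) * Real.exp (-(n * t)) ≤
        C * ((1 + |Real.log t|) / t) := by
  set D := ∑' n : ℕ+, ((n : ℕ).divisors.card : ℝ) * (1 / (n : ℝ) ^ 2)
  have hD : 0 ≤ D := tsum_nonneg fun n => by positivity
  have hK := conjLorentzConst_nonneg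
  refine ⟨|Real.eulerMascheroniConstant| + 1 + T / 4 + 4 * conjLorentzConst * T ^ 2 * D,
    fun t ht s => ?_⟩
  have ht0 := ht.1
  refine ((hasSum_card_divisors_mul_exp ht0).summable.sum_le_tsum s
    (fun n _ => by positivity)).trans ?_
  rw [(hasSum_card_divisors_mul_exp ht0).tsum_eq]
  have h1 : ∑' n : ℕ+, ((n : ℕ).divisors.card : ℝ) * cosConjLorentz (4 * Real.pi ^ 2 * n / t) ≤
      conjLorentzConst * t ^ 2 * D := by
    refine (Real.le_norm_self _).trans (tsum_of_norm_bounded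
      (summable_card_divisors_div_sq.hasSum.mul_left (conjLorentzConst * t ^ 2)) fun n => ?_)
    rw [norm_mul, Real.norm_natCast]
    calc _ ≤ ((n : ℕ).divisors.card : ℝ) * (conjLorentzConst * t ^ 2 * (1 / (n : ℝ) ^ 2)) :=
          mul_le_mul_of_nonneg_left (abs_cosConjLorentz_div_le ht0 n) (by positivity)
      _ = _ := by ring
  have hl := abs_nonneg (Real.log t)
  have h2 : (Real.eulerMascheroniConstant - Real.log t) / t ≤
      (|Real.eulerMascheroniConstant| + 1) * ((1 + |Real.log t|) / t) := by
    rw [← mul_div_assoc]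
    gcongr
    nlinarith [le_abs_self Real.eulerMascheroniConstant, neg_abs_le (Real.log t),
      abs_nonneg Real.eulerMascheroniConstant]
  have hw : 1 / t ≤ (1 + |Real.log t|) / t := by gcongr; linarith
  have h3 : (1 : ℝ) / 4 ≤ T / 4 * ((1 + |Real.log t|) / t) := by
    calc (1 : ℝ) / 4 ≤ T / 4 * (1 / t) := by
          rw [mul_one_div, div_div, div_le_div_iff₀ (by norm_num) (by positivity)]
          linarith [ht.2]
      _ ≤ _ := mul_le_mul_of_nonneg_left hw (by linarith)
  have h4 : 4 / t * ∑' n : ℕ+, ((n : ℕ).divisors.card : ℝ) *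
      cosConjLorentz (4 * Real.pi ^ 2 * n / t) ≤
      4 * conjLorentzConst * T ^ 2 * D * ((1 + |Real.log t|) / t) := by
    calc _ ≤ 4 / t * (conjLorentzConst * t ^ 2 * D) := mul_le_mul_of_nonneg_left h1 (by positivity)
      _ = 4 * conjLorentzConst * t ^ 2 * D * (1 / t) := by ring
      _ ≤ _ := by
        gcongr
        exact ht.2
  rw [add_mul, add_mul]
  linarith

namespace LogIntegrable

/-- Finite partial sums are integrated against `‖f‖` and bounded uniformly; nonnegativity turns this
into summability. -/
theorem summable_integral_norm_divisor_exp (hf : LogIntegrable f T) :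
    Summable fun n : ℕ+ => ∫ t in Ioi (0 : ℝ),
      ‖((n : ℕ).divisors.card : ℂ) * (Complex.exp (-(n : ℂ) * (t : ℂ)) * f t)‖ := by
  obtain ⟨C, hC⟩ := exists_sum_card_divisors_mul_exp_le hf.pos
  have hi : ∀ n : ℕ+, IntegrableOn (fun t : ℝ =>
      ‖((n : ℕ).divisors.card : ℂ) * (Complex.exp (-(n : ℂ) * (t : ℂ)) * f t)‖) (Ioi 0) :=
    fun n => ((hf.integrableOn_exp_mul n).const_mul _).norm
  refine summable_of_sum_le (fun n => integral_nonneg fun t => norm_nonneg _)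
    (c := ∫ t in Ioi (0 : ℝ), C * (‖f t‖ * ((1 + |Real.log t|) / t))) fun s => ?_
  rw [← integral_finsetSum _ fun n _ => hi n]
  refine setIntegral_mono_on (integrable_finsetSum _ fun n _ => hi n) (hf.int.const_mul C)
    measurableSet_Ioi fun t ht => ?_
  have hnorm : ∀ n : ℕ+, ‖((n : ℕ).divisors.card : ℂ) * (Complex.exp (-(n : ℂ) * (t : ℂ)) * f t)‖ =
      ((n : ℕ).divisors.card : ℝ) * Real.exp (-(n * t)) * ‖f t‖ := fun n => by
    rw [norm_mul, norm_mul, Complex.norm_natCast, Complex.norm_exp, ← mul_assoc]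
    congr 3
    rw [show (-(n : ℂ) * (t : ℂ)) = ((-(n * t) : ℝ) : ℂ) by push_cast; ring, Complex.ofReal_re]
  simp only [hnorm]
  rw [← Finset.sum_mul]
  by_cases h : t ≤ T
  · refine (mul_le_mul_of_nonneg_right (hC t ⟨ht, h⟩ s) (norm_nonneg _)).trans_eq ?_
    ring
  · simp [hf.zero t (not_le.1 h)]

theorem voronoiKernel_bound (hf : LogIntegrable f T) (n : ℕ+) :
    ∃ C : ℝ, ∀ t ∈ Ioc 0 T, ∫ k in Ioi (0 : ℝ), ‖voronoiKernel n k‖ * Real.exp (-t * k) ≤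
      C * ((1 + |Real.log t|) / t) :=
  exists_integral_norm_voronoiKernel_mul_exp_le n hf.pos

/-- The norm is taken after the `k`-integral, where the closed form already contains the
cancellation between `K₀` and `Y₀` and decays like `n⁻²`. This leaves the convergent series `∑
d(n)/n²`. -/
theorem summable_integral_norm_voronoiKernel (hf : LogIntegrable f T) :
    Summable fun n : ℕ+ => ∫ t in Ioi (0 : ℝ), ‖((n : ℕ).divisors.card : ℂ) *
      (((∫ k in Ioi (0 : ℝ), voronoiKernel n k * Real.exp (-t * k) : ℝ) : ℂ) * f t)‖ := by
  have hpi := Real.pi_pos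
  have hK := conjLorentzConst_nonneg
  set K := 2 / Real.pi * conjLorentzConst * T ^ 2
  refine Summable.of_nonneg_of_le (fun n => integral_nonneg fun t => norm_nonneg _) (fun n => ?_)
    (summable_card_divisors_div_sq.mul_right
      (K * ∫ t in Ioi (0 : ℝ), ‖f t‖ * ((1 + |Real.log t|) / t)))
  rw [← integral_const_mul, ← integral_const_mul]
  refine integral_mono_of_nonneg (Eventually.of_forall fun t => norm_nonneg _)
    ((hf.int.const_mul _).const_mul _)
    ((ae_restrict_iff' measurableSet_Ioi).2 (Eventually.of_forall fun t ht => ?_))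
  simp only
  rw [norm_mul, Complex.norm_natCast, mul_assoc]
  refine mul_le_mul_of_nonneg_left ?_ (Nat.cast_nonneg _)
  rw [← mul_assoc]
  refine hf.norm_mul_le (φ := fun t => ((∫ k in Ioi (0 : ℝ), voronoiKernel n k *
    Real.exp (-t * k) : ℝ) : ℂ)) (fun t ht => ?_) ht
  have ht0 := ht.1
  rw [Complex.norm_real, integral_voronoiKernel_mul_exp n ht0, norm_mul,
    Real.norm_of_nonneg (by positivity)]
  calc 2 / (Real.pi * t) * ‖cosConjLorentz (4 * Real.pi ^ 2 * n / t)‖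
      ≤ 2 / (Real.pi * t) * (conjLorentzConst * t ^ 2 * (1 / (n : ℝ) ^ 2)) :=
        mul_le_mul_of_nonneg_left (abs_cosConjLorentz_div_le ht0 n) (by positivity)
    _ = 1 / (n : ℝ) ^ 2 * (2 / Real.pi * conjLorentzConst * t ^ 2) * (1 / t) := by field_simp
    _ ≤ 1 / (n : ℝ) ^ 2 * K * ((1 + |Real.log t|) / t) := by
        simp only [K]
        gcongr
        · exact ht.2
        · linarith [abs_nonneg (Real.log t)]

/-- The Voronoï summation formula for the Laplace transform of `f`. -/
theorem voronoi_summation (hf : LogIntegrable f T) :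
    Summable (fun n : ℕ+ => ((n : ℕ).divisors.card : ℂ) * laplaceTransform f (n : ℂ)) ∧
    IntegrableOn (fun k : ℝ => ((Real.log k + 2 * Real.eulerMascheroniConstant : ℝ) : ℂ) *
      laplaceTransform f (k : ℂ)) (Ioi 0) ∧
    (∀ n : ℕ+, IntegrableOn
      (fun k : ℝ => (voronoiKernel n k : ℂ) * laplaceTransform f (k : ℂ)) (Ioi 0)) ∧
    Summable (fun n : ℕ+ => ((n : ℕ).divisors.card : ℂ) *
      ∫ k in Ioi (0 : ℝ), (voronoiKernel n k : ℂ) * laplaceTransform f (k : ℂ)) ∧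
    ∑' n : ℕ+, ((n : ℕ).divisors.card : ℂ) * laplaceTransform f (n : ℂ) =
      (∫ k in Ioi (0 : ℝ), ((Real.log k + 2 * Real.eulerMascheroniConstant : ℝ) : ℂ) *
        laplaceTransform f (k : ℂ))
      + laplaceTransform f 0 / 4
      + 2 * (Real.pi : ℂ) * ∑' n : ℕ+, ((n : ℕ).divisors.card : ℂ) *
          ∫ k in Ioi (0 : ℝ), (voronoiKernel n k : ℂ) * laplaceTransform f (k : ℂ) := by
  have hpi := Real.pi_pos
  set d : ℕ+ → ℂ := fun n => ((n : ℕ).divisors.card : ℂ)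
  set A : ℕ+ → ℝ → ℂ := fun n t => d n * (Complex.exp (-(n : ℂ) * (t : ℂ)) * f t) with hA
  set V : ℕ+ → ℝ → ℂ := fun n t => d n *
    (((∫ k in Ioi (0 : ℝ), voronoiKernel n k * Real.exp (-t * k) : ℝ) : ℂ) * f t) with hV
  have hAi : ∀ n, IntegrableOn (A n) (Ioi 0) := fun n => (hf.integrableOn_exp_mul n).const_mul _
  have hVi : ∀ n, IntegrableOn (V n) (Ioi 0) := fun n => by
    obtain ⟨C, hC⟩ := hf.voronoiKernel_bound n
    exact (hf.integrableOn_integral_mul (aestronglyMeasurable_voronoiKernel n)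
      (fun t ht => integrableOn_voronoiKernel_mul_exp n ht) hC).const_mul _
  have hAs := hf.summable_integral_norm_divisor_exp
  have hVs := hf.summable_integral_norm_voronoiKernel
  have hAint : ∀ n, ∫ t in Ioi (0 : ℝ), A n t = d n * laplaceTransform f (n : ℂ) := fun n => by
    rw [hA]
    simp only
    rw [integral_const_mul, laplaceTransform]
  have hVint : ∀ n, ∫ t in Ioi (0 : ℝ), V n t =
      d n * ∫ k in Ioi (0 : ℝ), (voronoiKernel n k : ℂ) * laplaceTransform f (k : ℂ) := fun n => by
    obtain ⟨C, hC⟩ := hf.voronoiKernel_bound n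
    rw [hV]
    simp only
    rw [integral_const_mul, hf.integral_mul_laplaceTransform (aestronglyMeasurable_voronoiKernel n)
      (fun t ht => integrableOn_voronoiKernel_mul_exp n ht) hC]
  have hS1 : Summable fun n => d n * laplaceTransform f (n : ℂ) := by
    refine Summable.of_norm_bounded hAs fun n => ?_
    rw [← hAint n]
    exact norm_integral_le_integral_norm _
  have hS2 : Summable fun n => d n *
      ∫ k in Ioi (0 : ℝ), (voronoiKernel n k : ℂ) * laplaceTransform f (k : ℂ) := by
    refine Summable.of_norm_bounded hVs fun n => ?_
    rw [← hVint n]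
    exact norm_integral_le_integral_norm _
  obtain ⟨C₀, hC₀⟩ := exists_integral_norm_log_add_mul_exp_le (2 * Real.eulerMascheroniConstant)
  have hlogm : AEStronglyMeasurable (fun k => Real.log k + 2 * Real.eulerMascheroniConstant)
      (volume.restrict (Ioi 0)) := by
    have : Measurable (fun k => Real.log k + 2 * Real.eulerMascheroniConstant) := by fun_prop
    exact this.aestronglyMeasurable
  have hlogb : ∀ t ∈ Ioc 0 T, ∫ k in Ioi (0 : ℝ),
      ‖Real.log k + 2 * Real.eulerMascheroniConstant‖ * Real.exp (-t * k) ≤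
      C₀ * ((1 + |Real.log t|) / t) := fun t ht => hC₀ t ht.1
  refine ⟨hS1, hf.integrableOn_mul_laplaceTransform hlogm
    (fun t ht => integrableOn_log_add_mul_exp ht _) hlogb, fun n => ?_, hS2, ?_⟩
  · obtain ⟨C, hC⟩ := hf.voronoiKernel_bound n
    exact hf.integrableOn_mul_laplaceTransform (aestronglyMeasurable_voronoiKernel n)
      (fun t ht => integrableOn_voronoiKernel_mul_exp n ht) hC
  -- integrate the exponential case of the formula termwise against `f`
  have hUs : Summable fun n => ∫ t in Ioi (0 : ℝ), ‖A n t - 2 * Real.pi * V n t‖ := by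
    refine Summable.of_nonneg_of_le (fun n => integral_nonneg fun t => norm_nonneg _) (fun n => ?_)
      (hAs.add (hVs.mul_left (2 * Real.pi)))
    rw [← integral_const_mul, ← integral_add (hAi n).norm ((hVi n).norm.const_mul _)]
    refine integral_mono_of_nonneg (Eventually.of_forall fun t => norm_nonneg _)
      ((hAi n).norm.add ((hVi n).norm.const_mul _)) (Eventually.of_forall fun t => ?_)
    refine (norm_sub_le _ _).trans_eq ?_
    simp only
    rw [norm_mul (2 * (Real.pi : ℂ))]
    congr 2
    rw [show (2 * (Real.pi : ℂ)) = ((2 * Real.pi : ℝ) : ℂ) by push_cast; rfl, Complex.norm_real,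
      Real.norm_of_nonneg (by positivity)]
  have key : HasSum (fun n => ∫ t in Ioi (0 : ℝ), (A n t - 2 * Real.pi * V n t))
      (∫ t in Ioi (0 : ℝ), ∑' n, (A n t - 2 * Real.pi * V n t)) :=
    hasSum_integral_of_summable_integral_norm
    (fun n => (hAi n).sub ((hVi n).const_mul (2 * (Real.pi : ℂ)))) hUs
  -- The factor `e^{-0·t}` is inserted so that the constant `1/4` integrates visibly to `f̃(0)/4`.
  have hpt : ∀ t ∈ Ioi (0 : ℝ), ∑' n, (A n t - 2 * Real.pi * V n t) =
      ((∫ k in Ioi (0 : ℝ), (Real.log k + 2 * Real.eulerMascheroniConstant) *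
        Real.exp (-t * k) : ℝ) : ℂ) * f t + 1 / 4 * (Complex.exp (-0 * (t : ℂ)) * f t) := by
    intro t ht
    rw [(hasSum_voronoi_exp ht (f t)).tsum_eq]
    simp
  have hIlog := hf.integrableOn_integral_mul hlogm
    (fun t ht => integrableOn_log_add_mul_exp ht _) hlogb
  have key2 := key.tsum_eq
  have hL : ∀ n, ∫ t in Ioi (0 : ℝ), (A n t - 2 * Real.pi * V n t) =
      d n * laplaceTransform f (n : ℂ) - 2 * Real.pi * (d n *
        ∫ k in Ioi (0 : ℝ), (voronoiKernel n k : ℂ) * laplaceTransform f (k : ℂ)) := fun n => by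
    rw [integral_sub (hAi n) ((hVi n).const_mul _), hAint, integral_const_mul, hVint]
  have key3 : ∑' n, (d n * laplaceTransform f (n : ℂ) - 2 * Real.pi * (d n *
        ∫ k in Ioi (0 : ℝ), (voronoiKernel n k : ℂ) * laplaceTransform f (k : ℂ))) =
      (∫ k in Ioi (0 : ℝ), ((Real.log k + 2 * Real.eulerMascheroniConstant : ℝ) : ℂ) *
        laplaceTransform f (k : ℂ)) + laplaceTransform f 0 / 4 := by
    rw [← tsum_congr hL]
    refine key2.trans ?_
    refine (setIntegral_congr_fun measurableSet_Ioi hpt).trans ?_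
    rw [integral_add hIlog ((hf.integrableOn_exp_mul 0).const_mul _), integral_const_mul,
      hf.integral_mul_laplaceTransform hlogm
        (fun t ht => integrableOn_log_add_mul_exp ht _) hlogb, laplaceTransform]
    ring
  rw [(hS1.hasSum.sub (hS2.hasSum.mul_left (2 * (Real.pi : ℂ)))).tsum_eq] at key3
  rw [← key3]
  ring

end LogIntegrable

end VoronoiSummation

theorem theorem147 (f : ℝ → ℂ) (hf : IsLFunction f) (hreg : IsRegulatedOnPos f)
    (hsupp : ∃ T : ℝ, ∀ t : ℝ, T < t → f t = 0)
    (B : ℂ) (β : ℝ) (hβ : 0 < β) (L : ℝ → ℝ) (hL : IsSlowlyVaryingAtZero L)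
    (hasymp : Tendsto (fun t : ℝ => f t / ((t ^ β * L t : ℝ) : ℂ)) (𝓝[>] 0) (𝓝 B)) :
    -- the Laplace transform converges everywhere
    (∀ s : ℂ, IntegrableOn (fun t : ℝ => Complex.exp (-s * (t : ℂ)) * f t) (Ioi 0)) ∧
    -- all series and integrals in the formula converge
    Summable (fun n : ℕ+ => ((n : ℕ).divisors.card : ℂ) * laplaceTransform f (n : ℂ)) ∧
    IntegrableOn (fun k : ℝ => ((Real.log k + 2 * Real.eulerMascheroniConstant : ℝ) : ℂ) *
      laplaceTransform f (k : ℂ)) (Ioi 0) ∧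
    (∀ n : ℕ+, IntegrableOn
      (fun k : ℝ => (voronoiKernel n k : ℂ) * laplaceTransform f (k : ℂ)) (Ioi 0)) ∧
    Summable (fun n : ℕ+ => ((n : ℕ).divisors.card : ℂ) *
      ∫ k in Ioi (0 : ℝ), (voronoiKernel n k : ℂ) * laplaceTransform f (k : ℂ)) ∧
    -- the summation formula
    ∑' n : ℕ+, ((n : ℕ).divisors.card : ℂ) * laplaceTransform f (n : ℂ) =
      (∫ k in Ioi (0 : ℝ), ((Real.log k + 2 * Real.eulerMascheroniConstant : ℝ) : ℂ) *
        laplaceTransform f (k : ℂ))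
      + laplaceTransform f 0 / 4
      + 2 * (Real.pi : ℂ) * ∑' n : ℕ+, ((n : ℕ).divisors.card : ℂ) *
          ∫ k in Ioi (0 : ℝ), (voronoiKernel n k : ℂ) * laplaceTransform f (k : ℂ) := by
  obtain ⟨T, hT⟩ := hsupp
  -- The given support bound need not be positive, hence the maximum with `1`.
  have hlog : LogIntegrable f (max T 1) :=
    ⟨lt_max_of_lt_right one_pos, fun t ht => hT t ((le_max_left _ _).trans_lt ht),
      hreg.aestronglyMeasurable, integrableOn_norm_mul_log_div hreg ⟨T, hT⟩ hβ hL hasymp⟩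
  exact ⟨hlog.integrableOn_exp_mul, hlog.voronoi_summation⟩
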